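/- Let $V=\mathbb{C}^n$ and let $W\subset GL(V)$ be a finite group generated by complex reflections and acting irreducibly on $V$. Let $S=\mathbb{C}[V]$, graded with $V^*$ in degree $1$, with invariant ring $S^W$, Hilbert ideal $I=S\cdot S^W_+$ and coinvariant algebra $A=S/I$; let $H\subset S$ be the space of $W$-harmonic polynomials (those killed by all $W$-invariant constant coefficient differential operators without constant term). The degrees $d_1\le\dots\le d_n$ (resp. codegrees $d_1^*\ge\dots\ge d_n^*$) of $W$ are the degrees, with multiplicity, in which the graded space $\mathrm{Hom}_W(V,H)$ (resp. $\mathrm{Hom}_W(V^*,H)$) is nonzero, where $V$ has degree $-1$ and $V^*$ degree $1$. Assume that $W$ is a duality group: $d_i+d_i^*=d$ for all $i$, where $d=d_n$. Let $f_1,\dots,f_n$ be basic invariants (homogeneous, algebraically independent generators of $S^W$), $f_n$ being of highest degree $d$, and put $R=S/(f_1,\dots,f_{n-1})$. For $\sigma\in\mathrm{Hom}_W(V,H)$ and $\phi\in\mathrm{Hom}_W(V^*,H)$ put $\tilde\sigma=\sum_v v^*\sigma(v)\in S^W$, and let $\langle\sigma,\phi\rangle\in\mathbb{C}$ be the coefficient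 of the monomial $f_n$ in $\sum_v\sigma(v)\phi(v^*)\in S^W=\mathbb{C}[f_1,\dots,f_n]$, the sums being over a basis $\{v\}$ of $V$ with dual basis $\{v^*\}$. Then the natural maps of $S$-modules $$\mathrm{Der}_{\mathbb{C}}(S^W,S)\to\mathrm{Hom}_{\mathbb{C}}(\mathrm{Hom}_W(V,H),S),\quad \delta\mapsto(\sigma\mapsto\delta(\tilde\sigma)),$$ $$\mathrm{Hom}_W(V^*,H)\otimes S\to\mathrm{Hom}_{\mathbb{C}}(\mathrm{Hom}_W(V,H),S),\quad \phi\otimes s\mapsto(\sigma\mapsto\langle\sigma,\phi\rangle s)$$ are isomorphisms. Hence there are $S$-linear maps $\overline{J}:\mathrm{Der}_{\mathbb{C}}(S,S)\to\mathrm{Der}_{\mathbb{C}}(S^W,S)$ (the reduced Jacobian), given by $\overline{J}(\theta)(\tilde\sigma)=\sum_v\sigma(v)\theta(v^*)$, and $K:\mathrm{Der}_{\mathbb{C}}(S^W,S)\to\mathrm{Der}_{\mathbb{C}}(S,S)$, the composite of the identification $\mathrm{Der}_{\mathbb{C}}(S^W,S)\cong\mathrm{Hom}_W(V^*,H)\otimes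 S$ with the map sending $\phi\otimes s$ to the derivation $v^*\mapsto s\,\phi(v^*)$. Moreover: (1) $\overline{J}\otimes_S R$ and $K\otimes_S R$ are homogeneous of degrees $0$ and $d$, and form a matrix factorisation of $f_n$ over $R$: the modules are projective over $R$ and both composites are multiplication by $f_n$. (2) The $2$-periodic sequence $$\cdots\to\mathrm{Der}_{\mathbb{C}}(S,S)\otimes_SA\xrightarrow{\overline{J}}\mathrm{Der}_{\mathbb{C}}(S^W,S)\otimes_SA\xrightarrow{K}\mathrm{Der}_{\mathbb{C}}(S,S)\otimes_SA\xrightarrow{\overline{J}}\mathrm{Der}_{\mathbb{C}}(S^W,S)\otimes_SA\xrightarrow{\varepsilon}\mathrm{Der}_{\mathbb{C}}(A,A)\to0,$$ in which $\varepsilon$ is induced by $K$ (homogeneous of degree $d$), is a minimal free resolution of $\mathrm{Der}_{\mathbb{C}}(A,A)$ over $A$, the maps $\overline{J}$ and $K$ being homogeneous of degrees $0$ and $d$. (3) Dually, with $(-)^*=\mathrm{Hom}_A(-,A)$, the $2$-periodic sequence $$\cdots\xrightarrow{K^*}(\mathrm{Der}_{\mathbb{C}}(S^W,S)\otimes_SA)^*\xrightarrow{\overline{J}^*}(\mathrm{Der}_{\mathbb{C}}(S,S)\otimes_SA)^*\xrightarrow{\varepsilon'}\Omega^1_{A/\mathbb{C}}\to0$$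 is a minimal free resolution of $\Omega^1_{A/\mathbb{C}}$ over $A$, where $\varepsilon'$ sends the functional $\theta\otimes a\mapsto a\,\theta(p)$ to $dp$ for every $p\in S$, and $\overline{J}^*$, $K^*$, $\varepsilon'$ are homogeneous of degrees $0$, $d$, $0$. -/

import Mathlib

open scoped TensorProduct

namespace WellGenerated

/-- The ring `S = ℂ[V]` of polynomial functions on `V = ℂⁿ`; `X i` is the `i`-th coordinate. -/
abbrev PolyRing (n : ℕ) := MvPolynomial (Fin n) ℂ

section Group

variable {n : ℕ}

/-! ### The group and its representations -/

/-- The tautological representation of `W` on `V = ℂⁿ`. -/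
noncomputable def stdRep (W : Subgroup (Matrix.GeneralLinearGroup (Fin n) ℂ)) :
    Representation ℂ W (Fin n → ℂ) where
  toFun g := Matrix.toLin' (g : Matrix.GeneralLinearGroup (Fin n) ℂ).val
  map_one' := by simp [Module.End.one_eq_id]
  map_mul' g h := by simp [Matrix.toLin'_mul, Module.End.mul_eq_comp]

/-- A complex reflection: an invertible matrix whose fixed space is a hyperplane.
(Elements of a finite group have finite order automatically.) -/
def IsReflection (g : Matrix.GeneralLinearGroup (Fin n) ℂ) : Prop :=
  (g.val - 1).rank = 1

/-- `W` is a complex reflection group acting irreducibly on `ℂⁿ`. -/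
structure IsIrreducibleReflectionGroup
    (W : Subgroup (Matrix.GeneralLinearGroup (Fin n) ℂ)) : Prop where
  finite : Finite W
  generated : Subgroup.closure {g | g ∈ W ∧ IsReflection g} = W
  irreducible : (stdRep W).IsIrreducible

/-- The action of `g` on `S = ℂ[V]`, `(g p)(v) = p (g⁻¹ v)`. -/
noncomputable def polyAct (g : Matrix.GeneralLinearGroup (Fin n) ℂ) : PolyRing n →ₐ[ℂ] PolyRing n :=
  MvPolynomial.aeval fun i => ∑ j, MvPolynomial.C ((g⁻¹).val i j) * MvPolynomial.X j

/-- The action of `g` on `Sym(V) = ℂ[∂₁, …, ∂ₙ]`; here `X j` stands for the vector `e_j`,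
equivalently for the operator `∂_j`, and `g e_j = ∑ i, g i j e_i`. -/
noncomputable def symAct (g : Matrix.GeneralLinearGroup (Fin n) ℂ) : PolyRing n →ₐ[ℂ] PolyRing n :=
  MvPolynomial.aeval fun j => ∑ i, MvPolynomial.C (g.val i j) * MvPolynomial.X i

/-- The invariant ring `S^W`. -/
noncomputable def invariantRing (W : Subgroup (Matrix.GeneralLinearGroup (Fin n) ℂ)) :
    Subalgebra ℂ (PolyRing n) where
  carrier := {p | ∀ g ∈ W, polyAct g p = p}
  mul_mem' ha hb g hg := by rw [map_mul, ha g hg, hb g hg]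
  add_mem' ha hb g hg := by rw [map_add, ha g hg, hb g hg]
  algebraMap_mem' r g _ := (polyAct g).commutes r

/-- The constant coefficient differential operator `P(∂)` on `S`. -/
noncomputable def diffOp (P : PolyRing n) : PolyRing n →ₗ[ℂ] PolyRing n :=
  ∑ m ∈ P.support, P.coeff m •
    ((List.finRange n).map fun i =>
      ((MvPolynomial.pderiv i : Derivation ℂ (PolyRing n) (PolyRing n)) :
        PolyRing n →ₗ[ℂ] PolyRing n) ^ m i).prod

/-- The space `H` of harmonic polynomials: those killed by every invariant constant coefficient
differential operator without constant term. -/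
noncomputable def harmonic (W : Subgroup (Matrix.GeneralLinearGroup (Fin n) ℂ)) :
    Submodule ℂ (PolyRing n) :=
  ⨅ P ∈ {P : PolyRing n | (∀ g ∈ W, symAct g P = P) ∧ MvPolynomial.constantCoeff P = 0},
    LinearMap.ker (diffOp P)

/-- The space `Hom_W(M, H)` of `W`-equivariant linear maps from `M` to the harmonics. -/
def homHarmonic (W : Subgroup (Matrix.GeneralLinearGroup (Fin n) ℂ)) {M : Type*}
    [AddCommGroup M] [Module ℂ M] (ρ : Representation ℂ W M) :
    Submodule ℂ (M →ₗ[ℂ] PolyRing n) where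
  carrier := {σ | (∀ m, σ m ∈ harmonic W) ∧
    ∀ (g : W) (m : M), σ (ρ g m) = polyAct (g : Matrix.GeneralLinearGroup (Fin n) ℂ) (σ m)}
  add_mem' ha hb := ⟨fun m => add_mem (ha.1 m) (hb.1 m), fun g m => by
    simp [ha.2 g m, hb.2 g m]⟩
  zero_mem' := ⟨fun _ => zero_mem _, fun _ _ => by simp⟩
  smul_mem' c _ ha := ⟨fun m => Submodule.smul_mem _ c (ha.1 m), fun g m => by
    simp [ha.2 g m]⟩

/-- `Hom_W(V, H)`. -/
noncomputable abbrev HomV (W : Subgroup (Matrix.GeneralLinearGroup (Fin n) ℂ)) :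
    Submodule ℂ ((Fin n → ℂ) →ₗ[ℂ] PolyRing n) :=
  homHarmonic W (stdRep W)

/-- `Hom_W(V*, H)`. -/
noncomputable abbrev HomVDual (W : Subgroup (Matrix.GeneralLinearGroup (Fin n) ℂ)) :
    Submodule ℂ (Module.Dual ℂ (Fin n → ℂ) →ₗ[ℂ] PolyRing n) :=
  homHarmonic W (stdRep W).dual

/-! ### Degrees, codegrees, duality groups -/

/-- The degree `k` part of `S`, for `k : ℤ` (zero for `k < 0`). -/
noncomputable def polyPart (n : ℕ) (k : ℤ) : Submodule ℂ (PolyRing n) :=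
  MvPolynomial.restrictSupport ℂ {m : Fin n →₀ ℕ | (m.degree : ℤ) = k}

/-- The elements of `Hom_W(M, H)` with values in the degree `e` part of `S`. -/
noncomputable def homHarmonicPart (W : Subgroup (Matrix.GeneralLinearGroup (Fin n) ℂ)) {M : Type*}
    [AddCommGroup M] [Module ℂ M] (ρ : Representation ℂ W M) (e : ℤ) :
    Submodule ℂ (M →ₗ[ℂ] PolyRing n) where
  carrier := {σ | σ ∈ homHarmonic W ρ ∧ ∀ m, σ m ∈ polyPart n e}
  add_mem' ha hb := ⟨add_mem ha.1 hb.1, fun m => add_mem (ha.2 m) (hb.2 m)⟩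
  zero_mem' := ⟨zero_mem _, fun _ => zero_mem _⟩
  smul_mem' c _ ha := ⟨Submodule.smul_mem _ c ha.1, fun m => Submodule.smul_mem _ c (ha.2 m)⟩

/-- `d₁ ≤ ⋯ ≤ dₙ` are the degrees in which `Hom_W(V, H)` is nonzero, with multiplicity. As `V*` is
in degree `1`, `V` is in degree `-1`, so a map of degree `k` takes values in `S_{k-1}`. -/
def IsDegreeSequence (W : Subgroup (Matrix.GeneralLinearGroup (Fin n) ℂ)) (d : Fin n → ℤ) : Prop :=
  Monotone d ∧ ∀ k : ℤ, Nat.card {i // d i = k} =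
    Module.finrank ℂ (homHarmonicPart W (stdRep W) (k - 1))

/-- `d₁* ≥ ⋯ ≥ dₙ*` are the degrees in which `Hom_W(V*, H)` is nonzero, with multiplicity. -/
def IsCodegreeSequence (W : Subgroup (Matrix.GeneralLinearGroup (Fin n) ℂ)) (d : Fin n → ℤ) :
    Prop :=
  Antitone d ∧ ∀ k : ℤ, Nat.card {i // d i = k} =
    Module.finrank ℂ (homHarmonicPart W (stdRep W).dual (k + 1))

/-- Duality groups: `d_i + d_i* = d` for all `i`, where `d` is the highest degree. -/
def IsDualityGroup (W : Subgroup (Matrix.GeneralLinearGroup (Fin n) ℂ)) : Prop :=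
  ∃ deg codeg : Fin n → ℤ, IsDegreeSequence W deg ∧ IsCodegreeSequence W codeg ∧
    ∃ d : ℤ, IsGreatest (Set.range deg) d ∧ ∀ i, deg i + codeg i = d

/-- `f₁, …, fₙ` is a set of basic invariants: homogeneous, algebraically independent generators of
the algebra `S^W`. -/
structure IsBasicInvariants (W : Subgroup (Matrix.GeneralLinearGroup (Fin n) ℂ))
    (f : Fin n → PolyRing n) : Prop where
  homogeneous : ∀ i, ∃ e : ℕ, (f i).IsHomogeneous e
  algebraicIndependent : AlgebraicIndependent ℂ f
  adjoin_eq : Algebra.adjoin ℂ (Set.range f) = invariantRing W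

/-! ### The contraction `Hom_W(V, S) ⊗ Hom_W(V*, S) → S^W` -/

/-- `∑ v, σ(v) φ(v*)`, the sum over a basis of `V` and its dual basis. -/
noncomputable def contract (σ : (Fin n → ℂ) →ₗ[ℂ] PolyRing n)
    (φ : Module.Dual ℂ (Fin n → ℂ) →ₗ[ℂ] PolyRing n) : PolyRing n :=
  ∑ i, σ (Pi.single i 1) * φ (LinearMap.proj i)

/-- The inclusion `V* → S` as linear forms. -/
noncomputable def linForm (n : ℕ) : Module.Dual ℂ (Fin n → ℂ) →ₗ[ℂ] PolyRing n where
  toFun l := ∑ i, MvPolynomial.C (l (Pi.single i 1)) * MvPolynomial.X i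
  map_add' a b := by simp [add_mul, Finset.sum_add_distrib]
  map_smul' c a := by simp [Finset.smul_sum, MvPolynomial.smul_eq_C_mul, mul_assoc]

theorem stdRep_single (W : Subgroup (Matrix.GeneralLinearGroup (Fin n) ℂ)) (g : W) (i : Fin n) :
    stdRep W g (Pi.single i 1) = ∑ j, g.1.val j i • (Pi.single j 1 : Fin n → ℂ) := by
  ext k
  simp [stdRep, Pi.single_apply, Finset.sum_apply, Matrix.mulVec_single]

theorem dual_proj (W : Subgroup (Matrix.GeneralLinearGroup (Fin n) ℂ)) (g : W) (i : Fin n) :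
    (stdRep W).dual g (LinearMap.proj i) =
      ∑ k, (g.1⁻¹).val i k • (LinearMap.proj k : Module.Dual ℂ (Fin n → ℂ)) := by
  ext k
  simp [stdRep, Representation.dual_apply, Module.Dual.transpose_apply, Pi.single_apply]

theorem contract_mem (W : Subgroup (Matrix.GeneralLinearGroup (Fin n) ℂ))
    (σ : (Fin n → ℂ) →ₗ[ℂ] PolyRing n) (φ : Module.Dual ℂ (Fin n → ℂ) →ₗ[ℂ] PolyRing n)
    (hσ : ∀ (g : W) v, σ (stdRep W g v) = polyAct g.1 (σ v))
    (hφ : ∀ (g : W) v, φ ((stdRep W).dual g v) = polyAct g.1 (φ v)) :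
    contract σ φ ∈ invariantRing W := by
  intro g hg
  have key : ∀ j k, ∑ i, g.val j i * (g⁻¹).val i k = if j = k then 1 else 0 := by
    intro j k
    have h : g.val * (g⁻¹).val = 1 := by rw [← Units.val_mul, mul_inv_cancel, Units.val_one]
    rw [← Matrix.mul_apply, h, Matrix.one_apply]
  have h1 : ∀ i, polyAct g (σ (Pi.single i 1) * φ (LinearMap.proj i)) =
      ∑ j, ∑ k, (g.val j i * (g⁻¹).val i k) • (σ (Pi.single j 1) * φ (LinearMap.proj k)) := by
    intro i
    rw [map_mul, ← hσ ⟨g, hg⟩, ← hφ ⟨g, hg⟩, stdRep_single, dual_proj, map_sum, map_sum,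
      Finset.sum_mul_sum]
    simp [smul_smul, mul_comm]
  rw [contract, map_sum, Finset.sum_congr rfl fun i _ => h1 i, Finset.sum_comm]
  refine Finset.sum_congr rfl fun j _ => ?_
  rw [Finset.sum_comm]
  simp_rw [← Finset.sum_smul, key]
  simp

theorem linForm_equivariant (W : Subgroup (Matrix.GeneralLinearGroup (Fin n) ℂ)) (g : W)
    (l : Module.Dual ℂ (Fin n → ℂ)) :
    linForm n ((stdRep W).dual g l) = polyAct g.1 (linForm n l) := by
  have h : linForm n ∘ₗ (stdRep W).dual g = (polyAct g.1).toLinearMap ∘ₗ linForm n := by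
    have hp : ∀ i, linForm n (LinearMap.proj i) = MvPolynomial.X i := by
      intro i
      simp [linForm, Pi.single_apply]
    refine (Pi.basisFun ℂ (Fin n)).dualBasis.ext fun i => ?_
    have hb : (Pi.basisFun ℂ (Fin n)).dualBasis i = LinearMap.proj i := by
      ext j
      simp [Pi.single_apply]
    rw [hb, LinearMap.comp_apply, LinearMap.comp_apply, dual_proj, map_sum, hp]
    simp [hp, polyAct, MvPolynomial.smul_eq_C_mul]
  exact LinearMap.congr_fun h l

/-- The canonical map `Hom_W(V, H) → S^W`, `σ ↦ σ̃ = ∑ v, v* σ(v)`. -/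
noncomputable def toInvariant (W : Subgroup (Matrix.GeneralLinearGroup (Fin n) ℂ)) :
    HomV W →ₗ[ℂ] invariantRing W where
  toFun σ := ⟨contract σ.1 (linForm n),
    contract_mem W _ _ σ.2.2 (linForm_equivariant W)⟩
  map_add' a b := by
    ext1; simp [contract, add_mul, Finset.sum_add_distrib]
  map_smul' c a := by
    ext1; simp [contract, Finset.smul_sum]

/-- The pairing `Hom_W(V*, H) × Hom_W(V, H) → S^W`. -/
noncomputable def invariantPairing (W : Subgroup (Matrix.GeneralLinearGroup (Fin n) ℂ)) :
    HomVDual W →ₗ[ℂ] HomV W →ₗ[ℂ] invariantRing W :=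
  LinearMap.mk₂ ℂ (fun φ σ => ⟨contract σ.1 φ.1, contract_mem W _ _ σ.2.2 φ.2.2⟩)
    (fun a b c => by ext1; simp [contract, mul_add, Finset.sum_add_distrib])
    (fun r a b => by ext1; simp [contract, Finset.smul_sum])
    (fun a b c => by ext1; simp [contract, add_mul, Finset.sum_add_distrib])
    (fun r a b => by ext1; simp [contract, Finset.smul_sum])

variable {W : Subgroup (Matrix.GeneralLinearGroup (Fin n) ℂ)} {f : Fin n → PolyRing n}

/-- The projection `S^W = ℂ[f₁, …, fₙ] → ℂ` taking the coefficient of the monomial `f_t`. -/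
noncomputable def basicCoeff (hf : IsBasicInvariants W f) (t : Fin n) : invariantRing W →ₗ[ℂ] ℂ :=
  MvPolynomial.lcoeff ℂ (Finsupp.single t 1) ∘ₗ
    hf.algebraicIndependent.repr.toLinearMap ∘ₗ
      (Subalgebra.inclusion hf.adjoin_eq.ge).toLinearMap

/-- The duality pairing: the pairing into `S^W` followed by projection onto `f_t`. -/
noncomputable def dualityPairing (hf : IsBasicInvariants W f) (t : Fin n) :
    HomVDual W →ₗ[ℂ] HomV W →ₗ[ℂ] ℂ :=
  (invariantPairing W).compr₂ (basicCoeff hf t)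

/-! ### The maps `J̄` and `K` -/

variable (W) in
/-- The natural map `Der(S^W, S) → Hom_W(V, H)* ⊗ S = Hom_ℂ(Hom_W(V, H), S)` restricting a
derivation to the canonical space of generators of `S^W`. -/
noncomputable def restrictDer :
    Derivation ℂ (invariantRing W) (PolyRing n) →ₗ[PolyRing n] (HomV W →ₗ[ℂ] PolyRing n) where
  toFun δ := (δ : invariantRing W →ₗ[ℂ] PolyRing n) ∘ₗ toInvariant W
  map_add' a b := by ext; simp
  map_smul' c a := by ext; simp

variable (W) in
/-- The reduced Jacobian as a map `Der(S, S) = V ⊗ S → Hom_W(V, H)* ⊗ S`,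
`v ⊗ p ↦ ∑ σ* ⊗ σ(v) p`. -/
noncomputable def reducedJacobianAux :
    Derivation ℂ (PolyRing n) (PolyRing n) →ₗ[PolyRing n] (HomV W →ₗ[ℂ] PolyRing n) where
  toFun θ :=
    { toFun := fun σ => ∑ i, σ.1 (Pi.single i 1) * θ (MvPolynomial.X i)
      map_add' := fun a b => by simp [add_mul, Finset.sum_add_distrib]
      map_smul' := fun c a => by simp [Finset.smul_sum] }
  map_add' a b := by ext1; simp [mul_add, Finset.sum_add_distrib]
  map_smul' c a := by
    ext1; simp only [LinearMap.coe_mk, AddHom.coe_mk, Derivation.smul_apply, smul_eq_mul,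
      RingHom.id_apply, LinearMap.smul_apply, Finset.mul_sum, mul_left_comm]

/-- The map `Hom_W(V*, H) ⊗ S → Hom_W(V, H)* ⊗ S` given by the duality pairing. -/
noncomputable def pairingMap (hf : IsBasicInvariants W f) (t : Fin n) :
    (PolyRing n ⊗[ℂ] HomVDual W) →ₗ[PolyRing n] (HomV W →ₗ[ℂ] PolyRing n) :=
  LinearMap.liftBaseChange (PolyRing n)
    ((dualityPairing hf t).compr₂ (Algebra.linearMap ℂ (PolyRing n)))

variable (W) in
/-- The map `K' : Hom_W(V*, H) ⊗ S → V ⊗ S = Der(S, S)`; `φ ⊗ 1` goes to the derivation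
extending `φ : V* → S`. -/
noncomputable def multMap :
    (PolyRing n ⊗[ℂ] HomVDual W) →ₗ[PolyRing n] Derivation ℂ (PolyRing n) (PolyRing n) :=
  LinearMap.liftBaseChange (PolyRing n)
    { toFun := fun φ : HomVDual W =>
        MvPolynomial.mkDerivation ℂ fun i => φ.1 (LinearMap.proj i)
      map_add' := fun a b => by ext; simp
      map_smul' := fun c a => by ext; simp }

/-- The reduced Jacobian `J̄ : Der(S, S) → Der(S^W, S)`. -/
noncomputable def reducedJacobian (hr : Function.Bijective (restrictDer W)) :
    Derivation ℂ (PolyRing n) (PolyRing n) →ₗ[PolyRing n] Derivation ℂ (invariantRing W) (PolyRing n) :=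
  (LinearEquiv.ofBijective (restrictDer W) hr).symm.toLinearMap ∘ₗ reducedJacobianAux W

/-- The map `K : Der(S^W, S) ≅ Hom_W(V, H)* ⊗ S ≅ Hom_W(V*, H) ⊗ S → Der(S, S)`. -/
noncomputable def pairingK (hf : IsBasicInvariants W f) (t : Fin n)
    (hp : Function.Bijective (pairingMap hf t)) :
    Derivation ℂ (invariantRing W) (PolyRing n) →ₗ[PolyRing n] Derivation ℂ (PolyRing n) (PolyRing n) :=
  multMap W ∘ₗ (LinearEquiv.ofBijective (pairingMap hf t) hp).symm.toLinearMap ∘ₗ restrictDer W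

/-! ### The quotient rings -/

/-- The ideal `(f_i : i ≠ t)` of `S`. -/
noncomputable def otherInvariantsIdeal (f : Fin n → PolyRing n) (t : Fin n) : Ideal (PolyRing n) :=
  Ideal.span (f '' {i | i ≠ t})

/-- The Hilbert ideal `I = S · S^W_+`. -/
noncomputable def hilbertIdeal (W : Subgroup (Matrix.GeneralLinearGroup (Fin n) ℂ)) : Ideal (PolyRing n) :=
  Ideal.span {p | p ∈ invariantRing W ∧ MvPolynomial.constantCoeff p = 0}

/-- The coinvariant algebra `A = S / I`. -/
abbrev Coinvariants (W : Subgroup (Matrix.GeneralLinearGroup (Fin n) ℂ)) :=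
  PolyRing n ⧸ hilbertIdeal W

/-- The irrelevant (maximal) ideal `A_+`. -/
noncomputable def irrelevant (W : Subgroup (Matrix.GeneralLinearGroup (Fin n) ℂ)) : Ideal (Coinvariants W) :=
  Ideal.map (Ideal.Quotient.mk (hilbertIdeal W)) (Ideal.span (Set.range MvPolynomial.X))

/-! ### Gradings (given through their sets of homogeneous elements) -/

/-- `φ` is homogeneous of degree `d`. -/
def IsHomogeneousMap {M N : Type*} (G : ℤ → Set M) (G' : ℤ → Set N) (φ : M → N) (d : ℤ) : Prop :=
  ∀ k, ∀ x ∈ G k, φ x ∈ G' (k + d)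

/-- Degree `k` elements of `S / I`. -/
def quotPart (I : Ideal (PolyRing n)) (k : ℤ) : Set (PolyRing n ⧸ I) :=
  Ideal.Quotient.mk I '' (polyPart n k : Set (PolyRing n))

/-- Derivations `S → S` of degree `k`. -/
def derPart (n : ℕ) (k : ℤ) : Set (Derivation ℂ (PolyRing n) (PolyRing n)) :=
  {θ | ∀ j, ∀ p ∈ polyPart n j, θ p ∈ polyPart n (j + k)}

/-- Derivations `S^W → S` of degree `k`. -/
def derInvPart (W : Subgroup (Matrix.GeneralLinearGroup (Fin n) ℂ)) (k : ℤ) :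
    Set (Derivation ℂ (invariantRing W) (PolyRing n)) :=
  {δ | ∀ j, ∀ p : invariantRing W, (p : PolyRing n) ∈ polyPart n j → δ p ∈ polyPart n (j + k)}

/-- Derivations `S / I → S / I` of degree `k`. -/
def derQuotPart (I : Ideal (PolyRing n)) (k : ℤ) : Set (Derivation ℂ (PolyRing n ⧸ I) (PolyRing n ⧸ I)) :=
  {θ | ∀ j, ∀ a ∈ quotPart I j, θ a ∈ quotPart I (j + k)}

/-- The degree `k` elements of `S / I ⊗ M = M / I M`, for a graded `S`-module `M`. -/
def tensorPart (I : Ideal (PolyRing n)) {M : Type*} [AddCommGroup M] [Module (PolyRing n) M]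
    (G : ℤ → Set M) (k : ℤ) : Set ((PolyRing n ⧸ I) ⊗[PolyRing n] M) :=
  (fun m => (1 : PolyRing n ⧸ I) ⊗ₜ[PolyRing n] m) '' G k

/-- The degree `k` elements of the dual of a graded `S / I`-module. -/
def dualPart (I : Ideal (PolyRing n)) {M : Type*} [AddCommGroup M] [Module (PolyRing n ⧸ I) M]
    (G : ℤ → Set M) (k : ℤ) : Set (Module.Dual (PolyRing n ⧸ I) M) :=
  {l | ∀ j, ∀ x ∈ G j, l x ∈ quotPart I (j + k)}

/-- The degree `k` part of the Kähler differentials of `S / I`, in which `D a` has the degree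
of `a`. -/
def kaehlerPart (I : Ideal (PolyRing n)) (k : ℤ) : Set (Ω[(PolyRing n ⧸ I)⁄ℂ]) :=
  (Submodule.span ℂ {ω | ∃ i j : ℤ, i + j = k ∧ ∃ a ∈ quotPart I i, ∃ b ∈ quotPart I j,
    ω = a • KaehlerDifferential.D ℂ (PolyRing n ⧸ I) b} : Submodule ℂ (Ω[(PolyRing n ⧸ I)⁄ℂ]))

/-- The functional `a ⊗ θ ↦ a θ(p)` on `S / I ⊗ Der(S, S)`: the element `dp` of
`S / I ⊗ Ω¹_S`, viewed in the dual of `S / I ⊗ Der(S, S)`. -/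
noncomputable def evalDual (I : Ideal (PolyRing n)) (p : PolyRing n) :
    Module.Dual (PolyRing n ⧸ I) ((PolyRing n ⧸ I) ⊗[PolyRing n] Derivation ℂ (PolyRing n) (PolyRing n)) :=
  LinearMap.liftBaseChange (PolyRing n ⧸ I)
    { toFun := fun θ : Derivation ℂ (PolyRing n) (PolyRing n) => Ideal.Quotient.mk I (θ p)
      map_add' := fun a b => by simp
      map_smul' := fun c a => by simp; rfl }

end Group

section Homological

variable {R : Type*} [CommRing R]

/-! ### Matrix factorisations and periodic resolutions -/

/-- `(φ, ψ)` is a matrix factorisation of `f`. -/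
structure IsMatrixFactorisation (f : R) {F₀ F₁ : Type*} [AddCommMonoid F₀] [Module R F₀]
    [AddCommMonoid F₁] [Module R F₁] (φ : F₀ →ₗ[R] F₁) (ψ : F₁ →ₗ[R] F₀) : Prop where
  projective₀ : Module.Projective R F₀
  projective₁ : Module.Projective R F₁
  comp₀ : ψ ∘ₗ φ = f • LinearMap.id
  comp₁ : φ ∘ₗ ψ = f • LinearMap.id

/-- The 2-periodic sequence
`⋯ → P₁ →[α] P₀ →[β] P₁ →[α] P₀ →[ε] M → 0`
is a minimal resolution of `M` by finitely generated free modules, `m` being the maximal ideal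
with respect to which minimality is meant. -/
structure IsPeriodicMinimalFreeResolution (m : Ideal R) {P₀ P₁ M : Type*} [AddCommMonoid P₀]
    [Module R P₀] [AddCommMonoid P₁] [Module R P₁] [AddCommMonoid M] [Module R M]
    (α : P₁ →ₗ[R] P₀) (β : P₀ →ₗ[R] P₁) (ε : P₀ →ₗ[R] M) : Prop where
  free₀ : Module.Free R P₀
  free₁ : Module.Free R P₁
  finite₀ : Module.Finite R P₀
  finite₁ : Module.Finite R P₁
  surjective : Function.Surjective ε
  exact_augmentation : Function.Exact α ε
  exact_odd : Function.Exact β α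
  exact_even : Function.Exact α β
  minimal_odd : LinearMap.range α ≤ m • (⊤ : Submodule R P₀)
  minimal_even : LinearMap.range β ≤ m • (⊤ : Submodule R P₁)

end Homological

end WellGenerated

/-!
# The reduced Jacobian of a duality group and its coinvariant algebra

Let `σ_j` and `φ_j` be homogeneous bases of `Hom_W(V, H)` and `Hom_W(V*, H)`, of degrees `d_j - 1`
and `d_j* + 1`. In the bases `∂_k` of `Der(S, S)` and the basis of `Der(S^W, S)` dual to the
invariants `σ̃_j`, the reduced Jacobian has the matrix `M` with rows `σ_j`, and, once the two bases
are dual for the duality pairing, `K` has the matrix `N` with columns `φ_j`. The entries of `M N`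
are the contractions of `σ_i` with `φ_j`. They are homogeneous invariants of degree `d_i + d_j*`, which
for a duality group lies strictly between `0` and `2d`, so modulo the other basic invariants they
are multiples of `f_t`, the factor being the duality pairing (`DualityBases.contract_sub_mem`).
Hence `M N = f_t` modulo `J = (f_i : i ≠ t)`. Since `f_t` is a nonzerodivisor modulo `J`
(`IsBasicInvariants.mem_of_mul_mem`), also `N M = f_t`, and by Eisenbud's argument
(`mulVec_eq_zero_iff_of_factorisation`) `M` and `N` and their transposes become exact over
`A = S / (J + (f_t))`.

The structure of `S` behind this is obtained from the Fischer form: `S = I + H`, so `S` is generated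
by `H` over `S^W`, and `Hom_W(M, S)` by `Hom_W(M, H)` (`exists_eq_sum_mul_basis`). Applied to the
differentials of the basic invariants, which are independent modulo `I`, this shows that the `df_i`
and the `σ_j` are related by a matrix that is invertible modulo `I`. So `d` is the degree of `f_t`,
the `σ̃_j` are basic invariants, and the first natural map is bijective.

The main point is that the duality pairing is perfect (`DualityBases.isUnit_pairing`), which makes
the second natural map bijective. Take `v` with `f_t(v) = 1` at which the other basic invariants
vanish. The pairing of `σ_i` with `φ_j` is then the value at `v` of their contraction, so it is
enough that evaluation at `v` maps both spaces bijectively to `V*` and `V`, which holds when `v` has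
a trivial stabiliser (`exists_eval_eq_of_free`). To see that it does, note that an equivariant
polynomial vector field of degree `1` modulo `d` is a multiple of the Euler field on the fibre of
`V → V / W` through `v`, because the codegrees lie between `0` and `d - 2` and the elements of
codegree `0` are scalars by Schur's lemma (`DualityBases.exists_sub_smul_X_mem`). A vector field of
this kind with derivative at `v` a multiple of `∑ (1 - h)`, the sum over the stabiliser of `v`, can
be made by averaging; comparing the two descriptions forces the stabiliser to be trivial
(`DualityBases.eq_one_of_mulVec_eq`).

As for the ends of the resolutions, the derivations of `A` are the derivations of `S` modulo `I`
killed by the `df_i` modulo `I`, that is, by `M`; by exactness they form the image of `N`. The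
differentials of `A` are the quotient of `A ⊗ Ω_S` by the `df_i`, that is, by the rows of `M`.
-/

open scoped TensorProduct

namespace WellGenerated

/-! ### Homogeneous components -/

section

variable {n : ℕ}

theorem mem_polyPart {k : ℤ} {p : PolyRing n} :
    p ∈ polyPart n k ↔ ∀ m, p.coeff m ≠ 0 → (m.degree : ℤ) = k := by
  rw [polyPart, MvPolynomial.mem_restrictSupport_iff]
  simp [Set.subset_def, MvPolynomial.mem_support_iff]

theorem coeff_eq_zero_of_mem_polyPart {k : ℤ} {p : PolyRing n} (hp : p ∈ polyPart n k)
    {m : Fin n →₀ ℕ} (hm : (m.degree : ℤ) ≠ k) : p.coeff m = 0 := by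
  by_contra h
  exact hm (mem_polyPart.1 hp m h)

theorem mem_polyPart_natCast {k : ℕ} {p : PolyRing n} :
    p ∈ polyPart n k ↔ p.IsHomogeneous k := by
  rw [mem_polyPart]
  constructor
  · intro h m hm
    rw [Finsupp.weight_apply]
    have := h m hm
    have h' : m.degree = k := by exact_mod_cast this
    rw [← h', Finsupp.degree_apply]
    simp [Finsupp.sum]
  · intro h m hm
    have := h hm
    rw [Finsupp.weight_apply] at this
    simp only [Pi.one_apply, smul_eq_mul, mul_one] at this
    exact_mod_cast this

theorem eq_zero_of_mem_polyPart_neg {k : ℤ} {p : PolyRing n} (hp : p ∈ polyPart n k)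
    (hk : k < 0) : p = 0 := by
  ext m
  rw [MvPolynomial.coeff_zero]
  exact coeff_eq_zero_of_mem_polyPart hp (by omega)

theorem monomial_mem_polyPart (m : Fin n →₀ ℕ) (c : ℂ) :
    MvPolynomial.monomial m c ∈ polyPart n (m.degree : ℤ) := by
  classical
  rw [mem_polyPart]
  intro m' h
  rw [MvPolynomial.coeff_monomial] at h
  split_ifs at h with h'
  · rw [h']
  · exact absurd rfl h

theorem C_mem_polyPart (c : ℂ) : (MvPolynomial.C c : PolyRing n) ∈ polyPart n 0 := by
  simpa using monomial_mem_polyPart (0 : Fin n →₀ ℕ) c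

theorem one_mem_polyPart : (1 : PolyRing n) ∈ polyPart n 0 := by
  simpa using C_mem_polyPart (n := n) 1

theorem X_mem_polyPart (i : Fin n) : (MvPolynomial.X i : PolyRing n) ∈ polyPart n 1 := by
  simpa [MvPolynomial.X] using monomial_mem_polyPart (Finsupp.single i 1) (1 : ℂ)

theorem mul_mem_polyPart {j k : ℤ} {p q : PolyRing n} (hp : p ∈ polyPart n j)
    (hq : q ∈ polyPart n k) : p * q ∈ polyPart n (j + k) := by
  classical
  rw [mem_polyPart]
  intro m hm
  rw [MvPolynomial.coeff_mul] at hm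
  obtain ⟨⟨a, b⟩, hab, h⟩ := Finset.exists_ne_zero_of_sum_ne_zero hm
  rw [Finset.HasAntidiagonal.mem_antidiagonal] at hab
  have ha := mem_polyPart.1 hp a (left_ne_zero_of_mul h)
  have hb := mem_polyPart.1 hq b (right_ne_zero_of_mul h)
  rw [← hab, ← ha, ← hb]
  simp

theorem pow_mem_polyPart {j : ℤ} {p : PolyRing n} (hp : p ∈ polyPart n j) (a : ℕ) :
    p ^ a ∈ polyPart n (a * j) := by
  induction a with
  | zero => simpa using one_mem_polyPart
  | succ a ih =>
    rw [pow_succ]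
    have h := mul_mem_polyPart ih hp
    rwa [show (a : ℤ) * j + j = ((a + 1 : ℕ) : ℤ) * j by push_cast; ring] at h

theorem prod_mem_polyPart {ι : Type*} (s : Finset ι) (p : ι → PolyRing n) (e : ι → ℤ)
    (h : ∀ i ∈ s, p i ∈ polyPart n (e i)) : ∏ i ∈ s, p i ∈ polyPart n (∑ i ∈ s, e i) := by
  classical
  induction s using Finset.induction_on with
  | empty => simpa using one_mem_polyPart
  | insert a s ha ih =>
    rw [Finset.prod_insert ha, Finset.sum_insert ha]
    exact mul_mem_polyPart (h a (Finset.mem_insert_self a s))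
      (ih fun i hi => h i (Finset.mem_insert_of_mem hi))

theorem C_mul_mem_polyPart {j : ℤ} (c : ℂ) {p : PolyRing n} (hp : p ∈ polyPart n j) :
    MvPolynomial.C c * p ∈ polyPart n j := by
  rw [← MvPolynomial.smul_eq_C_mul]
  exact Submodule.smul_mem _ c hp

/-- Substituting homogeneous polynomials `f i` of degree `e i` into a polynomial that is
homogeneous of degree `k` for the weights `e`. -/
theorem aeval_mem_polyPart {σ : Type*} [Fintype σ] (f : σ → PolyRing n) (e : σ → ℤ)
    (hf : ∀ i, f i ∈ polyPart n (e i)) (F : MvPolynomial σ ℂ) (k : ℤ)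
    (hF : ∀ m, F.coeff m ≠ 0 → ∑ i, (m i : ℤ) * e i = k) :
    MvPolynomial.aeval f F ∈ polyPart n k := by
  rw [MvPolynomial.aeval_def, MvPolynomial.eval₂_eq']
  refine Submodule.sum_mem _ fun m hm => ?_
  refine C_mul_mem_polyPart _ ?_
  rw [← hF m (MvPolynomial.mem_support_iff.1 hm)]
  exact prod_mem_polyPart _ _ _ fun i _ => pow_mem_polyPart (hf i) _

theorem aeval_linear_mem_polyPart (l : Fin n → PolyRing n) (hl : ∀ i, l i ∈ polyPart n 1)
    {k : ℤ} {p : PolyRing n} (hp : p ∈ polyPart n k) :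
    MvPolynomial.aeval l p ∈ polyPart n k := by
  refine aeval_mem_polyPart l (fun _ => 1) hl p k fun m hm => ?_
  rw [← mem_polyPart.1 hp m hm, Finsupp.degree_eq_sum]
  simp

theorem pderiv_mem_polyPart {k : ℤ} {p : PolyRing n} (hp : p ∈ polyPart n k) (i : Fin n) :
    MvPolynomial.pderiv i p ∈ polyPart n (k - 1) := by
  classical
  rw [mem_polyPart]
  intro m hm
  rw [MvPolynomial.coeff_pderiv] at hm
  have := mem_polyPart.1 hp _ (left_ne_zero_of_mul hm)
  rw [← this]
  simp

/-- The homogeneous component of degree `k`. -/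
noncomputable def polyComp (n : ℕ) (k : ℤ) : PolyRing n →ₗ[ℂ] PolyRing n :=
  MvPolynomial.weightedHomogeneousComponent (fun _ => (1 : ℤ)) k

theorem coeff_polyComp (k : ℤ) (p : PolyRing n) (m : Fin n →₀ ℕ) :
    (polyComp n k p).coeff m = if (m.degree : ℤ) = k then p.coeff m else 0 := by
  classical
  rw [polyComp, MvPolynomial.coeff_weightedHomogeneousComponent]
  congr 1
  rw [Finsupp.weight_apply, Finsupp.degree_apply]
  simp [Finsupp.sum]

theorem polyComp_mem (k : ℤ) (p : PolyRing n) : polyComp n k p ∈ polyPart n k := by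
  rw [mem_polyPart]
  intro m hm
  rw [coeff_polyComp] at hm
  by_contra h
  simp [h] at hm

theorem polyComp_of_mem {k : ℤ} {p : PolyRing n} (hp : p ∈ polyPart n k) :
    polyComp n k p = p := by
  ext m
  rw [coeff_polyComp]
  split_ifs with h
  · rfl
  · exact (coeff_eq_zero_of_mem_polyPart hp h).symm

theorem polyComp_of_mem_ne {j k : ℤ} {p : PolyRing n} (hp : p ∈ polyPart n j) (h : j ≠ k) :
    polyComp n k p = 0 := by
  ext m
  rw [coeff_polyComp]
  split_ifs with h'
  · rw [MvPolynomial.coeff_zero]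
    exact coeff_eq_zero_of_mem_polyPart hp (by omega)
  · rfl

theorem sum_polyComp (p : PolyRing n) {N : ℕ} (hN : p.totalDegree < N) :
    ∑ k ∈ Finset.range N, polyComp n (k : ℤ) p = p := by
  ext m
  rw [MvPolynomial.coeff_sum]
  simp_rw [coeff_polyComp, Nat.cast_inj]
  rw [Finset.sum_ite_eq]
  split_ifs with h
  · rfl
  · symm
    apply MvPolynomial.coeff_eq_zero_of_totalDegree_lt
    rw [Finset.mem_range] at h
    rw [Finsupp.degree_apply] at h
    omega

theorem polyComp_homogeneous_mul {j : ℤ} {q : PolyRing n} (hq : q ∈ polyPart n j) (k : ℤ)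
    (p : PolyRing n) : polyComp n k (q * p) = q * polyComp n (k - j) p := by
  classical
  ext m
  rw [coeff_polyComp, MvPolynomial.coeff_mul, MvPolynomial.coeff_mul,
    ← mul_boole, Finset.sum_mul]
  refine Finset.sum_congr rfl fun x hx => ?_
  rw [Finset.HasAntidiagonal.mem_antidiagonal] at hx
  rw [coeff_polyComp]
  by_cases h : q.coeff x.1 = 0
  · simp [h]
  have h1 := mem_polyPart.1 hq _ h
  have h2 : (m.degree : ℤ) = x.1.degree + x.2.degree := by rw [← hx]; simp
  by_cases h3 : (m.degree : ℤ) = k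
  · rw [if_pos h3, if_pos (by omega), mul_one]
  · rw [if_neg h3, if_neg (by omega), mul_zero, mul_zero]

theorem polyComp_comm (L : PolyRing n →ₗ[ℂ] PolyRing n)
    (hL : ∀ k : ℤ, ∀ p ∈ polyPart n k, L p ∈ polyPart n k) (k : ℤ) (p : PolyRing n) :
    polyComp n k (L p) = L (polyComp n k p) := by
  conv_lhs => rw [← sum_polyComp p (Nat.lt_succ_self _), map_sum, map_sum]
  rcases lt_or_ge k 0 with hk | hk
  · rw [eq_zero_of_mem_polyPart_neg (polyComp_mem k p) hk, map_zero]
    exact Finset.sum_eq_zero fun i _ =>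
      polyComp_of_mem_ne (hL _ _ (polyComp_mem _ _)) (by omega)
  lift k to ℕ using hk
  by_cases hN : k < p.totalDegree.succ
  · rw [Finset.sum_eq_single_of_mem k (Finset.mem_range.2 hN)
      fun i _ hi => polyComp_of_mem_ne (hL _ _ (polyComp_mem _ _)) (by exact_mod_cast hi),
      polyComp_of_mem (hL _ _ (polyComp_mem _ _))]
  · rw [Finset.sum_eq_zero fun i hi => polyComp_of_mem_ne (hL _ _ (polyComp_mem _ _)) (by
      rw [Finset.mem_range] at hi; omega)]
    have : polyComp n (k : ℤ) p = 0 := by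
      ext m
      rw [coeff_polyComp]
      split_ifs with h
      · rw [MvPolynomial.coeff_zero]
        apply MvPolynomial.coeff_eq_zero_of_totalDegree_lt
        rw [Finsupp.degree_apply] at h
        have : (∑ i ∈ m.support, m i) = k := by exact_mod_cast h
        omega
      · rfl
    rw [this, map_zero]

theorem constantCoeff_of_mem_polyPart {k : ℤ} {p : PolyRing n} (hp : p ∈ polyPart n k)
    (hk : k ≠ 0) : MvPolynomial.constantCoeff p = 0 := by
  rw [MvPolynomial.constantCoeff_eq]
  exact coeff_eq_zero_of_mem_polyPart hp (by simpa using hk.symm)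

theorem eq_C_of_mem_polyPart_zero {p : PolyRing n} (hp : p ∈ polyPart n 0) :
    p = MvPolynomial.C (MvPolynomial.constantCoeff p) := by
  have h : p.IsHomogeneous 0 := mem_polyPart_natCast.1 (by simpa using hp)
  have := MvPolynomial.totalDegree_eq_zero_iff_eq_C.1 (Nat.le_zero.1 h.totalDegree_le)
  rwa [← MvPolynomial.constantCoeff_eq] at this

theorem constantCoeff_polyComp {k : ℤ} {p : PolyRing n}
    (hp : MvPolynomial.constantCoeff p = 0) :
    MvPolynomial.constantCoeff (polyComp n k p) = 0 := by
  rw [MvPolynomial.constantCoeff_eq] at *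
  rw [coeff_polyComp, hp, ite_self]

theorem degree_unique {j k : ℤ} {p : PolyRing n} (h0 : p ≠ 0) (hj : p ∈ polyPart n j)
    (hk : p ∈ polyPart n k) : j = k := by
  by_contra h
  exact h0 (by rw [← polyComp_of_mem hk, polyComp_of_mem_ne hj h])

theorem nonneg_of_mem_polyPart {j : ℤ} {p : PolyRing n} (h0 : p ≠ 0) (hj : p ∈ polyPart n j) :
    0 ≤ j := by
  by_contra h
  exact h0 (eq_zero_of_mem_polyPart_neg hj (by omega))

/-- Euler's identity. -/
theorem euler_identity {k : ℤ} {p : PolyRing n} (hp : p ∈ polyPart n k) :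
    ∑ i, MvPolynomial.X i * MvPolynomial.pderiv i p = (k : ℂ) • p := by
  by_cases h0 : p = 0
  · simp [h0]
  have hk := nonneg_of_mem_polyPart h0 hp
  lift k to ℕ using hk
  have := (mem_polyPart_natCast.1 hp).sum_X_mul_pderiv
  rw [this]
  simp [MvPolynomial.smul_eq_C_mul]

instance polyPart_finiteDimensional (k : ℤ) : FiniteDimensional ℂ (polyPart n k) := by
  have hfin : Set.Finite {m : Fin n →₀ ℕ | (m.degree : ℤ) = k} := by
    rcases lt_or_ge k 0 with hk | hk
    · convert Set.finite_empty
      ext m; simp; omega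
    · lift k to ℕ using hk
      have := Finset.finite_toSet (Finset.finsuppAntidiag (Finset.univ : Finset (Fin n)) k)
      refine this.subset fun m hm => ?_
      simp only [Set.mem_ofPred_eq, Nat.cast_inj] at hm
      simp [Finset.mem_finsuppAntidiag, ← hm, Finsupp.degree_eq_sum]
  have := hfin.to_subtype
  exact Module.Finite.of_basis
    (MvPolynomial.basisRestrictSupport ℂ {m : Fin n →₀ ℕ | (m.degree : ℤ) = k})

end

/-! ### Substitutions, constant coefficient operators and the Fischer pairing -/

section

variable {n : ℕ}

/-- The substitution `p ↦ p ∘ A` of a linear map into a polynomial function. -/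
noncomputable def subst (A : Matrix (Fin n) (Fin n) ℂ) : PolyRing n →ₐ[ℂ] PolyRing n :=
  MvPolynomial.aeval fun i => ∑ j, MvPolynomial.C (A i j) * MvPolynomial.X j

theorem polyAct_eq_subst (g : Matrix.GeneralLinearGroup (Fin n) ℂ) :
    polyAct g = subst (g⁻¹).val := rfl

theorem symAct_eq_subst (g : Matrix.GeneralLinearGroup (Fin n) ℂ) :
    symAct g = subst g.val.transpose := rfl

theorem subst_X (A : Matrix (Fin n) (Fin n) ℂ) (i : Fin n) :
    subst A (MvPolynomial.X i) = ∑ j, MvPolynomial.C (A i j) * MvPolynomial.X j := by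
  simp [subst]

theorem subst_C (A : Matrix (Fin n) (Fin n) ℂ) (c : ℂ) :
    subst A (MvPolynomial.C c) = MvPolynomial.C c := by
  simp [subst]

theorem subst_subst (A B : Matrix (Fin n) (Fin n) ℂ) (p : PolyRing n) :
    subst A (subst B p) = subst (B * A) p := by
  have h : (subst A).comp (subst B) = subst (B * A) := by
    apply MvPolynomial.algHom_ext
    intro i
    simp only [AlgHom.comp_apply, subst_X, map_sum, map_mul, subst_C, Matrix.mul_apply,
      Finset.mul_sum, Finset.sum_mul]
    rw [Finset.sum_comm]
    simp [mul_assoc]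
  exact DFunLike.congr_fun h p

theorem subst_one (p : PolyRing n) : subst (1 : Matrix (Fin n) (Fin n) ℂ) p = p := by
  have h : subst (1 : Matrix (Fin n) (Fin n) ℂ) = AlgHom.id ℂ (PolyRing n) := by
    apply MvPolynomial.algHom_ext
    intro i
    simp [subst_X, Matrix.one_apply]
  rw [h]; rfl

theorem eval_subst (A : Matrix (Fin n) (Fin n) ℂ) (v : Fin n → ℂ) (p : PolyRing n) :
    MvPolynomial.eval v (subst A p) = MvPolynomial.eval (A.mulVec v) p := by
  have h : (MvPolynomial.aeval v).comp (subst A) =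
      (MvPolynomial.aeval (A.mulVec v) : PolyRing n →ₐ[ℂ] ℂ) := by
    apply MvPolynomial.algHom_ext
    intro i
    simp [subst_X, Matrix.mulVec, dotProduct]
  simpa [MvPolynomial.aeval_eq_eval] using DFunLike.congr_fun h p

theorem subst_mem_polyPart (A : Matrix (Fin n) (Fin n) ℂ) {k : ℤ} {p : PolyRing n}
    (hp : p ∈ polyPart n k) : subst A p ∈ polyPart n k :=
  aeval_linear_mem_polyPart _ (fun _ => Submodule.sum_mem _ fun j _ =>
    C_mul_mem_polyPart _ (X_mem_polyPart j)) hp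

theorem polyComp_subst (A : Matrix (Fin n) (Fin n) ℂ) (k : ℤ) (p : PolyRing n) :
    polyComp n k (subst A p) = subst A (polyComp n k p) :=
  polyComp_comm (subst A).toLinearMap (fun _ _ h => subst_mem_polyPart A h) k p

theorem constantCoeff_subst (A : Matrix (Fin n) (Fin n) ℂ) (p : PolyRing n) :
    MvPolynomial.constantCoeff (subst A p) = MvPolynomial.constantCoeff p := by
  have h := eval_subst A 0 p
  rw [Matrix.mulVec_zero] at h
  simpa [MvPolynomial.constantCoeff_eq, MvPolynomial.eval_zero] using h

theorem polyAct_mul (g h : Matrix.GeneralLinearGroup (Fin n) ℂ) (p : PolyRing n) :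
    polyAct (g * h) p = polyAct g (polyAct h p) := by
  simp only [polyAct_eq_subst, subst_subst, mul_inv_rev, Units.val_mul]

theorem polyAct_one (p : PolyRing n) :
    polyAct (1 : Matrix.GeneralLinearGroup (Fin n) ℂ) p = p := by
  simp only [polyAct_eq_subst, inv_one, Units.val_one, subst_one]

theorem polyAct_inv_act (g : Matrix.GeneralLinearGroup (Fin n) ℂ) (p : PolyRing n) :
    polyAct g⁻¹ (polyAct g p) = p := by
  rw [← polyAct_mul, inv_mul_cancel, polyAct_one]

theorem eval_polyAct (g : Matrix.GeneralLinearGroup (Fin n) ℂ) (v : Fin n → ℂ) (p : PolyRing n) :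
    MvPolynomial.eval v (polyAct g p) = MvPolynomial.eval ((g⁻¹).val.mulVec v) p :=
  eval_subst _ v p

theorem polyAct_mem_polyPart (g : Matrix.GeneralLinearGroup (Fin n) ℂ) {k : ℤ} {p : PolyRing n}
    (hp : p ∈ polyPart n k) : polyAct g p ∈ polyPart n k := subst_mem_polyPart _ hp

theorem polyComp_polyAct (g : Matrix.GeneralLinearGroup (Fin n) ℂ) (k : ℤ) (p : PolyRing n) :
    polyComp n k (polyAct g p) = polyAct g (polyComp n k p) := polyComp_subst _ k p

theorem polyComp_mem_invariantRing {W : Subgroup (Matrix.GeneralLinearGroup (Fin n) ℂ)}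
    {p : PolyRing n} (hp : p ∈ invariantRing W) (k : ℤ) :
    polyComp n k p ∈ invariantRing W := fun g hg => by
  rw [← polyComp_polyAct, hp g hg]

/-- The chain rule for a linear substitution. -/
theorem pderiv_subst (A : Matrix (Fin n) (Fin n) ℂ) (j : Fin n) (p : PolyRing n) :
    MvPolynomial.pderiv j (subst A p) =
      ∑ i, MvPolynomial.C (A i j) * subst A (MvPolynomial.pderiv i p) := by
  classical
  induction p using MvPolynomial.induction_on with
  | C a => simp
  | add p q hp hq => simp only [map_add, hp, hq, mul_add, Finset.sum_add_distrib]
  | mul_X p i hp =>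
    simp only [map_mul, Derivation.leibniz, smul_eq_mul, hp, map_add, mul_add,
      Finset.sum_add_distrib, MvPolynomial.pderiv_X]
    congr 1
    · rw [subst_X, map_sum, Finset.sum_eq_single j, Finset.sum_eq_single i]
      · simp [mul_comm]
      · intro k _ hk
        simp [Ne.symm hk]
      · simp
      · intro k _ hk
        simp [Ne.symm hk]
      · simp
    · rw [Finset.mul_sum]
      exact Finset.sum_congr rfl fun k _ => by ring

/-- The commutative algebra of constant coefficient differential operators. -/
noncomputable abbrev constDiffOps (n : ℕ) : Subalgebra ℂ (Module.End ℂ (PolyRing n)) :=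
  Algebra.adjoin ℂ (Set.range fun i : Fin n =>
    ((MvPolynomial.pderiv i : Derivation ℂ (PolyRing n) (PolyRing n)) :
      PolyRing n →ₗ[ℂ] PolyRing n))

theorem pderiv_comm (i j : Fin n) (p : PolyRing n) :
    MvPolynomial.pderiv i (MvPolynomial.pderiv j p) =
      MvPolynomial.pderiv j (MvPolynomial.pderiv i p) := by
  have h : ⁅(MvPolynomial.pderiv i : Derivation ℂ (PolyRing n) (PolyRing n)),
      (MvPolynomial.pderiv j : Derivation ℂ (PolyRing n) (PolyRing n))⁆ = 0 := by
    classical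
    apply MvPolynomial.derivation_ext
    intro k
    simp [Derivation.commutator_apply, MvPolynomial.pderiv_X, Pi.single_apply, apply_ite]
  have := DFunLike.congr_fun h p
  rw [Derivation.commutator_apply] at this
  exact sub_eq_zero.1 this

theorem constDiffOps_comm : ∀ a ∈ Set.range (fun i : Fin n =>
    ((MvPolynomial.pderiv i : Derivation ℂ (PolyRing n) (PolyRing n)) :
      PolyRing n →ₗ[ℂ] PolyRing n)), ∀ b ∈ Set.range (fun i : Fin n =>
    ((MvPolynomial.pderiv i : Derivation ℂ (PolyRing n) (PolyRing n)) :
      PolyRing n →ₗ[ℂ] PolyRing n)), a * b = b * a := by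
  rintro _ ⟨i, rfl⟩ _ ⟨j, rfl⟩
  refine LinearMap.ext fun p => ?_
  exact pderiv_comm i j p

/-- Commutativity is bundled as an instance so that `MvPolynomial.aeval` can take values in
`constDiffOps n`. -/
noncomputable instance : CommRing (constDiffOps n) :=
  { (constDiffOps n).toRing with
    mul_comm := fun a b =>
      (Algebra.isMulCommutative_adjoin ℂ (constDiffOps_comm (n := n))).is_comm.comm a b }

/-- The map `P ↦ P(∂)` as an algebra homomorphism; it agrees with `diffOp`, see `diffOp_eq`. -/
noncomputable def diffHom (n : ℕ) : PolyRing n →ₐ[ℂ] Module.End ℂ (PolyRing n) :=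
  (constDiffOps n).val.comp (MvPolynomial.aeval fun i =>
    (⟨_, Algebra.subset_adjoin (Set.mem_range_self i)⟩ : constDiffOps n))

theorem diffHom_X (i : Fin n) (p : PolyRing n) :
    diffHom n (MvPolynomial.X i) p = MvPolynomial.pderiv i p := by
  simp [diffHom]

theorem diffOp_eq (P : PolyRing n) : diffOp P = diffHom n P := by
  conv_rhs => rw [P.as_sum, map_sum]
  refine Finset.sum_congr rfl fun m _ => ?_
  have h : MvPolynomial.monomial m (P.coeff m) =
      P.coeff m • ((List.finRange n).map fun i => (MvPolynomial.X i : PolyRing n) ^ m i).prod := by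
    rw [MvPolynomial.monomial_eq, MvPolynomial.smul_eq_C_mul, Finsupp.prod_fintype _ _ (by simp),
      ← List.ofFn_eq_map, List.prod_ofFn]
  rw [h, map_smul, map_list_prod, List.map_map]
  congr 3
  funext i
  rw [Function.comp_apply, map_pow]
  congr 1
  exact LinearMap.ext fun p => (diffHom_X i p).symm

/-- Equivariance of constant coefficient operators: `P(∂)` acts after a linear substitution `A` as
`(P ∘ Aᵀ)(∂)` acts before it. -/
theorem diffHom_subst (A : Matrix (Fin n) (Fin n) ℂ) (P p : PolyRing n) :
    diffHom n P (subst A p) = subst A (diffHom n (subst A.transpose P) p) := by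
  induction P using MvPolynomial.induction_on generalizing p with
  | C a =>
    have h (c : ℂ) : diffHom n (MvPolynomial.C c) = algebraMap ℂ _ c := (diffHom n).commutes c
    simp [h]
  | add P Q hP hQ => simp only [map_add, LinearMap.add_apply, hP, hQ]
  | mul_X P i hP =>
    rw [map_mul, map_mul, map_mul, Module.End.mul_apply, Module.End.mul_apply, diffHom_X,
      pderiv_subst, map_sum, subst_X, map_sum, LinearMap.sum_apply, map_sum, map_sum]
    have h (c : ℂ) : diffHom n (MvPolynomial.C c) = algebraMap ℂ _ c := (diffHom n).commutes c
    refine Finset.sum_congr rfl fun k _ => ?_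
    rw [← MvPolynomial.smul_eq_C_mul, map_smul, hP, map_mul, Module.End.mul_apply, h, diffHom_X]
    simp

/-- The Fischer form: the bilinear form on `S` in which monomials are orthogonal and `x^m` has
square length `m!`. It is defined on the basis of monomials in its second argument. -/
noncomputable def fischer (p : PolyRing n) : PolyRing n →ₗ[ℂ] ℂ :=
  (MvPolynomial.basisMonomials (Fin n) ℂ).constr ℂ fun m =>
    (∏ i, ((m i).factorial : ℂ)) * p.coeff m

theorem fischer_monomial (p : PolyRing n) (m : Fin n →₀ ℕ) :
    fischer p (MvPolynomial.monomial m 1) = (∏ i, ((m i).factorial : ℂ)) * p.coeff m := by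
  have h := (MvPolynomial.basisMonomials (Fin n) ℂ).constr_basis ℂ
    (fun m => (∏ i, ((m i).factorial : ℂ)) * p.coeff m) m
  rwa [MvPolynomial.coe_basisMonomials] at h

theorem fischer_apply (p P : PolyRing n) :
    fischer p P = ∑ m ∈ P.support, (∏ i, ((m i).factorial : ℂ)) * p.coeff m * P.coeff m := by
  conv_lhs => rw [P.as_sum, map_sum]
  refine Finset.sum_congr rfl fun m _ => ?_
  rw [← mul_one (P.coeff m), ← smul_eq_mul, ← MvPolynomial.smul_monomial, map_smul,
    fischer_monomial, smul_eq_mul, mul_comm]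
  simp

theorem fischer_mul_X (p P : PolyRing n) (i : Fin n) :
    fischer p (P * MvPolynomial.X i) = fischer (MvPolynomial.pderiv i p) P := by
  have h : (fischer p) ∘ₗ LinearMap.mulRight ℂ (MvPolynomial.X i) =
      fischer (MvPolynomial.pderiv i p) := by
    refine (MvPolynomial.basisMonomials (Fin n) ℂ).ext fun m => ?_
    rw [MvPolynomial.coe_basisMonomials, LinearMap.comp_apply, LinearMap.mulRight_apply,
      MvPolynomial.X, MvPolynomial.monomial_mul, mul_one, fischer_monomial, fischer_monomial,
      MvPolynomial.coeff_pderiv]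
    have : ∏ j, (((m + Finsupp.single i 1 : Fin n →₀ ℕ) j).factorial : ℂ) =
        (∏ j, ((m j).factorial : ℂ)) * (m i + 1) := by
      rw [← Finset.mul_prod_erase _ _ (Finset.mem_univ i),
        ← Finset.mul_prod_erase _ (fun j => ((m j).factorial : ℂ)) (Finset.mem_univ i)]
      rw [Finset.prod_congr rfl (g := fun j => ((m j).factorial : ℂ))]
      · simp [Nat.factorial_succ]; ring
      · intro j hj
        simp [(Finset.ne_of_mem_erase hj).symm]
    rw [this]; ring
  exact LinearMap.congr_fun h P

/-- Multiplication by `P` and the operator `P(∂)` are adjoint to each other. -/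
theorem fischer_mul (p P Q : PolyRing n) :
    fischer p (Q * P) = fischer (diffHom n P p) Q := by
  induction P using MvPolynomial.induction_on generalizing p Q with
  | C a =>
    have h : diffHom n (MvPolynomial.C a) = algebraMap ℂ _ a := (diffHom n).commutes a
    rw [h, mul_comm, ← MvPolynomial.smul_eq_C_mul, map_smul, fischer_apply, fischer_apply,
      Finset.smul_sum]
    refine Finset.sum_congr rfl fun m _ => ?_
    simp; ring
  | add P P' hP hP' =>
    rw [mul_add, map_add, hP, hP', map_add, LinearMap.add_apply, fischer_apply, fischer_apply,
      fischer_apply, ← Finset.sum_add_distrib]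
    refine Finset.sum_congr rfl fun m _ => ?_
    simp; ring
  | mul_X P i hP =>
    rw [← mul_assoc, fischer_mul_X, hP, ← diffHom_X, ← Module.End.mul_apply, map_mul]

theorem fischer_one (p : PolyRing n) : fischer p 1 = MvPolynomial.constantCoeff p := by
  rw [← MvPolynomial.C_1, MvPolynomial.C_apply, fischer_monomial]
  simp [MvPolynomial.constantCoeff_eq]

theorem eq_zero_of_fischer {p : PolyRing n} (h : ∀ P, fischer p P = 0) : p = 0 := by
  ext m
  have := h (MvPolynomial.monomial m 1)
  rw [fischer_monomial, mul_eq_zero] at this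
  refine this.resolve_left (Finset.prod_ne_zero_iff.2 fun i _ => ?_)
  exact_mod_cast Nat.factorial_ne_zero _

/-- Linear substitutions are adjoint to each other for the Fischer form. -/
theorem fischer_subst (A : Matrix (Fin n) (Fin n) ℂ) (P p : PolyRing n) :
    fischer (subst A p) P = fischer p (subst A.transpose P) := by
  have h (q Q : PolyRing n) : fischer q Q = MvPolynomial.constantCoeff (diffHom n Q q) := by
    rw [← fischer_one, ← fischer_mul, one_mul]
  rw [h, h, diffHom_subst, constantCoeff_subst]

end

/-! ### The decomposition of `S` into the Hilbert ideal and the harmonics -/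

section

variable {n : ℕ}

theorem fischer_polyComp (k : ℤ) (p P : PolyRing n) :
    fischer (polyComp n k p) P = fischer p (polyComp n k P) := by
  have h : fischer (polyComp n k p) = fischer p ∘ₗ polyComp n k := by
    refine (MvPolynomial.basisMonomials (Fin n) ℂ).ext fun m => ?_
    rw [MvPolynomial.coe_basisMonomials, LinearMap.comp_apply, fischer_monomial, coeff_polyComp]
    split_ifs with hm
    · rw [polyComp_of_mem (hm ▸ monomial_mem_polyPart m 1), fischer_monomial]
    · rw [polyComp_of_mem_ne (monomial_mem_polyPart m 1) hm, map_zero, mul_zero]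
  exact LinearMap.congr_fun h P

theorem fischer_add (p q P : PolyRing n) : fischer (p + q) P = fischer p P + fischer q P := by
  simp [fischer_apply, ← Finset.sum_add_distrib, mul_add, add_mul]

theorem fischer_smul (c : ℂ) (p P : PolyRing n) : fischer (c • p) P = c * fischer p P := by
  rw [fischer_apply, fischer_apply, Finset.mul_sum]
  refine Finset.sum_congr rfl fun m _ => ?_
  simp; ring

theorem fischer_sum {ι : Type*} (s : Finset ι) (p : ι → PolyRing n) (P : PolyRing n) :
    fischer (∑ i ∈ s, p i) P = ∑ i ∈ s, fischer (p i) P := by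
  classical
  induction s using Finset.induction_on with
  | empty => simp [fischer_apply]
  | insert a s ha ih => rw [Finset.sum_insert ha, Finset.sum_insert ha, fischer_add, ih]

/-- Complex conjugation of the coefficients. -/
noncomputable abbrev conjPoly (n : ℕ) : PolyRing n →+* PolyRing n :=
  MvPolynomial.map (starRingEnd ℂ)

/-- The Hermitian form associated with the Fischer form is definite. -/
theorem fischer_conjPoly_self {P : PolyRing n} (h : fischer (conjPoly n P) P = 0) : P = 0 := by
  rw [fischer_apply] at h
  have h1 : ∀ m, (∏ i, ((m i).factorial : ℂ)) * (conjPoly n P).coeff m * P.coeff m =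
      (((∏ i, ((m i).factorial : ℝ)) * Complex.normSq (P.coeff m) : ℝ) : ℂ) := by
    intro m
    rw [MvPolynomial.coeff_map, mul_assoc, mul_comm ((starRingEnd ℂ) _), Complex.mul_conj]
    push_cast; rfl
  simp_rw [h1] at h
  rw [← Complex.ofReal_sum, Complex.ofReal_eq_zero, Finset.sum_eq_zero_iff_of_nonneg
    fun m _ => mul_nonneg (Finset.prod_nonneg fun _ _ => Nat.cast_nonneg _)
      (Complex.normSq_nonneg _)] at h
  ext m
  by_contra hm
  rcases mul_eq_zero.1 (h m (MvPolynomial.mem_support_iff.2 hm)) with h2 | h2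
  · refine Finset.prod_ne_zero_iff.2 (fun i _ => ?_) h2
    exact_mod_cast Nat.factorial_ne_zero _
  · exact hm (Complex.normSq_eq_zero.1 h2)

theorem conjPoly_subst (A : Matrix (Fin n) (Fin n) ℂ) (P : PolyRing n) :
    conjPoly n (subst A P) = subst (A.map (starRingEnd ℂ)) (conjPoly n P) := by
  induction P using MvPolynomial.induction_on with
  | C a => simp
  | add p q hp hq => simp only [map_add, hp, hq]
  | mul_X p i hp => simp [map_mul, hp, subst_X]

theorem conjPoly_mem_polyPart {k : ℤ} {P : PolyRing n} (hP : P ∈ polyPart n k) :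
    conjPoly n P ∈ polyPart n k := by
  rw [mem_polyPart] at *
  intro m hm
  rw [MvPolynomial.coeff_map] at hm
  exact hP m fun h => hm (by rw [h, map_zero])

section Hermitian

variable (W : Subgroup (Matrix.GeneralLinearGroup (Fin n) ℂ)) [Fintype W]

open scoped ComplexOrder MatrixOrder Matrix.Norms.L2Operator in
/-- A finite linear group preserves a positive definite Hermitian form `Cᴴ * C`. -/
theorem exists_invariant_hermitian : ∃ C : Matrix (Fin n) (Fin n) ℂ, IsUnit C ∧
    ∀ g ∈ W, g.val.conjTranspose * (C.conjTranspose * C) = C.conjTranspose * C * (g⁻¹).val := by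
  classical
  set B : Matrix (Fin n) (Fin n) ℂ := ∑ g : W, g.1.val.conjTranspose * g.1.val with hB
  have hpos : B.PosDef := by
    have h1 : B = (1 : Matrix (Fin n) (Fin n) ℂ) +
        ∑ g ∈ Finset.univ.erase (1 : W), g.1.val.conjTranspose * g.1.val := by
      rw [hB, ← Finset.add_sum_erase _ _ (Finset.mem_univ (1 : W))]
      simp
    rw [h1]
    exact Matrix.PosDef.one.add_posSemidef (Matrix.posSemidef_sum _ fun g _ =>
      Matrix.posSemidef_conjTranspose_mul_self _)
  have hinv : ∀ g ∈ W, g.val.conjTranspose * B = B * (g⁻¹).val := by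
    intro g hg
    rw [hB, Finset.mul_sum, Finset.sum_mul]
    refine Fintype.sum_equiv (Equiv.mulRight (⟨g, hg⟩ : W)) _ _ fun x => ?_
    simp [Matrix.mul_assoc, Matrix.conjTranspose_mul]
  obtain ⟨C, hC⟩ := CStarAlgebra.nonneg_iff_eq_star_mul_self.1 hpos.posSemidef.nonneg
  rw [Matrix.star_eq_conjTranspose] at hC
  refine ⟨C, ?_, fun g hg => by rw [← hC, hinv g hg]⟩
  have hu := hpos.isUnit
  rw [hC] at hu
  rw [Matrix.isUnit_iff_isUnit_det] at hu ⊢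
  rw [Matrix.det_mul] at hu
  exact isUnit_of_mul_isUnit_right hu

end Hermitian

section Harmonic

variable (W : Subgroup (Matrix.GeneralLinearGroup (Fin n) ℂ))

/-- The ideal of `Sym(V)` generated by the invariants without constant term. -/
noncomputable def symHilbertIdeal : Ideal (PolyRing n) :=
  Ideal.span {P | (∀ g ∈ W, symAct g P = P) ∧ MvPolynomial.constantCoeff P = 0}

theorem polyComp_mem_symHilbertIdeal {P : PolyRing n} (hP : P ∈ symHilbertIdeal W) (k : ℤ) :
    polyComp n k P ∈ symHilbertIdeal W := by
  induction hP using Submodule.span_induction generalizing k with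
  | mem x hx =>
    refine Ideal.subset_span ⟨fun g hg => ?_, constantCoeff_polyComp hx.2⟩
    rw [symAct_eq_subst, ← polyComp_subst, ← symAct_eq_subst, hx.1 g hg]
  | zero => simp
  | add x y _ _ hx hy => rw [map_add]; exact add_mem (hx k) (hy k)
  | smul a x _ hx =>
    rw [smul_eq_mul, ← sum_polyComp a (Nat.lt_succ_self _), Finset.sum_mul, map_sum]
    refine Submodule.sum_mem _ fun i _ => ?_
    rw [polyComp_homogeneous_mul (polyComp_mem _ _)]
    exact Ideal.mul_mem_left _ _ (hx _)

theorem symAct_mem_symHilbertIdeal {P : PolyRing n} (hP : P ∈ symHilbertIdeal W)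
    {g : Matrix.GeneralLinearGroup (Fin n) ℂ} (hg : g ∈ W) : symAct g P ∈ symHilbertIdeal W := by
  induction hP using Submodule.span_induction with
  | mem x hx => rw [hx.1 g hg]; exact Ideal.subset_span hx
  | zero => simp
  | add x y _ _ hx hy => rw [map_add]; exact add_mem hx hy
  | smul a x _ hx => rw [smul_eq_mul, map_mul]; exact Ideal.mul_mem_left _ _ hx

/-- The harmonic polynomials are the orthogonal complement of `symHilbertIdeal`. -/
theorem mem_harmonic_iff {p : PolyRing n} :
    p ∈ harmonic W ↔ ∀ P ∈ symHilbertIdeal W, fischer p P = 0 := by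
  simp only [harmonic, Submodule.mem_iInf, LinearMap.mem_ker, diffOp_eq]
  constructor
  · intro h P hP
    rw [symHilbertIdeal, ← Ideal.submodule_span_eq] at hP
    induction hP using Submodule.span_induction with
    | mem x hx =>
      rw [← one_mul x, fischer_mul, h x hx]; simp [fischer_apply]
    | zero => simp
    | add x y _ _ hx hy => rw [map_add, hx, hy, add_zero]
    | smul a x hx' hx =>
      clear hx
      rw [smul_eq_mul]
      induction hx' using Submodule.span_induction generalizing a with
      | mem x hx => rw [fischer_mul, h x hx]; simp [fischer_apply]
      | zero => simp
      | add x y _ _ hx hy => rw [mul_add, map_add, hx, hy, add_zero]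
      | smul b x _ hx => rw [smul_eq_mul, ← mul_assoc, hx]
  · intro h P hP
    refine eq_zero_of_fischer fun Q => ?_
    rw [← fischer_mul]
    exact h _ (Ideal.mul_mem_left _ _ (Ideal.subset_span hP))

theorem polyComp_mem_harmonic {p : PolyRing n} (hp : p ∈ harmonic W) (k : ℤ) :
    polyComp n k p ∈ harmonic W := by
  rw [mem_harmonic_iff] at *
  intro P hP
  rw [fischer_polyComp]
  exact hp _ (polyComp_mem_symHilbertIdeal W hP k)

theorem polyAct_mem_harmonic {p : PolyRing n} (hp : p ∈ harmonic W)
    {g : Matrix.GeneralLinearGroup (Fin n) ℂ} (hg : g ∈ W) : polyAct g p ∈ harmonic W := by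
  rw [mem_harmonic_iff] at *
  intro P hP
  rw [polyAct_eq_subst, fischer_subst, ← symAct_eq_subst]
  exact hp _ (symAct_mem_symHilbertIdeal W hP (W.inv_mem hg))

theorem one_mem_harmonic : (1 : PolyRing n) ∈ harmonic W := by
  rw [mem_harmonic_iff]
  intro P hP
  have h1 : (1 : PolyRing n) = polyComp n 0 1 := (polyComp_of_mem one_mem_polyPart).symm
  have h0 : MvPolynomial.constantCoeff P = 0 := by
    have : symHilbertIdeal W ≤ RingHom.ker (MvPolynomial.constantCoeff (R := ℂ) (σ := Fin n)) :=
      Ideal.span_le.2 fun x hx => hx.2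
    exact this hP
  rw [fischer_apply]
  refine Finset.sum_eq_zero fun m _ => ?_
  by_cases hm : m = 0
  · subst hm
    rw [MvPolynomial.constantCoeff_eq] at h0
    rw [h0, mul_zero]
  · rw [← MvPolynomial.C_1, MvPolynomial.coeff_C, if_neg (Ne.symm hm)]
    simp

/-- Conjugation and the invariant Hermitian form carry `Sym(V)·Sym(V)^W_+` into the
Hilbert ideal. -/
theorem subst_conj_mem_hilbertIdeal {B : Matrix (Fin n) (Fin n) ℂ}
    (hB : ∀ g ∈ W, g.val.conjTranspose * B = B * (g⁻¹).val) {P : PolyRing n}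
    (hP : P ∈ symHilbertIdeal W) : subst B (conjPoly n P) ∈ hilbertIdeal W := by
  induction hP using Submodule.span_induction with
  | mem x hx =>
    refine Ideal.subset_span ⟨fun g hg => ?_, ?_⟩
    · conv_rhs => rw [← hx.1 g hg]
      rw [symAct_eq_subst, conjPoly_subst, polyAct_eq_subst, subst_subst, subst_subst, ← hB g hg]
      rfl
    · rw [constantCoeff_subst, MvPolynomial.constantCoeff_eq, MvPolynomial.coeff_map,
        ← MvPolynomial.constantCoeff_eq, hx.2, map_zero]
  | zero => simp
  | add x y _ _ hx hy => rw [map_add, map_add]; exact add_mem hx hy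
  | smul a x _ hx => rw [smul_eq_mul, map_mul, map_mul]; exact Ideal.mul_mem_left _ _ hx

/-- `S = I + H`, degree by degree. Twisting by conjugation and an invariant Hermitian form turns the
Fischer form into a definite one, for which orthogonal projection to the degree `k` part of
`symHilbertIdeal` exists; the projection lands in `I` and the remainder is harmonic. -/
theorem exists_harmonic_add_hilbertIdeal [Fintype W] {k : ℤ} {p : PolyRing n}
    (hp : p ∈ polyPart n k) : ∃ q ∈ hilbertIdeal W, ∃ h ∈ harmonic W,
      q ∈ polyPart n k ∧ h ∈ polyPart n k ∧ p = q + h := by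
  classical
  obtain ⟨C, hC, hinv⟩ := exists_invariant_hermitian W
  set B := C.conjTranspose * C with hB
  set N : Submodule ℂ (PolyRing n) := (symHilbertIdeal W).restrictScalars ℂ ⊓ polyPart n k with hN
  have : FiniteDimensional ℂ N := Submodule.finiteDimensional_inf_right _ _
  let b := Module.finBasis ℂ N
  set r := Module.finrank ℂ N
  -- the semilinear map carrying `symHilbertIdeal` into the Hilbert ideal
  let τ : PolyRing n → PolyRing n := fun P => subst B (conjPoly n P)
  have hτpos : ∀ P, fischer (τ P) P = 0 → P = 0 := by
    intro P h
    have e1 : τ P = subst C (conjPoly n (subst C.transpose P)) := by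
      rw [conjPoly_subst, subst_subst]; rfl
    rw [e1, fischer_subst] at h
    have h2 := fischer_conjPoly_self h
    have h3 : C.transpose * C.transpose⁻¹ = 1 := Matrix.mul_nonsing_inv _ (by
      rw [Matrix.det_transpose]; exact (Matrix.isUnit_iff_isUnit_det _).1 hC)
    rw [← subst_one P, ← h3, ← subst_subst, h2, map_zero]
  have hτsum : ∀ y : Fin r → ℂ, τ (∑ j, y j • (b j : PolyRing n)) =
      ∑ j, (starRingEnd ℂ) (y j) • τ (b j) := by
    intro y
    simp [τ, MvPolynomial.smul_eq_C_mul]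
  -- the Gram matrix of the positive definite form on `N` is invertible
  let G : Matrix (Fin r) (Fin r) ℂ := fun i j => fischer (τ (b j)) (b i)
  have hG : ∀ y, ∀ i, G.mulVec y i =
      fischer (τ (∑ j, (starRingEnd ℂ) (y j) • (b j : PolyRing n))) (b i) := by
    intro y i
    rw [hτsum, fischer_sum]
    simp [G, Matrix.mulVec, dotProduct, fischer_smul, mul_comm]
  have hker : Function.Injective G.mulVecLin := by
    rw [← LinearMap.ker_eq_bot, LinearMap.ker_eq_bot']
    intro y hy
    have hy' : ∀ i, fischer (τ (∑ j, (starRingEnd ℂ) (y j) • (b j : PolyRing n))) (b i) = 0 := by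
      intro i
      rw [← hG]
      exact congrFun hy i
    have h0 : ∑ j, (starRingEnd ℂ) (y j) • (b j : PolyRing n) = 0 := by
      apply hτpos
      conv_lhs => rw [map_sum]
      exact Finset.sum_eq_zero fun i _ => by rw [map_smul, hy' i, smul_zero]
    have h1 : ∑ j, (starRingEnd ℂ) (y j) • b j = 0 := by
      ext1
      simpa using h0
    funext j
    simpa using Fintype.linearIndependent_iff.1 b.linearIndependent _ h1 j
  obtain ⟨y, hy⟩ := LinearMap.injective_iff_surjective.1 hker fun i => fischer p (b i)
  set Q : PolyRing n := ∑ j, (starRingEnd ℂ) (y j) • (b j : PolyRing n) with hQ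
  have hQN : Q ∈ N := Submodule.sum_mem _ fun j _ => Submodule.smul_mem _ _ (b j).2
  have hτQ : τ Q ∈ polyPart n k := subst_mem_polyPart _ (conjPoly_mem_polyPart hQN.2)
  refine ⟨τ Q, subst_conj_mem_hilbertIdeal W hinv hQN.1, p - τ Q, ?_, hτQ, sub_mem hp hτQ, by ring⟩
  have horth : ∀ P ∈ N, fischer (p - τ Q) P = 0 := by
    have hb : ∀ i, fischer (p - τ Q) (b i) = 0 := by
      intro i
      rw [sub_eq_add_neg, ← neg_one_smul ℂ, fischer_add, fischer_smul, ← hG,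
        ← Matrix.mulVecLin_apply, hy]
      ring
    intro P hP
    have h1 := congrArg Subtype.val (b.sum_repr ⟨P, hP⟩)
    simp only [Submodule.coe_sum, Submodule.coe_smul] at h1
    rw [← h1, map_sum]
    exact Finset.sum_eq_zero fun i _ => by rw [map_smul, hb i, smul_zero]
  rw [mem_harmonic_iff]
  intro P hP
  rw [← polyComp_of_mem (sub_mem hp hτQ), fischer_polyComp]
  exact horth _ ⟨polyComp_mem_symHilbertIdeal W hP k, polyComp_mem k P⟩

end Harmonic

end

/-! ### Averaging, and bases of equivariant maps over the invariants -/

section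

variable {n : ℕ}

section Reynolds

variable (W : Subgroup (Matrix.GeneralLinearGroup (Fin n) ℂ))

variable [Fintype W]

theorem card_ne_zero_complex : (Fintype.card W : ℂ) ≠ 0 := by
  exact_mod_cast Fintype.card_ne_zero

/-- Averaging a linear map over the group. -/
noncomputable def reynoldsHom {M : Type*} [AddCommGroup M] [Module ℂ M]
    (ρ : Representation ℂ W M) : (M →ₗ[ℂ] PolyRing n) →ₗ[ℂ] (M →ₗ[ℂ] PolyRing n) where
  toFun σ := (Fintype.card W : ℂ)⁻¹ • ∑ g : W, (polyAct g.1).toLinearMap ∘ₗ σ ∘ₗ ρ g⁻¹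
  map_add' σ τ := by
    ext1 m
    simp [LinearMap.sum_apply, Finset.sum_add_distrib]
  map_smul' c σ := by
    ext1 m
    simp [LinearMap.sum_apply, Finset.smul_sum, smul_smul, mul_comm]

theorem reynoldsHom_apply {M : Type*} [AddCommGroup M] [Module ℂ M]
    (ρ : Representation ℂ W M) (σ : M →ₗ[ℂ] PolyRing n) (m : M) :
    reynoldsHom W ρ σ m = (Fintype.card W : ℂ)⁻¹ • ∑ g : W, polyAct g.1 (σ (ρ g⁻¹ m)) := by
  simp [reynoldsHom, LinearMap.sum_apply]

theorem reynoldsHom_equivariant {M : Type*} [AddCommGroup M] [Module ℂ M]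
    (ρ : Representation ℂ W M) (σ : M →ₗ[ℂ] PolyRing n) (g : W) (m : M) :
    reynoldsHom W ρ σ (ρ g m) = polyAct g.1 (reynoldsHom W ρ σ m) := by
  rw [reynoldsHom_apply, reynoldsHom_apply, map_smul, map_sum]
  refine congrArg (_ • ·) ?_
  refine Fintype.sum_equiv (Equiv.mulLeft g⁻¹) _ _ fun x => ?_
  rw [Equiv.coe_mulLeft, ← polyAct_mul, ← Module.End.mul_apply, ← map_mul]
  simp

theorem reynoldsHom_of_equivariant {M : Type*} [AddCommGroup M] [Module ℂ M]
    (ρ : Representation ℂ W M) (σ : M →ₗ[ℂ] PolyRing n)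
    (hσ : ∀ (g : W) m, σ (ρ g m) = polyAct g.1 (σ m)) : reynoldsHom W ρ σ = σ := by
  ext1 m
  rw [reynoldsHom_apply]
  simp_rw [← hσ, ← Module.End.mul_apply, ← map_mul]
  simp [← Nat.cast_smul_eq_nsmul ℂ, smul_smul, card_ne_zero_complex W]

/-- The Reynolds operator, averaging a polynomial over the group. -/
noncomputable def reynolds : PolyRing n →ₗ[ℂ] PolyRing n :=
  (Fintype.card W : ℂ)⁻¹ • ∑ g : W, (polyAct g.1).toLinearMap

theorem reynolds_apply (p : PolyRing n) :
    reynolds W p = (Fintype.card W : ℂ)⁻¹ • ∑ g : W, polyAct g.1 p := by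
  simp [reynolds]

theorem reynolds_mem (p : PolyRing n) : reynolds W p ∈ invariantRing W := by
  intro g hg
  rw [reynolds_apply, map_smul, map_sum]
  refine congrArg (_ • ·) ?_
  refine Fintype.sum_equiv (Equiv.mulLeft ⟨g, hg⟩) _ _ fun x => ?_
  rw [Equiv.coe_mulLeft, ← polyAct_mul]
  rfl

theorem reynolds_mul {s : PolyRing n} (hs : s ∈ invariantRing W) (p : PolyRing n) :
    reynolds W (s * p) = s * reynolds W p := by
  rw [reynolds_apply, reynolds_apply, mul_smul_comm, Finset.mul_sum]
  congr 1
  exact Finset.sum_congr rfl fun g _ => by rw [map_mul, hs _ g.2]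

theorem reynolds_of_mem {s : PolyRing n} (hs : s ∈ invariantRing W) : reynolds W s = s := by
  rw [reynolds_apply, Finset.sum_congr rfl fun g _ => hs _ g.2]
  simp [← Nat.cast_smul_eq_nsmul ℂ, smul_smul, card_ne_zero_complex W]

theorem constantCoeff_reynolds (p : PolyRing n) :
    MvPolynomial.constantCoeff (reynolds W p) = MvPolynomial.constantCoeff p := by
  have h : ∀ g : W, (MvPolynomial.constantCoeff (polyAct g.1 p)) =
    MvPolynomial.constantCoeff p := fun g => constantCoeff_subst _ _
  rw [reynolds_apply, MvPolynomial.smul_eq_C_mul, map_mul, map_sum,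
    Finset.sum_congr rfl fun g _ => h g]
  simp [card_ne_zero_complex W]

end Reynolds

section Generation

variable (W : Subgroup (Matrix.GeneralLinearGroup (Fin n) ℂ))

/-- The span of the products of invariants and harmonic polynomials. -/
noncomputable def invMulHarmonic : Submodule ℂ (PolyRing n) :=
  Submodule.span ℂ {x | ∃ s ∈ invariantRing W, ∃ h ∈ harmonic W, x = s * h}

theorem mul_mem_invMulHarmonic {s : PolyRing n} (hs : s ∈ invariantRing W) {x : PolyRing n}
    (hx : x ∈ invMulHarmonic W) : s * x ∈ invMulHarmonic W := by
  induction hx using Submodule.span_induction with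
  | mem x hx =>
    obtain ⟨s', hs', h, hh, rfl⟩ := hx
    exact Submodule.subset_span ⟨s * s', mul_mem hs hs', h, hh, by ring⟩
  | zero => simp
  | add x y _ _ hx hy => rw [mul_add]; exact add_mem hx hy
  | smul c x _ hx => rw [mul_smul_comm]; exact Submodule.smul_mem _ c hx

variable [Fintype W]

/-- Induction on the degree, using `S = I + H`: in an element of the Hilbert ideal the
coefficients of the invariants have lower degree. -/
theorem polyPart_le_invMulHarmonic (k : ℕ) : polyPart n k ≤ invMulHarmonic W := by
  induction k using Nat.strong_induction_on with
  | _ k ih =>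
  have hlow : ∀ j : ℤ, j < k → polyPart n j ≤ invMulHarmonic W := by
    intro j hj p hp
    rcases lt_or_ge j 0 with h | h
    · rw [eq_zero_of_mem_polyPart_neg hp h]; exact zero_mem _
    · lift j to ℕ using h
      exact ih j (by exact_mod_cast hj) hp
  intro p hp
  obtain ⟨q, hq, h, hh, hqk, -, rfl⟩ := exists_harmonic_add_hilbertIdeal W hp
  refine add_mem ?_ (Submodule.subset_span ⟨1, one_mem _, h, hh, by simp⟩)
  rw [← polyComp_of_mem hqk]
  clear hp hqk
  induction hq using Submodule.span_induction with
  | mem u hu =>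
    exact Submodule.subset_span ⟨_, polyComp_mem_invariantRing hu.1 k, 1, one_mem_harmonic W,
      by simp⟩
  | zero => simp
  | add x y _ _ hx hy => rw [map_add]; exact add_mem hx hy
  | smul a u hu h' =>
    clear h'
    induction hu using Submodule.span_induction generalizing a with
    | zero => simp
    | add x y _ _ hx hy => rw [smul_add, map_add]; exact add_mem (hx a) (hy a)
    | smul b x _ hx => rw [smul_smul]; exact hx _
    | mem u hu =>
    rw [smul_eq_mul, mul_comm, ← sum_polyComp u (Nat.lt_succ_self _), Finset.sum_mul, map_sum]
    refine Submodule.sum_mem _ fun i _ => ?_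
    rw [polyComp_homogeneous_mul (polyComp_mem _ _)]
    rcases Nat.eq_zero_or_pos i with rfl | hi
    · rw [Nat.cast_zero, eq_C_of_mem_polyPart_zero (polyComp_mem 0 u), constantCoeff_polyComp hu.2]
      simp
    · exact mul_mem_invMulHarmonic W (polyComp_mem_invariantRing hu.1 _)
        (hlow _ (by omega) (polyComp_mem _ _))

/-- `S` is generated by the harmonic polynomials over the invariants. -/
theorem mem_invMulHarmonic (p : PolyRing n) : p ∈ invMulHarmonic W := by
  rw [← sum_polyComp p (Nat.lt_succ_self _)]
  exact Submodule.sum_mem _ fun k _ => polyPart_le_invMulHarmonic W k (polyComp_mem _ _)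

variable {M : Type*} [AddCommGroup M] [Module ℂ M] (ρ : Representation ℂ W M)

/-- Multiplying a linear map into `S` by a polynomial. -/
noncomputable def mulHom (s : PolyRing n) (τ : M →ₗ[ℂ] PolyRing n) : M →ₗ[ℂ] PolyRing n :=
  LinearMap.mulLeft ℂ s ∘ₗ τ

theorem reynoldsHom_mem_homHarmonic {τ : M →ₗ[ℂ] PolyRing n} (hτ : ∀ m, τ m ∈ harmonic W) :
    reynoldsHom W ρ τ ∈ homHarmonic W ρ := by
  refine ⟨fun m => ?_, reynoldsHom_equivariant W ρ τ⟩
  rw [reynoldsHom_apply]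
  exact Submodule.smul_mem _ _ (Submodule.sum_mem _ fun g _ => polyAct_mem_harmonic W (hτ _) g.2)

theorem reynoldsHom_mulHom {s : PolyRing n} (hs : s ∈ invariantRing W)
    (τ : M →ₗ[ℂ] PolyRing n) : reynoldsHom W ρ (mulHom s τ) = mulHom s (reynoldsHom W ρ τ) := by
  ext1 m
  simp only [reynoldsHom_apply, mulHom, LinearMap.comp_apply, LinearMap.mulLeft_apply]
  rw [mul_smul_comm, Finset.mul_sum]
  congr 1
  exact Finset.sum_congr rfl fun g _ => by rw [map_mul, hs _ g.2]

/-- `Hom_W(M, S)` is generated by `Hom_W(M, H)` over the invariants: write the values on a basis of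
`M` as combinations of harmonic polynomials, and average. -/
theorem exists_eq_sum_mul_basis [FiniteDimensional ℂ M] {ι : Type*} [Fintype ι]
    (b : Module.Basis ι ℂ (homHarmonic W ρ)) {σ : M →ₗ[ℂ] PolyRing n}
    (hσ : ∀ (g : W) m, σ (ρ g m) = polyAct g.1 (σ m)) :
    ∃ s : ι → PolyRing n, (∀ i, s i ∈ invariantRing W) ∧ ∀ m, σ m = ∑ i, s i * (b i).1 m := by
  classical
  let T : Submodule ℂ (M →ₗ[ℂ] PolyRing n) :=
    { carrier := {σ | ∃ s : ι → PolyRing n, (∀ i, s i ∈ invariantRing W) ∧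
        ∀ m, σ m = ∑ i, s i * (b i).1 m}
      add_mem' := by
        rintro _ _ ⟨s, hs, h⟩ ⟨s', hs', h'⟩
        exact ⟨s + s', fun i => add_mem (hs i) (hs' i), fun m => by
          simp [h, h', add_mul, Finset.sum_add_distrib]⟩
      zero_mem' := ⟨0, fun _ => zero_mem _, fun m => by simp⟩
      smul_mem' := by
        rintro c _ ⟨s, hs, h⟩
        exact ⟨c • s, fun i => Subalgebra.smul_mem _ (hs i) c, fun m => by
          simp [h, Finset.smul_sum]⟩ }
  suffices h : ∀ τ : M →ₗ[ℂ] PolyRing n, reynoldsHom W ρ τ ∈ T by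
    rw [← reynoldsHom_of_equivariant W ρ σ hσ]
    exact h σ
  intro τ
  let e := Module.finBasis ℂ M
  have hτ : τ = ∑ i, LinearMap.smulRight (e.coord i) (τ (e i)) := by
    refine e.ext fun j => ?_
    simp [LinearMap.sum_apply, Finsupp.single_apply]
  rw [hτ, map_sum]
  refine Submodule.sum_mem _ fun i _ => ?_
  have hx := mem_invMulHarmonic W (τ (e i))
  generalize τ (e i) = x at hx
  induction hx using Submodule.span_induction with
  | mem x hx =>
    obtain ⟨s, hs, h, hh, rfl⟩ := hx
    have h1 : LinearMap.smulRight (e.coord i) (s * h) =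
        mulHom s (LinearMap.smulRight (e.coord i) h) := by
      ext1 m; simp [mulHom]
    have h2 : reynoldsHom W ρ (LinearMap.smulRight (e.coord i) h) ∈ homHarmonic W ρ :=
      reynoldsHom_mem_homHarmonic W ρ fun m => by
        rw [LinearMap.smulRight_apply]; exact Submodule.smul_mem _ _ hh
    rw [h1, reynoldsHom_mulHom W ρ hs]
    refine ⟨fun j => s * MvPolynomial.C (b.repr ⟨_, h2⟩ j), fun j =>
      mul_mem hs ((invariantRing W).algebraMap_mem _), fun m => ?_⟩
    have h3 := congrArg (fun z : homHarmonic W ρ => z.1 m) (b.sum_repr ⟨_, h2⟩)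
    simp only [Submodule.coe_sum, Submodule.coe_smul, LinearMap.sum_apply,
      LinearMap.smul_apply] at h3
    rw [mulHom, LinearMap.comp_apply, LinearMap.mulLeft_apply, ← h3, Finset.mul_sum]
    exact Finset.sum_congr rfl fun j _ => by rw [MvPolynomial.smul_eq_C_mul, mul_assoc]
  | zero =>
    convert zero_mem T
    ext1 m; simp
  | add x y _ _ hx hy =>
    have : LinearMap.smulRight (e.coord i) (x + y) =
      LinearMap.smulRight (e.coord i) x + LinearMap.smulRight (e.coord i) y := by
      ext1 m; simp
    rw [this, map_add]; exact add_mem hx hy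
  | smul c x _ hx =>
    have : LinearMap.smulRight (e.coord i) (c • x) = c • LinearMap.smulRight (e.coord i) x := by
      ext1 m; simp [smul_comm c]
    rw [this, map_smul]; exact Submodule.smul_mem _ c hx

/-- The graded form of `exists_eq_sum_mul_basis`. -/
theorem exists_eq_sum_mul_basis_of_mem_polyPart [FiniteDimensional ℂ M] {ι : Type*} [Fintype ι]
    (b : Module.Basis ι ℂ (homHarmonic W ρ)) {a : ι → ℤ} (ha : ∀ i m, (b i).1 m ∈ polyPart n (a i))
    {σ : M →ₗ[ℂ] PolyRing n} (hσ : ∀ (g : W) m, σ (ρ g m) = polyAct g.1 (σ m)) {D : ℤ}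
    (hD : ∀ m, σ m ∈ polyPart n D) :
    ∃ s : ι → PolyRing n, (∀ i, s i ∈ invariantRing W) ∧ (∀ i, s i ∈ polyPart n (D - a i)) ∧
      ∀ m, σ m = ∑ i, s i * (b i).1 m := by
  obtain ⟨s, hs, h⟩ := exists_eq_sum_mul_basis W ρ b hσ
  refine ⟨fun i => polyComp n (D - a i) (s i), fun i => polyComp_mem_invariantRing (hs i) _,
    fun i => polyComp_mem _ _, fun m => ?_⟩
  rw [← polyComp_of_mem (hD m), h, map_sum]
  refine Finset.sum_congr rfl fun i _ => ?_
  rw [mul_comm, polyComp_homogeneous_mul (ha i m), mul_comm]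

end Generation

section GradedBasis

variable (W : Subgroup (Matrix.GeneralLinearGroup (Fin n) ℂ))
variable {M : Type*} [AddCommGroup M] [Module ℂ M] (ρ : Representation ℂ W M)

/-- A direct path to an instance that is slow to find through the module structure of `S`. -/
noncomputable instance (N : Submodule ℂ (M →ₗ[ℂ] PolyRing n)) : AddCommGroup N :=
  Submodule.addCommGroup N

/-- A direct path to an instance that is slow to find through the module structure of `S`. -/
instance (N : Submodule ℂ (M →ₗ[ℂ] PolyRing n)) : Module.Free ℂ N :=
  Module.Free.of_divisionRing ℂ N

theorem homHarmonicPart_finiteDimensional [FiniteDimensional ℂ M] (k : ℤ) :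
    FiniteDimensional ℂ (homHarmonicPart W ρ k) := by
  let L : homHarmonicPart W ρ k →ₗ[ℂ] (M →ₗ[ℂ] polyPart n k) :=
    { toFun := fun σ => σ.1.codRestrict (polyPart n k) σ.2.2
      map_add' := fun a b => rfl
      map_smul' := fun c a => rfl }
  refine Module.Finite.of_injective L fun a b h => ?_
  ext1; ext1 m
  exact congrArg Subtype.val (LinearMap.congr_fun h m)

theorem comp_polyComp_mem_homHarmonicPart {σ : M →ₗ[ℂ] PolyRing n} (hσ : σ ∈ homHarmonic W ρ)
    (k : ℤ) : polyComp n k ∘ₗ σ ∈ homHarmonicPart W ρ k :=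
  ⟨⟨fun m => polyComp_mem_harmonic W (hσ.1 m) k, fun g m => by
    rw [LinearMap.comp_apply, hσ.2, polyComp_polyAct]; rfl⟩, fun m => polyComp_mem _ _⟩

/-- A family of subspaces separated by projections, whose projections sum to the identity, is a
direct sum decomposition. -/
theorem isInternal_of_projections {ι E F : Type*} [AddCommGroup E] [Module ℂ E]
    [AddCommGroup F] [Module ℂ F] [DecidableEq ι] (A : ι → Submodule ℂ E) (π : ι → E →ₗ[ℂ] F)
    (hinj : ∀ k, ∀ x ∈ A k, π k x = 0 → x = 0) (hne : ∀ j k, j ≠ k → ∀ x ∈ A j, π k x = 0)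
    (hspan : ∀ x, x ∈ ⨆ k, A k) : DirectSum.IsInternal A := by
  refine DirectSum.isInternal_submodule_of_iSupIndep_of_iSup_eq_top ?_
    (eq_top_iff.2 fun x _ => hspan x)
  intro k
  rw [Submodule.disjoint_def]
  intro x hk hx
  refine hinj k x hk ?_
  have : ⨆ j, ⨆ (_ : j ≠ k), A j ≤ LinearMap.ker (π k) :=
    iSup_le fun j => iSup_le fun hj => fun y hy => hne j k hj y hy
  exact this hx

theorem homHarmonicPart_isInternal [FiniteDimensional ℂ M] : DirectSum.IsInternal fun k : ℤ =>
    (homHarmonicPart W ρ k).comap (homHarmonic W ρ).subtype := by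
  classical
  let π (k : ℤ) : homHarmonic W ρ →ₗ[ℂ] (M →ₗ[ℂ] PolyRing n) :=
    { toFun := fun σ => polyComp n k ∘ₗ σ.1
      map_add' := fun σ τ => LinearMap.comp_add _ _ _
      map_smul' := fun c σ => LinearMap.comp_smul _ _ _ }
  apply isInternal_of_projections (F := M →ₗ[ℂ] PolyRing n) _ π
  · intro k σ hk h
    refine Subtype.ext (LinearMap.ext fun m => ?_)
    exact (polyComp_of_mem (hk.2 m)).symm.trans (LinearMap.congr_fun h m)
  · intro j k hjk σ hj
    exact LinearMap.ext fun m => polyComp_of_mem_ne (hj.2 m) hjk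
  · intro σ
    let e := Module.finBasis ℂ M
    let N := (Finset.univ.sup fun i => (σ.1 (e i)).totalDegree) + 1
    have hsum : σ = ∑ k ∈ Finset.range N, (⟨polyComp n k ∘ₗ σ.1,
        (comp_polyComp_mem_homHarmonicPart W ρ σ.2 k).1⟩ : homHarmonic W ρ) := by
      ext1
      refine e.ext fun i => ?_
      rw [Submodule.coe_sum, LinearMap.sum_apply]
      refine (sum_polyComp (σ.1 (e i)) ?_).symm
      exact Nat.lt_succ_of_le (Finset.le_sup (f := fun i => (σ.1 (e i)).totalDegree)
        (Finset.mem_univ i))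
    rw [hsum]
    refine Submodule.sum_mem _ fun k _ => ?_
    refine Submodule.mem_iSup_of_mem (k : ℤ) ?_
    exact comp_polyComp_mem_homHarmonicPart W ρ σ.2 k

/-- A homogeneous basis of `Hom_W(M, H)` with prescribed degrees. -/
theorem exists_homogeneous_basis [FiniteDimensional ℂ M] {a : Fin n → ℤ}
    (ha : ∀ k : ℤ, Nat.card {i // a i = k} = Module.finrank ℂ (homHarmonicPart W ρ k)) :
    ∃ b : Module.Basis (Fin n) ℂ (homHarmonic W ρ), ∀ i m, (b i).1 m ∈ polyPart n (a i) := by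
  classical
  have hfin := homHarmonicPart_finiteDimensional W ρ
  have hle : ∀ k, homHarmonicPart W ρ k ≤ homHarmonic W ρ := fun k σ h => h.1
  let v : ∀ k : ℤ, Module.Basis {i // a i = k} ℂ
      ((homHarmonicPart W ρ k).comap (homHarmonic W ρ).subtype) := fun k =>
    ((Module.finBasisOfFinrankEq ℂ _ (by rw [← ha k, Nat.card_eq_fintype_card])).map
      (Submodule.comapSubtypeEquivOfLe (hle k)).symm).reindex (Fintype.equivFin _).symm
  let b := (homHarmonicPart_isInternal W ρ).collectedBasis v
  refine ⟨b.reindex (Equiv.sigmaFiberEquiv a), fun i m => ?_⟩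
  rw [Module.Basis.reindex_apply]
  have := (homHarmonicPart_isInternal W ρ).collectedBasis_mem v ((Equiv.sigmaFiberEquiv a).symm i)
  exact this.2 m

end GradedBasis

end

/-! ### Basic invariants -/

section

variable {n : ℕ} {W : Subgroup (Matrix.GeneralLinearGroup (Fin n) ℂ)} {f : Fin n → PolyRing n}

section BasicInvariants

theorem C_mem_invariantRing (c : ℂ) : (MvPolynomial.C c : PolyRing n) ∈ invariantRing W :=
  (invariantRing W).algebraMap_mem c

theorem IsBasicInvariants.mem_invariantRing (hf : IsBasicInvariants W f) (i : Fin n) :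
    f i ∈ invariantRing W := by
  rw [← hf.adjoin_eq]
  exact Algebra.subset_adjoin (Set.mem_range_self i)

theorem IsBasicInvariants.ne_zero (hf : IsBasicInvariants W f) (i : Fin n) : f i ≠ 0 :=
  hf.algebraicIndependent.ne_zero i

theorem IsBasicInvariants.mem_polyPart (hf : IsBasicInvariants W f) (i : Fin n) :
    f i ∈ polyPart n (f i).totalDegree := by
  obtain ⟨e, he⟩ := hf.homogeneous i
  rw [he.totalDegree (hf.ne_zero i)]
  exact mem_polyPart_natCast.2 he

theorem IsBasicInvariants.exists_aeval (hf : IsBasicInvariants W f) {s : PolyRing n}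
    (hs : s ∈ invariantRing W) : ∃ F : MvPolynomial (Fin n) ℂ, MvPolynomial.aeval f F = s := by
  rw [← hf.adjoin_eq, Algebra.adjoin_range_eq_range_aeval] at hs
  exact hs

theorem IsBasicInvariants.aeval_mem (hf : IsBasicInvariants W f) (F : MvPolynomial (Fin n) ℂ) :
    MvPolynomial.aeval f F ∈ invariantRing W := by
  rw [← hf.adjoin_eq, Algebra.adjoin_range_eq_range_aeval]
  exact ⟨F, rfl⟩

theorem IsBasicInvariants.aeval_injective (hf : IsBasicInvariants W f) :
    Function.Injective (MvPolynomial.aeval f : MvPolynomial (Fin n) ℂ →ₐ[ℂ] PolyRing n) :=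
  hf.algebraicIndependent

theorem IsBasicInvariants.totalDegree_pos (hf : IsBasicInvariants W f) (i : Fin n) :
    0 < (f i).totalDegree := by
  by_contra h
  have h0 := MvPolynomial.totalDegree_eq_zero_iff_eq_C.1 (Nat.eq_zero_of_not_pos h)
  have h1 : MvPolynomial.aeval f (MvPolynomial.X i : MvPolynomial (Fin n) ℂ) =
      MvPolynomial.aeval f (MvPolynomial.C ((f i).coeff 0) : MvPolynomial (Fin n) ℂ) := by
    rw [MvPolynomial.aeval_X, MvPolynomial.aeval_C]
    exact h0
  have h2 := congrArg (MvPolynomial.coeff (Finsupp.single i 1)) (hf.aeval_injective h1)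
  have h3 : (0 : Fin n →₀ ℕ) ≠ Finsupp.single i 1 := fun h => by
    have := DFunLike.congr_fun h i
    simp at this
  rw [MvPolynomial.coeff_X, MvPolynomial.coeff_C, if_neg h3, if_pos rfl] at h2
  exact one_ne_zero h2

theorem IsBasicInvariants.constantCoeff_eq_zero (hf : IsBasicInvariants W f) (i : Fin n) :
    MvPolynomial.constantCoeff (f i) = 0 :=
  constantCoeff_of_mem_polyPart (hf.mem_polyPart i) (by
    have := hf.totalDegree_pos i; omega)

theorem IsBasicInvariants.constantCoeff_aeval (hf : IsBasicInvariants W f)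
    (F : MvPolynomial (Fin n) ℂ) :
    MvPolynomial.constantCoeff (MvPolynomial.aeval f F) = MvPolynomial.constantCoeff F := by
  induction F using MvPolynomial.induction_on with
  | C a => simp
  | add p q hp hq => simp only [map_add, hp, hq]
  | mul_X p i hp => simp [hf.constantCoeff_eq_zero]

/-- The polynomial expressing a homogeneous invariant in terms of basic invariants is weighted
homogeneous. -/
theorem IsBasicInvariants.weight_eq (hf : IsBasicInvariants W f) {F : MvPolynomial (Fin n) ℂ}
    {k : ℤ} (hF : MvPolynomial.aeval f F ∈ polyPart n k) (m : Fin n →₀ ℕ) (hm : F.coeff m ≠ 0) :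
    ∑ i, (m i : ℤ) * (f i).totalDegree = k := by
  classical
  let wt : (Fin n →₀ ℕ) → ℤ := fun m => ∑ i, (m i : ℤ) * (f i).totalDegree
  let F' : MvPolynomial (Fin n) ℂ :=
    ∑ m ∈ F.support with wt m = k, MvPolynomial.monomial m (F.coeff m)
  have hmon : ∀ (m : Fin n →₀ ℕ) (c : ℂ), 
      MvPolynomial.aeval f (MvPolynomial.monomial m c) ∈ polyPart n (wt m) := by
    intro m c
    refine aeval_mem_polyPart f _ hf.mem_polyPart _ _ fun m' hm' => ?_
    rw [MvPolynomial.coeff_monomial] at hm'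
    have : m = m' := by by_contra h; exact hm' (if_neg h)
    rw [this]
  have h1 : MvPolynomial.aeval f F = MvPolynomial.aeval f F' := by
    rw [← polyComp_of_mem hF]
    conv_lhs => rw [F.as_sum, map_sum, map_sum]
    rw [map_sum, Finset.sum_filter]
    refine Finset.sum_congr rfl fun m _ => ?_
    split_ifs with h
    · rw [polyComp_of_mem (h ▸ hmon m _)]
    · rw [polyComp_of_mem_ne (hmon m _) h]
  have h2 := hf.aeval_injective h1
  rw [h2, MvPolynomial.coeff_sum] at hm
  obtain ⟨m', hm', h⟩ := Finset.exists_ne_zero_of_sum_ne_zero hm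
  rw [MvPolynomial.coeff_monomial] at h
  have : m' = m := by by_contra h'; exact h (if_neg h')
  rw [← this]
  exact (Finset.mem_filter.1 hm').2

theorem IsBasicInvariants.hilbertIdeal_eq (hf : IsBasicInvariants W f) :
    hilbertIdeal W = Ideal.span (Set.range f) := by
  refine le_antisymm (Ideal.span_le.2 ?_) (Ideal.span_le.2 ?_)
  · rintro p ⟨hp, h0⟩
    obtain ⟨F, rfl⟩ := hf.exists_aeval hp
    rw [hf.constantCoeff_aeval] at h0
    have hF : F ∈ Ideal.span (Set.range (MvPolynomial.X : Fin n → MvPolynomial (Fin n) ℂ)) := by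
      rw [← Set.image_univ, MvPolynomial.mem_ideal_span_X_image]
      intro m hm
      by_contra! h
      have : m = 0 := by ext i; exact h i (Set.mem_univ i)
      rw [this, MvPolynomial.mem_support_iff, ← MvPolynomial.constantCoeff_eq] at hm
      exact hm h0
    have := Ideal.mem_map_of_mem (MvPolynomial.aeval f : MvPolynomial (Fin n) ℂ →ₐ[ℂ] PolyRing n) hF
    rw [Ideal.map_span, ← Set.range_comp] at this
    have hcomp : (MvPolynomial.aeval f : MvPolynomial (Fin n) ℂ →ₐ[ℂ] PolyRing n) ∘
        MvPolynomial.X = f := funext fun i => MvPolynomial.aeval_X f i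
    rwa [hcomp] at this
  · rintro _ ⟨i, rfl⟩
    exact Ideal.subset_span ⟨hf.mem_invariantRing i, hf.constantCoeff_eq_zero i⟩

/-- The differential of a polynomial, as a linear map `V → S`. -/
noncomputable def differential (p : PolyRing n) : (Fin n → ℂ) →ₗ[ℂ] PolyRing n where
  toFun u := ∑ k, MvPolynomial.C (u k) * MvPolynomial.pderiv k p
  map_add' u v := by simp [add_mul, Finset.sum_add_distrib]
  map_smul' c u := by simp [Finset.smul_sum, MvPolynomial.smul_eq_C_mul, mul_assoc]

theorem differential_single (p : PolyRing n) (k : Fin n) :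
    differential p (Pi.single k 1) = MvPolynomial.pderiv k p := by
  classical
  simp [differential, Pi.single_apply]

theorem differential_equivariant {p : PolyRing n} (hp : p ∈ invariantRing W) (g : W)
    (u : Fin n → ℂ) : differential p (stdRep W g u) = polyAct g.1 (differential p u) := by
  have h : ∀ j, MvPolynomial.pderiv j p = ∑ i, MvPolynomial.C ((g.1⁻¹).val i j) *
      polyAct g.1 (MvPolynomial.pderiv i p) := by
    intro j
    conv_lhs => rw [← hp g.1 g.2]
    exact pderiv_subst _ j p
  simp only [differential, LinearMap.coe_mk, AddHom.coe_mk]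
  rw [map_sum, Finset.sum_congr rfl fun j _ => by rw [h j, Finset.mul_sum], Finset.sum_comm]
  refine Finset.sum_congr rfl fun i _ => ?_
  rw [map_mul, polyAct_eq_subst, subst_C]
  simp_rw [← mul_assoc, ← Finset.sum_mul, ← map_mul, ← map_sum]
  congr 2
  have h1 : (g.1⁻¹).val.mulVec (g.1.val.mulVec u) = u := by
    rw [Matrix.mulVec_mulVec, ← Units.val_mul, inv_mul_cancel, Units.val_one, Matrix.one_mulVec]
  conv_rhs => rw [← h1]
  simp [Matrix.mulVec, dotProduct, stdRep, mul_comm]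

theorem differential_mem_polyPart {p : PolyRing n} {k : ℤ} (hp : p ∈ polyPart n k)
    (u : Fin n → ℂ) : differential p u ∈ polyPart n (k - 1) :=
  Submodule.sum_mem _ fun i _ => C_mul_mem_polyPart _ (pderiv_mem_polyPart hp i)

theorem mem_hilbertIdeal_iff (hf : IsBasicInvariants W f) {p : PolyRing n} :
    p ∈ hilbertIdeal W ↔ ∃ c : Fin n → PolyRing n, p = ∑ i, f i * c i := by
  rw [hf.hilbertIdeal_eq, Ideal.mem_span_range_iff_exists_fun]
  simp_rw [eq_comm (a := p), mul_comm]

/-- The differentials of the basic invariants are linearly independent modulo the Hilbert ideal: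
contracting a relation with the Euler field and averaging gives a relation between the `f i` modulo
products of two invariants without constant term. -/
theorem IsBasicInvariants.eq_zero_of_sum_pderiv_mem [Fintype W] (hf : IsBasicInvariants W f)
    (c : Fin n → ℂ)
    (h : ∀ k, ∑ i, MvPolynomial.C (c i) * MvPolynomial.pderiv k (f i) ∈ hilbertIdeal W) :
    c = 0 := by
  classical
  choose u hu using fun k => (mem_hilbertIdeal_iff hf).1 (h k)
  have h1 : ∑ i, MvPolynomial.C (c i * (f i).totalDegree) * f i =
      ∑ l, f l * ∑ k, MvPolynomial.X k * u k l := by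
    calc _ = ∑ i, MvPolynomial.C (c i) * ∑ k, MvPolynomial.X k * MvPolynomial.pderiv k (f i) := by
            refine Finset.sum_congr rfl fun i _ => ?_
            rw [euler_identity (hf.mem_polyPart i), MvPolynomial.smul_eq_C_mul, ← mul_assoc,
              ← map_mul]
            simp
      _ = ∑ k, MvPolynomial.X k * ∑ i, MvPolynomial.C (c i) * MvPolynomial.pderiv k (f i) := by
            simp_rw [Finset.mul_sum]
            rw [Finset.sum_comm]
            refine Finset.sum_congr rfl fun _ _ => Finset.sum_congr rfl fun _ _ => by ring
      _ = _ := by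
            simp_rw [hu, Finset.mul_sum]
            rw [Finset.sum_comm]
            refine Finset.sum_congr rfl fun _ _ => Finset.sum_congr rfl fun _ _ => by ring
  have h2 := congrArg (reynolds W) h1
  rw [reynolds_of_mem W (Subalgebra.sum_mem _ fun i _ => mul_mem
    (C_mem_invariantRing _) (hf.mem_invariantRing i)), map_sum] at h2
  choose G hG using fun l => hf.exists_aeval (reynolds_mem W (∑ k, MvPolynomial.X k * u k l))
  have hG0 : ∀ l, MvPolynomial.constantCoeff (G l) = 0 := by
    intro l
    rw [← hf.constantCoeff_aeval, hG, constantCoeff_reynolds]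
    simp
  have h3 : MvPolynomial.aeval f (∑ i, MvPolynomial.C (c i * (f i).totalDegree) *
      MvPolynomial.X i : MvPolynomial (Fin n) ℂ) =
      MvPolynomial.aeval f (∑ l, MvPolynomial.X l * G l) := by
    rw [map_sum (MvPolynomial.aeval f) (fun l => MvPolynomial.X l * G l)]
    simp only [map_mul, MvPolynomial.aeval_X, hG]
    refine Eq.trans ?_ (h2.trans (Finset.sum_congr rfl fun l _ =>
      reynolds_mul W (hf.mem_invariantRing l) _))
    simp
  have h4 := hf.aeval_injective h3
  funext i
  have h5 := congrArg (MvPolynomial.coeff (Finsupp.single i 1)) h4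
  rw [MvPolynomial.coeff_sum, MvPolynomial.coeff_sum, Finset.sum_eq_single i,
    Finset.sum_eq_single i] at h5
  · rw [MvPolynomial.coeff_C_mul, MvPolynomial.coeff_X, if_pos rfl, mul_one,
      ← add_zero (Finsupp.single i 1), MvPolynomial.coeff_X_mul, ← MvPolynomial.constantCoeff_eq,
      hG0, mul_eq_zero] at h5
    refine h5.resolve_right ?_
    exact_mod_cast (hf.totalDegree_pos i).ne'
  · intro l _ hl
    rw [MvPolynomial.coeff_X_mul', if_neg]
    simpa using hl
  · simp
  · intro l _ hl
    rw [MvPolynomial.coeff_C_mul, MvPolynomial.coeff_X, if_neg, mul_zero]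
    intro h
    have := DFunLike.congr_fun h l
    simp [hl.symm] at this
  · simp

end BasicInvariants

section Regular

theorem mem_otherInvariantsIdeal_iff {t : Fin n} {p : PolyRing n} :
    p ∈ otherInvariantsIdeal f t ↔
      ∃ c : Fin n → PolyRing n, p = ∑ i ∈ Finset.univ.erase t, f i * c i := by
  have h : f '' {i | i ≠ t} = f '' ((Finset.univ.erase t : Finset (Fin n)) : Set (Fin n)) := by
    congr 1; ext i; simp
  rw [otherInvariantsIdeal, h, Ideal.span, Submodule.mem_span_image_finset_iff_exists_fun]
  constructor
  · rintro ⟨c, hc⟩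
    refine ⟨fun i => if h : i ∈ Finset.univ.erase t then c ⟨i, h⟩ else 0, ?_⟩
    rw [← hc, ← Finset.sum_coe_sort (Finset.univ.erase t)]
    refine Finset.sum_congr rfl fun i _ => ?_
    simp only [dif_pos i.2, smul_eq_mul]
    rw [mul_comm]
  · rintro ⟨c, rfl⟩
    refine ⟨fun i => c i, ?_⟩
    rw [← Finset.sum_coe_sort (Finset.univ.erase t)]
    exact Finset.sum_congr rfl fun i _ => by rw [smul_eq_mul, mul_comm]

theorem polyAct_mem_otherInvariantsIdeal (hf : IsBasicInvariants W f) {t : Fin n} {p : PolyRing n}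
    (hp : p ∈ otherInvariantsIdeal f t) {g : Matrix.GeneralLinearGroup (Fin n) ℂ} (hg : g ∈ W) :
    polyAct g p ∈ otherInvariantsIdeal f t := by
  rw [mem_otherInvariantsIdeal_iff] at *
  obtain ⟨c, rfl⟩ := hp
  refine ⟨fun i => polyAct g (c i), ?_⟩
  rw [map_sum]
  exact Finset.sum_congr rfl fun i _ => by rw [map_mul, hf.mem_invariantRing i g hg]

/-- A polynomial minus its image under a reflection is divisible by the equation of the
hyperplane. -/
theorem exists_reflection_quotient {g : Matrix.GeneralLinearGroup (Fin n) ℂ}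
    (hg : IsReflection g) : ∃ α : PolyRing n, α ≠ 0 ∧ α ∈ polyPart n 1 ∧
      ∀ p, ∃ q, p - polyAct g p = α * q := by
  obtain ⟨u, w, huw⟩ : ∃ u w : Fin n → ℂ, ∀ i j, (g.val - 1) i j = u i * w j := by
    have h : Module.finrank ℂ (LinearMap.range (g.val - 1).mulVecLin) = 1 := hg
    obtain ⟨u, -, hu⟩ := finrank_eq_one_iff'.1 h
    choose w hw using fun j =>
      hu ⟨_, LinearMap.mem_range_self (g.val - 1).mulVecLin (Pi.single j 1)⟩
    refine ⟨u.1, w, fun i j => ?_⟩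
    have := congrFun (congrArg Subtype.val (hw j)) i
    simp only [Submodule.coe_smul, Pi.smul_apply, smul_eq_mul, Matrix.mulVecLin_apply,
      Matrix.mulVec_single_one, Matrix.col_apply] at this
    rw [← this, mul_comm]
  have hw : w ≠ 0 := by
    rintro rfl
    have h0 : g.val - 1 = 0 := by ext i j; simp [huw]
    have : (g.val - 1).rank = 1 := hg
    rw [h0, Matrix.rank_zero] at this
    exact zero_ne_one this
  set α : PolyRing n := ∑ j, MvPolynomial.C (w j) * MvPolynomial.X j with hα
  have hinv : ∀ i j, ((g⁻¹).val - 1) i j = -((g⁻¹).val.mulVec u i) * w j := by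
    intro i j
    have h1 : (g⁻¹).val - 1 = -((g⁻¹).val * (g.val - 1)) := by
      rw [mul_sub, ← Units.val_mul, inv_mul_cancel, Units.val_one, mul_one, neg_sub]
    rw [h1, Matrix.neg_apply, Matrix.mul_apply]
    simp only [huw, Matrix.mulVec, dotProduct]
    rw [neg_mul, Finset.sum_mul]
    simp [mul_assoc]
  refine ⟨α, ?_, ?_, ?_⟩
  · intro h0
    apply hw
    funext j
    have := congrArg (MvPolynomial.coeff (Finsupp.single j 1)) h0
    rw [hα, MvPolynomial.coeff_sum] at this
    simpa [MvPolynomial.coeff_C_mul, MvPolynomial.coeff_X, Finsupp.single_left_inj] using this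
  · exact Submodule.sum_mem _ fun j _ => C_mul_mem_polyPart _ (X_mem_polyPart j)
  · intro p
    have hX : ∀ i, ∃ q, MvPolynomial.X i - polyAct g (MvPolynomial.X i) = α * q := by
      intro i
      refine ⟨MvPolynomial.C ((g⁻¹).val.mulVec u i), ?_⟩
      have h2 : ∀ j, (g⁻¹).val i j = (1 : Matrix (Fin n) (Fin n) ℂ) i j -
          (g⁻¹).val.mulVec u i * w j := by
        intro j
        have := hinv i j
        rw [Matrix.sub_apply] at this
        linear_combination this
      rw [polyAct_eq_subst, subst_X, Finset.sum_congr rfl fun j _ => by rw [h2 j]]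
      simp only [map_sub, sub_mul, Finset.sum_sub_distrib, map_mul, hα, Finset.sum_mul]
      simp only [Matrix.one_apply, apply_ite MvPolynomial.C, map_one, map_zero, ite_mul, one_mul,
        zero_mul, Finset.sum_ite_eq, Finset.mem_univ, if_true, sub_sub_cancel]
      exact Finset.sum_congr rfl fun j _ => by ring
    induction p using MvPolynomial.induction_on with
    | C a => exact ⟨0, by rw [polyAct_eq_subst, subst_C]; simp⟩
    | add p q hp hq =>
      obtain ⟨a, ha⟩ := hp
      obtain ⟨b, hb⟩ := hq
      exact ⟨a + b, by rw [map_add]; linear_combination ha + hb⟩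
    | mul_X p i hp =>
      obtain ⟨a, ha⟩ := hp
      obtain ⟨b, hb⟩ := hX i
      refine ⟨a * MvPolynomial.X i + polyAct g p * b, ?_⟩
      rw [map_mul]
      linear_combination MvPolynomial.X i * ha + polyAct g p * hb

/-- `f t` is a nonzerodivisor modulo the other basic invariants. For a reflection `g` with linear
form `α` the quotient `(p - g p) / α` satisfies the same hypothesis in lower degree, so by induction
`p` is congruent to its average over `W`; for invariants the claim holds because `S^W` is a
polynomial ring. -/
theorem IsBasicInvariants.mem_of_mul_mem [Fintype W] (hf : IsBasicInvariants W f)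
    (hgen : Subgroup.closure {g | g ∈ W ∧ IsReflection g} = W) (t : Fin n) (p : PolyRing n)
    (hp : f t * p ∈ otherInvariantsIdeal f t) : p ∈ otherInvariantsIdeal f t := by
  classical
  induction hN : p.totalDegree using Nat.strong_induction_on generalizing p with
  | _ N ih =>
  subst hN
  obtain ⟨c, hc⟩ := mem_otherInvariantsIdeal_iff.1 hp
  have hrefl : ∀ g, g ∈ W → IsReflection g → p - polyAct g p ∈ otherInvariantsIdeal f t := by
    intro g hgW hg
    obtain ⟨α, hα0, hα1, hα⟩ := exists_reflection_quotient hg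
    obtain ⟨q, hq⟩ := hα p
    choose q' hq' using fun i => hα (c i)
    have h1 : f t * q = ∑ i ∈ Finset.univ.erase t, f i * q' i := by
      apply mul_left_cancel₀ hα0
      have h2 := congrArg (polyAct g) hc
      rw [map_mul, map_sum, hf.mem_invariantRing t g hgW] at h2
      calc α * (f t * q) = f t * p - f t * polyAct g p := by linear_combination -f t * hq
        _ = ∑ i ∈ Finset.univ.erase t, (f i * c i - polyAct g (f i * c i)) := by
            rw [h2, hc, Finset.sum_sub_distrib]
        _ = _ := by
            rw [Finset.mul_sum]
            refine Finset.sum_congr rfl fun i _ => ?_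
            rw [map_mul, hf.mem_invariantRing i g hgW]
            linear_combination f i * hq' i
    by_cases hq0 : q = 0
    · rw [hq, hq0, mul_zero]; exact zero_mem _
    rw [hq]
    refine Ideal.mul_mem_left _ _
      (ih q.totalDegree ?_ q (mem_otherInvariantsIdeal_iff.2 ⟨_, h1⟩) rfl)
    have h3 : (α * q).totalDegree = α.totalDegree + q.totalDegree :=
      MvPolynomial.totalDegree_mul_of_isDomain hα0 hq0
    have h4 : α.totalDegree = 1 :=
      ((mem_polyPart_natCast (k := 1)).1 (by exact_mod_cast hα1)).totalDegree hα0
    have h5 : (p - polyAct g p).totalDegree ≤ p.totalDegree := by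
      refine (MvPolynomial.totalDegree_sub _ _).trans (max_le le_rfl ?_)
      conv_lhs => rw [← sum_polyComp p (Nat.lt_succ_self _), map_sum]
      refine MvPolynomial.totalDegree_finsetSum_le fun i hi => ?_
      have := (mem_polyPart_natCast.1
        (polyAct_mem_polyPart g (polyComp_mem (i : ℤ) p))).totalDegree_le
      rw [Finset.mem_range] at hi
      omega
    rw [hq, h3, h4] at h5
    omega
  have hall : ∀ g ∈ W, p - polyAct g p ∈ otherInvariantsIdeal f t := by
    intro g hg
    have hsub : Subgroup.closure {g | g ∈ W ∧ IsReflection g} ≤ W := hgen.le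
    rw [← hgen] at hg
    induction hg using Subgroup.closure_induction with
    | mem g hg => exact hrefl g hg.1 hg.2
    | one => rw [polyAct_one, sub_self]; exact zero_mem _
    | mul g h hg' hh' hg hh =>
      have : p - polyAct (g * h) p = (p - polyAct g p) + polyAct g (p - polyAct h p) := by
        rw [polyAct_mul, map_sub]; ring
      rw [this]
      exact add_mem hg (polyAct_mem_otherInvariantsIdeal hf hh (hsub hg'))
    | inv g hg' hg =>
      have : p - polyAct g⁻¹ p = -polyAct g⁻¹ (p - polyAct g p) := by
        rw [map_sub, polyAct_inv_act]; ring
      rw [this]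
      exact neg_mem (polyAct_mem_otherInvariantsIdeal hf hg (inv_mem (hsub hg')))
  have havg : p - reynolds W p ∈ otherInvariantsIdeal f t := by
    have h1 : p - reynolds W p = (Fintype.card W : ℂ)⁻¹ • ∑ g : W, (p - polyAct g.1 p) := by
      rw [Finset.sum_sub_distrib, smul_sub, reynolds_apply]
      simp [← Nat.cast_smul_eq_nsmul ℂ, smul_smul, card_ne_zero_complex W]
    rw [h1, MvPolynomial.smul_eq_C_mul]
    exact Ideal.mul_mem_left _ _ (Submodule.sum_mem _ fun g _ => hall _ g.2)
  have hR : reynolds W p ∈ otherInvariantsIdeal f t := by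
    have h2 := congrArg (reynolds W) hc
    rw [reynolds_mul W (hf.mem_invariantRing t), map_sum,
      Finset.sum_congr rfl fun i _ => reynolds_mul W (hf.mem_invariantRing i) (c i)] at h2
    obtain ⟨G, hG⟩ := hf.exists_aeval (reynolds_mem W p)
    choose G' hG' using fun i => hf.exists_aeval (reynolds_mem W (c i))
    have h3 : MvPolynomial.aeval f (MvPolynomial.X t * G) =
        MvPolynomial.aeval f (∑ i ∈ Finset.univ.erase t, MvPolynomial.X i * G' i) := by
      simp only [map_sum, map_mul, MvPolynomial.aeval_X, hG, hG', h2]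
    have h4 := hf.aeval_injective h3
    have h5 : MvPolynomial.X t * G ∈
        Ideal.span ((MvPolynomial.X : Fin n → MvPolynomial (Fin n) ℂ) '' {i | i ≠ t}) := by
      rw [h4]
      refine Submodule.sum_mem _ fun i hi =>
        Ideal.mul_mem_right _ _ (Ideal.subset_span ⟨i, ?_, rfl⟩)
      exact Finset.ne_of_mem_erase hi
    have h6 : G ∈
        Ideal.span ((MvPolynomial.X : Fin n → MvPolynomial (Fin n) ℂ) '' {i | i ≠ t}) := by
      rw [MvPolynomial.mem_ideal_span_X_image] at h5 ⊢
      intro m hm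
      obtain ⟨i, hi, him⟩ := h5 (Finsupp.single t 1 + m) (by
        rw [MvPolynomial.mem_support_iff, MvPolynomial.coeff_X_mul]
        exact MvPolynomial.mem_support_iff.1 hm)
      refine ⟨i, hi, ?_⟩
      have hi' : t ≠ i := fun h => hi h.symm
      simpa [Finsupp.single_apply, hi'] using him
    have h7 := Ideal.mem_map_of_mem
      (MvPolynomial.aeval f : MvPolynomial (Fin n) ℂ →ₐ[ℂ] PolyRing n) h6
    rw [Ideal.map_span, hG, ← Set.image_comp] at h7
    have hcomp : (MvPolynomial.aeval f : MvPolynomial (Fin n) ℂ →ₐ[ℂ] PolyRing n) ∘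
        MvPolynomial.X = f := funext fun i => MvPolynomial.aeval_X f i
    rwa [hcomp] at h7
  have := add_mem havg hR
  rwa [sub_add_cancel] at this

/-- A point at which `f t` takes the value `1` and the other basic invariants vanish, by the
Nullstellensatz: averaging shows that these equations generate a proper ideal. -/
theorem IsBasicInvariants.exists_point [Fintype W] (hf : IsBasicInvariants W f) (t : Fin n) :
    ∃ v : Fin n → ℂ, ∀ i, MvPolynomial.eval v (f i) = if i = t then 1 else 0 := by
  classical
  let y : Fin n → ℂ := fun i => if i = t then 1 else 0
  let K : Ideal (PolyRing n) := Ideal.span (Set.range fun i => f i - MvPolynomial.C (y i))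
  have hK : K ≠ ⊤ := by
    intro h
    have h1 : (1 : PolyRing n) ∈ K := h ▸ Submodule.mem_top
    obtain ⟨c, hc⟩ := Ideal.mem_span_range_iff_exists_fun.1 h1
    have h2 := congrArg (reynolds W) hc
    choose G hG using fun i => hf.exists_aeval (reynolds_mem W (c i))
    have h3 : MvPolynomial.aeval f (∑ i, (MvPolynomial.X i - MvPolynomial.C (y i)) * G i) =
        MvPolynomial.aeval f (1 : MvPolynomial (Fin n) ℂ) := by
      rw [map_one, ← reynolds_of_mem W (one_mem (invariantRing W)), ← h2, map_sum, map_sum]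
      refine Finset.sum_congr rfl fun i _ => ?_
      rw [mul_comm (c i), reynolds_mul W (sub_mem (hf.mem_invariantRing i)
        (C_mem_invariantRing (y i))), ← hG]
      simp
    have h4 := congrArg (MvPolynomial.eval y) (hf.aeval_injective h3)
    simp at h4
  by_contra! hv
  apply hK
  rw [← Ideal.radical_eq_top, ← MvPolynomial.vanishingIdeal_zeroLocus_eq_radical (K := ℂ)]
  have : MvPolynomial.zeroLocus ℂ K = ∅ := by
    rw [Set.eq_empty_iff_forall_notMem]
    intro v hvK
    obtain ⟨i, hi⟩ := hv v
    apply hi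
    have := hvK (f i - MvPolynomial.C (y i)) (Ideal.subset_span ⟨i, rfl⟩)
    simpa [MvPolynomial.aeval_eq_eval, sub_eq_zero] using this
  rw [this, MvPolynomial.vanishingIdeal_empty]

end Regular

end

/-! ### Schur's lemma and homogeneous bases of a duality group -/

section

variable {n : ℕ} {W : Subgroup (Matrix.GeneralLinearGroup (Fin n) ℂ)} {f : Fin n → PolyRing n}

section Irreducible

/-- A nonzero stable subspace of an irreducible reflection representation is everything. -/
theorem IsIrreducibleReflectionGroup.eq_top (hW : IsIrreducibleReflectionGroup W)
    (U : Submodule ℂ (Fin n → ℂ)) (hU : ∀ g ∈ W, ∀ u ∈ U, g.val.mulVec u ∈ U) (h0 : U ≠ ⊥) :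
    U = ⊤ := by
  have := hW.irreducible
  let U' : Subrepresentation (stdRep W) := ⟨U, fun g u hu => hU g.1 g.2 u hu⟩
  rcases eq_bot_or_eq_top U' with h | h
  · exact absurd (congrArg Subrepresentation.toSubmodule h) h0
  · exact congrArg Subrepresentation.toSubmodule h

/-- The polynomial vector field attached to a linear map `V* → S`. -/
noncomputable def vectorField (φ : Module.Dual ℂ (Fin n → ℂ) →ₗ[ℂ] PolyRing n) (x : Fin n → ℂ) :
    Fin n → ℂ := fun k => MvPolynomial.eval x (φ (LinearMap.proj k))

theorem vectorField_equivariant {φ : Module.Dual ℂ (Fin n → ℂ) →ₗ[ℂ] PolyRing n}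
    (hφ : ∀ (g : W) l, φ ((stdRep W).dual g l) = polyAct g.1 (φ l))
    {g : Matrix.GeneralLinearGroup (Fin n) ℂ} (hg : g ∈ W) (x : Fin n → ℂ) :
    vectorField φ (g.val.mulVec x) = g.val.mulVec (vectorField φ x) := by
  have h : ∀ x, (g⁻¹).val.mulVec (vectorField φ x) = vectorField φ ((g⁻¹).val.mulVec x) := by
    intro x
    funext i
    have h1 := congrArg (MvPolynomial.eval x) (hφ ⟨g, hg⟩ (LinearMap.proj i))
    rw [dual_proj, eval_polyAct, map_sum, map_sum] at h1
    rw [vectorField, ← h1]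
    simp [Matrix.mulVec, dotProduct, vectorField, MvPolynomial.smul_eval]
  have h2 := h (g.val.mulVec x)
  rw [Matrix.mulVec_mulVec, ← Units.val_mul, inv_mul_cancel, Units.val_one,
    Matrix.one_mulVec] at h2
  rw [← h2, Matrix.mulVec_mulVec, ← Units.val_mul, mul_inv_cancel, Units.val_one,
    Matrix.one_mulVec]

theorem eq_sum_X_of_mem_polyPart_one {p : PolyRing n} (hp : p ∈ polyPart n 1) :
    p = ∑ i, MvPolynomial.C (p.coeff (Finsupp.single i 1)) * MvPolynomial.X i := by
  have h := euler_identity hp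
  rw [Int.cast_one, one_smul] at h
  rw [← h]
  refine Finset.sum_congr rfl fun i _ => ?_
  rw [h, eq_C_of_mem_polyPart_zero (pderiv_mem_polyPart hp i), MvPolynomial.constantCoeff_eq,
    MvPolynomial.coeff_pderiv, mul_comm]
  simp

/-- Schur's lemma for equivariant linear vector fields. -/
theorem IsIrreducibleReflectionGroup.schur (hW : IsIrreducibleReflectionGroup W)
    {φ : Module.Dual ℂ (Fin n → ℂ) →ₗ[ℂ] PolyRing n}
    (hφ : ∀ (g : W) l, φ ((stdRep W).dual g l) = polyAct g.1 (φ l))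
    (h1 : ∀ l, φ l ∈ polyPart n 1) :
    ∃ c : ℂ, ∀ k, φ (LinearMap.proj k) = MvPolynomial.C c * MvPolynomial.X k := by
  rcases isEmpty_or_nonempty (Fin n) with hn | hn
  · exact ⟨0, fun k => isEmptyElim k⟩
  let T : (Fin n → ℂ) →ₗ[ℂ] (Fin n → ℂ) := Matrix.toLin' (Matrix.of fun k i =>
    (φ (LinearMap.proj k)).coeff (Finsupp.single i 1))
  have hT : ∀ x, T x = vectorField φ x := by
    intro x
    funext k
    rw [vectorField, eq_sum_X_of_mem_polyPart_one (h1 (LinearMap.proj k))]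
    simp only [T, Matrix.toLin'_apply, Matrix.mulVec, dotProduct, Matrix.of_apply, map_sum,
      map_mul, MvPolynomial.eval_C, MvPolynomial.eval_X]
  obtain ⟨c, hc⟩ := Module.End.exists_eigenvalue T
  have htop := hW.eq_top (Module.End.eigenspace T c) (fun g hg u hu => by
    rw [Module.End.mem_eigenspace_iff] at *
    rw [hT, vectorField_equivariant hφ hg, ← hT, hu, Matrix.mulVec_smul]) hc
  refine ⟨c, fun k => MvPolynomial.funext fun x => ?_⟩
  have hx : T x = c • x := Module.End.mem_eigenspace_iff.1 (htop ▸ Submodule.mem_top)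
  have := congrFun ((hT x).symm.trans hx) k
  simpa [vectorField] using this

end Irreducible

/-- Homogeneous bases of `Hom_W(V, H)` and `Hom_W(V*, H)` for a duality group, with the degrees of
their elements. -/
structure DualityBases (W : Subgroup (Matrix.GeneralLinearGroup (Fin n) ℂ)) where
  /-- the basis of `Hom_W(V, H)` -/
  σ : Module.Basis (Fin n) ℂ (HomV W)
  /-- the basis of `Hom_W(V*, H)` -/
  φ : Module.Basis (Fin n) ℂ (HomVDual W)
  /-- the degrees -/
  deg : Fin n → ℤ
  /-- the codegrees -/
  codeg : Fin n → ℤ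
  /-- the highest degree -/
  d : ℤ
  σ_mem : ∀ i m, (σ i).1 m ∈ polyPart n (deg i - 1)
  φ_mem : ∀ i m, (φ i).1 m ∈ polyPart n (codeg i + 1)
  deg_le : ∀ i, deg i ≤ d
  exists_deg_eq : ∃ i, deg i = d
  add_eq : ∀ i, deg i + codeg i = d

theorem IsDualityGroup.exists_bases (h : IsDualityGroup W) : Nonempty (DualityBases W) := by
  obtain ⟨deg, codeg, hdeg, hcodeg, d, hd, hadd⟩ := h
  obtain ⟨σ, hσ⟩ := exists_homogeneous_basis W (stdRep W) (a := fun i => deg i - 1) fun k => by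
    have := hdeg.2 (k + 1)
    rw [add_sub_cancel_right] at this
    rw [← this]
    exact Nat.card_congr (Equiv.subtypeEquivRight fun i => by omega)
  obtain ⟨φ, hφ⟩ := exists_homogeneous_basis W (stdRep W).dual (a := fun i => codeg i + 1)
    fun k => by
      have := hcodeg.2 (k - 1)
      rw [sub_add_cancel] at this
      rw [← this]
      exact Nat.card_congr (Equiv.subtypeEquivRight fun i => by omega)
  exact ⟨⟨σ, φ, deg, codeg, d, hσ, hφ, fun i => hd.2 (Set.mem_range_self i), hd.1, hadd⟩⟩

namespace DualityBases

variable (B : DualityBases W)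

theorem one_le_deg (i : Fin n) : 1 ≤ B.deg i := by
  by_contra h
  apply B.σ.ne_zero i
  refine Subtype.ext (LinearMap.ext fun m => ?_)
  exact eq_zero_of_mem_polyPart_neg (B.σ_mem i m) (by omega)

theorem codeg_nonneg (i : Fin n) : 0 ≤ B.codeg i := by
  have := B.add_eq i
  have := B.deg_le i
  omega

/-- No degree equals `1`. Otherwise `W` would be trivial, acting on a line, and there would be a
constant element of `Hom_W(V*, H)`, hence a negative codegree. -/
theorem two_le_deg (hW : IsIrreducibleReflectionGroup W) (i : Fin n) : 2 ≤ B.deg i := by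
  classical
  by_contra h
  have h1 : B.deg i = 1 := by have := B.one_le_deg i; omega
  -- a degree `1` gives an invariant linear functional `l`, hence `W` acts trivially
  have hc : ∀ m, (B.σ i).1 m = MvPolynomial.C (MvPolynomial.constantCoeff ((B.σ i).1 m)) :=
    fun m => eq_C_of_mem_polyPart_zero (by simpa [h1] using B.σ_mem i m)
  let l : (Fin n → ℂ) →ₗ[ℂ] ℂ :=
    MvPolynomial.lcoeff ℂ (0 : Fin n →₀ ℕ) ∘ₗ (B.σ i).1
  have hl : ∀ m, (B.σ i).1 m = MvPolynomial.C (l m) := hc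
  have hlg : ∀ (g : W) m, l (stdRep W g m) = l m := by
    intro g m
    have := (B.σ i).2.2 g m
    rw [hl, hl, polyAct_eq_subst, subst_C] at this
    exact MvPolynomial.C_injective _ _ this
  have hl0 : l ≠ 0 := by
    intro h0
    apply B.σ.ne_zero i
    refine Subtype.ext (LinearMap.ext fun m => ?_)
    rw [hl, h0]; simp
  have hker : LinearMap.ker l = ⊥ := by
    by_contra hne
    have := hW.eq_top (LinearMap.ker l) (fun g hg u hu => by
      rw [LinearMap.mem_ker] at *
      exact (hlg ⟨g, hg⟩ u).trans hu) hne
    exact hl0 (LinearMap.ker_eq_top.1 this)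
  have htriv : ∀ (g : W) m, stdRep W g m = m := fun g m =>
    LinearMap.ker_eq_bot.1 hker (hlg g m)
  obtain ⟨u, hu⟩ : ∃ u, l u ≠ 0 := by
    by_contra! h; exact hl0 (LinearMap.ext h)
  -- so there is a constant element of `Hom_W(V*, H)`, although all codegrees are nonnegative
  let ψ : Module.Dual ℂ (Fin n → ℂ) →ₗ[ℂ] PolyRing n :=
    (Algebra.linearMap ℂ (PolyRing n)) ∘ₗ (Module.Dual.eval ℂ (Fin n → ℂ) u)
  have hψ : ψ ∈ homHarmonic W (stdRep W).dual := by
    refine ⟨fun m => ?_, fun g m => ?_⟩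
    · have : ψ m = m u • (1 : PolyRing n) := by
        change algebraMap ℂ (PolyRing n) (m u) = _
        exact Algebra.algebraMap_eq_smul_one _
      rw [this]
      exact Submodule.smul_mem _ _ (one_mem_harmonic W)
    · have h2 : ∀ m, ψ m = MvPolynomial.C (m u) := fun m => rfl
      rw [h2, h2, polyAct_eq_subst, subst_C, Representation.dual_apply,
        Module.Dual.transpose_apply, LinearMap.comp_apply, htriv]
  have h3 := congrArg (fun z : HomVDual W => z.1 l) (B.φ.sum_repr ⟨ψ, hψ⟩)
  simp only [Submodule.coe_sum, Submodule.coe_smul, LinearMap.sum_apply,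
    LinearMap.smul_apply] at h3
  have h4 := congrArg (polyComp n 0) h3
  rw [map_sum, Finset.sum_eq_zero, show ψ l = MvPolynomial.C (l u) from rfl,
    polyComp_of_mem (C_mem_polyPart (l u))] at h4
  · exact hu (by simpa using h4.symm)
  · intro j _
    rw [map_smul, polyComp_of_mem_ne (B.φ_mem j l) (by have := B.codeg_nonneg j; omega), smul_zero]

end DualityBases

/-- A surjective endomorphism of a Noetherian ring is injective. -/
theorem injective_of_surjective_ringHom {R : Type*} [CommRing R] [IsNoetherianRing R] (φ : R →+* R)
    (h : Function.Surjective φ) : Function.Injective φ := by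
  have hmono : Monotone fun k : ℕ => RingHom.ker (φ ^ k) := by
    refine monotone_nat_of_le_succ fun k x hx => ?_
    rw [RingHom.mem_ker] at *
    rw [pow_succ', RingHom.mul_def, RingHom.comp_apply, hx, map_zero]
  obtain ⟨N, hN⟩ := monotone_stabilizes_iff_noetherian.2 ‹IsNoetherianRing R› ⟨_, hmono⟩
  have hsurj : Function.Surjective (φ ^ N) := by
    rw [RingHom.coe_pow]; exact h.iterate N
  rw [injective_iff_map_eq_zero]
  intro x hx
  obtain ⟨y, rfl⟩ := hsurj x
  have h1 : y ∈ RingHom.ker (φ ^ (N + 1)) := by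
    rw [RingHom.mem_ker, pow_succ', RingHom.mul_def, RingHom.comp_apply, hx]
  rw [show RingHom.ker (φ ^ (N + 1)) = RingHom.ker (φ ^ N) from
    (hN (N + 1) (Nat.le_succ N)).symm] at h1
  exact h1

namespace DualityBases

variable (B : DualityBases W)

/-- The expansion of the differentials of the basic invariants in the basis of `Hom_W(V, H)`. -/
theorem exists_expansion [Fintype W] (hf : IsBasicInvariants W f) :
    ∃ s : Fin n → Fin n → PolyRing n, (∀ i j, s i j ∈ invariantRing W) ∧
      (∀ i j, s i j ∈ polyPart n ((f i).totalDegree - B.deg j)) ∧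
      ∀ i m, differential (f i) m = ∑ j, s i j * (B.σ j).1 m := by
  choose s h1 h2 h3 using fun i => exists_eq_sum_mul_basis_of_mem_polyPart W (stdRep W) B.σ B.σ_mem
    (differential_equivariant (hf.mem_invariantRing i))
    (differential_mem_polyPart (hf.mem_polyPart i))
  refine ⟨s, h1, fun i j => ?_, h3⟩
  have := h2 i j
  rwa [show ((f i).totalDegree : ℤ) - 1 - (B.deg j - 1) = (f i).totalDegree - B.deg j by
    ring] at this

/-- The constant terms of the coefficients in `exists_expansion` form an invertible matrix, because
the differentials of the `f i` are independent modulo the Hilbert ideal. -/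
theorem isUnit_constantCoeff [Fintype W] (hf : IsBasicInvariants W f)
    {s : Fin n → Fin n → PolyRing n} (hs : ∀ i j, s i j ∈ invariantRing W)
    (hexp : ∀ i m, differential (f i) m = ∑ j, s i j * (B.σ j).1 m) :
    IsUnit (Matrix.of fun i j => MvPolynomial.constantCoeff (s i j)) := by
  rw [← Matrix.vecMul_injective_iff_isUnit]
  refine (injective_iff_map_eq_zero
    (Matrix.vecMulLinear (Matrix.of fun i j => MvPolynomial.constantCoeff (s i j)))).2 ?_
  intro a ha
  refine hf.eq_zero_of_sum_pderiv_mem a fun k => ?_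
  have h1 : ∑ i, MvPolynomial.C (a i) * MvPolynomial.pderiv k (f i) =
      ∑ j, (∑ i, MvPolynomial.C (a i) * s i j) * (B.σ j).1 (Pi.single k 1) := by
    simp_rw [← differential_single, hexp, Finset.mul_sum, Finset.sum_mul]
    rw [Finset.sum_comm]
    simp_rw [mul_assoc]
  rw [h1]
  refine Submodule.sum_mem _ fun j _ => Ideal.mul_mem_right _ _ (Ideal.subset_span ⟨?_, ?_⟩)
  · exact Subalgebra.sum_mem _ fun i _ => mul_mem (C_mem_invariantRing _) (hs i j)
  · have := congrFun ha j
    simpa [Matrix.vecMul, dotProduct] using this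

/-- The highest degree of the basic invariants is the highest degree `d`. -/
theorem totalDegree_eq [Fintype W] (hf : IsBasicInvariants W f) {t : Fin n}
    (ht : ∀ i, (f i).totalDegree ≤ (f t).totalDegree) : ((f t).totalDegree : ℤ) = B.d := by
  obtain ⟨s, hs, hsdeg, hexp⟩ := B.exists_expansion hf
  have hu := B.isUnit_constantCoeff hf hs hexp
  have hdeg : ∀ i j,
      MvPolynomial.constantCoeff (s i j) ≠ 0 → ((f i).totalDegree : ℤ) = B.deg j := by
    intro i j h
    by_contra h'
    exact h (constantCoeff_of_mem_polyPart (hsdeg i j) (by omega))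
  rw [Matrix.isUnit_iff_isUnit_det, isUnit_iff_ne_zero] at hu
  apply le_antisymm
  · obtain ⟨j, hj⟩ : ∃ j, MvPolynomial.constantCoeff (s t j) ≠ 0 := by
      by_contra! h
      exact hu (Matrix.det_eq_zero_of_row_eq_zero t h)
    rw [hdeg t j hj]
    exact B.deg_le j
  · obtain ⟨j, hj⟩ := B.exists_deg_eq
    obtain ⟨i, hi⟩ : ∃ i, MvPolynomial.constantCoeff (s i j) ≠ 0 := by
      by_contra! h
      exact hu (Matrix.det_eq_zero_of_column_eq_zero j h)
    rw [← hj, ← hdeg i j hi]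
    exact_mod_cast ht i

theorem toInvariant_coe (σ : HomV W) :
    (toInvariant W σ : PolyRing n) = ∑ k, σ.1 (Pi.single k 1) * MvPolynomial.X k := by
  have h : ∀ i : Fin n, linForm n (LinearMap.proj i) = MvPolynomial.X i := by
    intro i
    classical
    simp [linForm, Pi.single_apply]
  change contract σ.1 (linForm n) = _
  simp [contract, h]

/-- The invariants `σ̃` attached to a homogeneous basis of `Hom_W(V, H)` are basic invariants: by
Euler's identity they generate the ideal of `S^W` of invariants without constant term, hence the
algebra `S^W`, and `n` generators of a polynomial ring in `n` variables are independent. -/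
theorem isBasicInvariants [Fintype W] (hf : IsBasicInvariants W f) :
    IsBasicInvariants W fun j => (toInvariant W (B.σ j) : PolyRing n) := by
  set y : Fin n → PolyRing n := fun j => (toInvariant W (B.σ j) : PolyRing n) with hy
  have hydeg : ∀ j, y j ∈ polyPart n (B.deg j) := by
    intro j
    simp only [hy, toInvariant_coe]
    refine Submodule.sum_mem _ fun k _ => ?_
    have := mul_mem_polyPart (B.σ_mem j (Pi.single k 1)) (X_mem_polyPart k)
    rwa [sub_add_cancel] at this
  obtain ⟨s, hs, hsdeg, hexp⟩ := B.exists_expansion hf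
  have heuler : ∀ i, MvPolynomial.C ((f i).totalDegree : ℂ) * f i = ∑ j, s i j * y j := by
    intro i
    have h1 := euler_identity (hf.mem_polyPart i)
    rw [MvPolynomial.smul_eq_C_mul, Int.cast_natCast] at h1
    rw [← h1]
    simp only [hy, toInvariant_coe, ← differential_single, hexp, Finset.mul_sum]
    rw [Finset.sum_comm]
    refine Finset.sum_congr rfl fun _ _ => Finset.sum_congr rfl fun _ _ => by ring
  have hadj : Algebra.adjoin ℂ (Set.range y) = invariantRing W := by
    refine le_antisymm (Algebra.adjoin_le ?_) ?_
    · rintro _ ⟨j, rfl⟩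
      exact (toInvariant W (B.σ j)).2
    have key : ∀ k : ℕ, ∀ p ∈ invariantRing W, p ∈ polyPart n k →
        p ∈ Algebra.adjoin ℂ (Set.range y) := by
      intro k
      induction k using Nat.strong_induction_on with
      | _ k ih =>
      intro p hp hpk
      rcases Nat.eq_zero_or_pos k with rfl | hk
      · rw [eq_C_of_mem_polyPart_zero (p := p) (by exact_mod_cast hpk)]
        exact Subalgebra.algebraMap_mem _ _
      have hpI : p ∈ hilbertIdeal W := Ideal.subset_span
        ⟨hp, constantCoeff_of_mem_polyPart hpk (by omega)⟩
      obtain ⟨c, hc⟩ := (mem_hilbertIdeal_iff hf).1 hpI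
      let c' : Fin n → PolyRing n := fun i =>
        polyComp n (k - (f i).totalDegree) (reynolds W (c i))
      have hc' : p = ∑ i, f i * c' i := by
        rw [← polyComp_of_mem hpk, ← reynolds_of_mem W hp, hc, map_sum, map_sum]
        refine Finset.sum_congr rfl fun i _ => ?_
        rw [reynolds_mul W (hf.mem_invariantRing i), polyComp_homogeneous_mul (hf.mem_polyPart i)]
      have hp2 : p = ∑ j, (∑ i, MvPolynomial.C ((f i).totalDegree : ℂ)⁻¹ * s i j * c' i) * y j := by
        simp_rw [Finset.sum_mul]
        rw [Finset.sum_comm, hc']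
        refine Finset.sum_congr rfl fun i _ => ?_
        have h1 : f i = MvPolynomial.C ((f i).totalDegree : ℂ)⁻¹ * ∑ j, s i j * y j := by
          rw [← heuler, ← mul_assoc, ← map_mul, inv_mul_cancel₀
            (by exact_mod_cast (hf.totalDegree_pos i).ne'), map_one, one_mul]
        conv_lhs => rw [h1]
        rw [Finset.mul_sum, Finset.sum_mul]
        exact Finset.sum_congr rfl fun j _ => by ring
      rw [hp2]
      refine Subalgebra.sum_mem _ fun j _ => mul_mem ?_ (Algebra.subset_adjoin ⟨j, rfl⟩)
      set q := ∑ i, MvPolynomial.C ((f i).totalDegree : ℂ)⁻¹ * s i j * c' i with hq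
      have hqinv : q ∈ invariantRing W := Subalgebra.sum_mem _ fun i _ => mul_mem (mul_mem
        (C_mem_invariantRing _) (hs i j)) (polyComp_mem_invariantRing (reynolds_mem W _) _)
      have hqdeg : q ∈ polyPart n (k - B.deg j) := Submodule.sum_mem _ fun i _ => by
        have := mul_mem_polyPart (C_mul_mem_polyPart ((f i).totalDegree : ℂ)⁻¹ (hsdeg i j))
          (polyComp_mem (k - (f i).totalDegree) (reynolds W (c i)))
        rwa [show ((f i).totalDegree : ℤ) - B.deg j + (k - (f i).totalDegree) = k - B.deg j by
          ring] at this
      rcases lt_or_ge ((k : ℤ) - B.deg j) 0 with h | h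
      · rw [eq_zero_of_mem_polyPart_neg hqdeg h]; exact zero_mem _
      · have h1 := B.one_le_deg j
        refine ih ((k : ℤ) - B.deg j).toNat (by omega) q hqinv ?_
        rwa [Int.toNat_of_nonneg h]
    intro p hp
    rw [← sum_polyComp p (Nat.lt_succ_self _)]
    exact Subalgebra.sum_mem _ fun k _ =>
      key k _ (polyComp_mem_invariantRing hp _) (polyComp_mem _ _)
  refine ⟨fun j => ?_, ?_, hadj⟩
  · have := B.one_le_deg j
    refine ⟨(B.deg j).toNat, mem_polyPart_natCast.1 ?_⟩
    rw [Int.toNat_of_nonneg (by omega)]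
    exact hydeg j
  · -- `ℂ[Y] → S^W ≅ ℂ[X]` is a surjective endomorphism of a Noetherian ring
    have hE : ∀ F : MvPolynomial (Fin n) ℂ, ∃ G : MvPolynomial (Fin n) ℂ,
        MvPolynomial.aeval f G = MvPolynomial.aeval y F := by
      intro F
      apply hf.exists_aeval
      rw [← hadj, Algebra.adjoin_range_eq_range_aeval]
      exact ⟨F, rfl⟩
    let G : Fin n → MvPolynomial (Fin n) ℂ := fun j => (hE (MvPolynomial.X j)).choose
    have hG : ∀ j, MvPolynomial.aeval f (G j) = y j := fun j => by
      rw [(hE (MvPolynomial.X j)).choose_spec, MvPolynomial.aeval_X]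
    have hcomp : ∀ F : MvPolynomial (Fin n) ℂ,
        MvPolynomial.aeval f (MvPolynomial.aeval G F) = MvPolynomial.aeval y F := by
      intro F
      have : (MvPolynomial.aeval f).comp (MvPolynomial.aeval G) =
          (MvPolynomial.aeval y : MvPolynomial (Fin n) ℂ →ₐ[ℂ] PolyRing n) := by
        apply MvPolynomial.algHom_ext
        intro j
        rw [AlgHom.comp_apply, MvPolynomial.aeval_X, MvPolynomial.aeval_X, hG]
      exact DFunLike.congr_fun this F
    have hsurj : Function.Surjective
        (MvPolynomial.aeval G : MvPolynomial (Fin n) ℂ →ₐ[ℂ] MvPolynomial (Fin n) ℂ) := by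
      intro F
      have h1 : MvPolynomial.aeval f F ∈ Algebra.adjoin ℂ (Set.range y) := by
        rw [hadj]; exact hf.aeval_mem F
      rw [Algebra.adjoin_range_eq_range_aeval] at h1
      obtain ⟨F', hF'⟩ := h1
      refine ⟨F', hf.aeval_injective ?_⟩
      rw [hcomp]
      exact hF'
    have hinj := injective_of_surjective_ringHom (MvPolynomial.aeval G :
      MvPolynomial (Fin n) ℂ →ₐ[ℂ] MvPolynomial (Fin n) ℂ).toRingHom hsurj
    intro F F' h
    apply hinj
    apply hf.aeval_injective
    exact (hcomp F).trans (h.trans (hcomp F').symm)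

end DualityBases

end

/-! ### Derivations of the invariant ring -/

section

variable {n : ℕ} {W : Subgroup (Matrix.GeneralLinearGroup (Fin n) ℂ)} {f : Fin n → PolyRing n}

section Derivations

/-- The invariant ring as a polynomial ring in basic invariants. -/
noncomputable def IsBasicInvariants.polyEquiv {y : Fin n → invariantRing W}
    (hy : IsBasicInvariants W fun j => (y j : PolyRing n)) :
    MvPolynomial (Fin n) ℂ ≃ₐ[ℂ] invariantRing W :=
  AlgEquiv.ofBijective (MvPolynomial.aeval y) (by
    have h : ∀ F : MvPolynomial (Fin n) ℂ,
        ((MvPolynomial.aeval y F : invariantRing W) : PolyRing n) =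
        MvPolynomial.aeval (fun j => (y j : PolyRing n)) F := fun F => by
      have : (invariantRing W).val.comp (MvPolynomial.aeval y) =
          (MvPolynomial.aeval (fun j => (y j : PolyRing n)) :
            MvPolynomial (Fin n) ℂ →ₐ[ℂ] PolyRing n) := by
        apply MvPolynomial.algHom_ext; intro j; simp
      exact DFunLike.congr_fun this F
    refine ⟨fun F F' hF => hy.aeval_injective ?_, fun x => ?_⟩
    · rw [← h, ← h, hF]
    · obtain ⟨F, hF⟩ := hy.exists_aeval x.2
      exact ⟨F, Subtype.ext ((h F).trans hF)⟩)

theorem IsBasicInvariants.polyEquiv_X {y : Fin n → invariantRing W}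
    (hy : IsBasicInvariants W fun j => (y j : PolyRing n)) (j : Fin n) :
    hy.polyEquiv (MvPolynomial.X j) = y j := by
  exact MvPolynomial.aeval_X y j

theorem IsBasicInvariants.coe_polyEquiv {y : Fin n → invariantRing W}
    (hy : IsBasicInvariants W fun j => (y j : PolyRing n)) (F : MvPolynomial (Fin n) ℂ) :
    (hy.polyEquiv F : PolyRing n) = MvPolynomial.aeval (fun j => (y j : PolyRing n)) F := by
  have : (invariantRing W).val.comp (hy.polyEquiv : MvPolynomial (Fin n) ℂ →ₐ[ℂ] invariantRing W) =
      (MvPolynomial.aeval (fun j => (y j : PolyRing n)) :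
        MvPolynomial (Fin n) ℂ →ₐ[ℂ] PolyRing n) := by
    apply MvPolynomial.algHom_ext; intro j
    rw [AlgHom.comp_apply, MvPolynomial.aeval_X]
    exact congrArg Subtype.val (hy.polyEquiv_X j)
  exact DFunLike.congr_fun this F

/-- The derivation of `S^W` with prescribed values on basic invariants. -/
noncomputable def IsBasicInvariants.mkDer {y : Fin n → invariantRing W}
    (hy : IsBasicInvariants W fun j => (y j : PolyRing n)) (l : Fin n → PolyRing n) :
    Derivation ℂ (invariantRing W) (PolyRing n) :=
  Derivation.mk'
    { toFun := fun p => ∑ j, (hy.polyEquiv (MvPolynomial.pderiv j (hy.polyEquiv.symm p)) :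
        PolyRing n) * l j
      map_add' := fun p q => by simp [add_mul, Finset.sum_add_distrib]
      map_smul' := fun c p => by simp [Finset.smul_sum] }
    (fun p q => by
      simp only [LinearMap.coe_mk, AddHom.coe_mk, map_mul, Derivation.leibniz, smul_eq_mul,
        map_add, Subalgebra.coe_add, Subalgebra.coe_mul, AlgEquiv.apply_symm_apply, add_mul,
        Finset.sum_add_distrib, Subalgebra.smul_def, Finset.mul_sum, mul_assoc])

theorem IsBasicInvariants.mkDer_apply {y : Fin n → invariantRing W}
    (hy : IsBasicInvariants W fun j => (y j : PolyRing n)) (l : Fin n → PolyRing n)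
    (F : MvPolynomial (Fin n) ℂ) : hy.mkDer l (hy.polyEquiv F) =
      ∑ j, MvPolynomial.aeval (fun j => (y j : PolyRing n)) (MvPolynomial.pderiv j F) * l j := by
  change ∑ j, (hy.polyEquiv (MvPolynomial.pderiv j (hy.polyEquiv.symm (hy.polyEquiv F))) :
        PolyRing n) * l j = _
  simp_rw [AlgEquiv.symm_apply_apply, hy.coe_polyEquiv]

theorem IsBasicInvariants.mkDer_apply_self {y : Fin n → invariantRing W}
    (hy : IsBasicInvariants W fun j => (y j : PolyRing n)) (l : Fin n → PolyRing n) (i : Fin n) :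
    hy.mkDer l (y i) = l i := by
  classical
  rw [← hy.polyEquiv_X i, hy.mkDer_apply, Finset.sum_eq_single i]
  · simp
  · intro j _ hj
    rw [MvPolynomial.pderiv_X_of_ne hj.symm, map_zero, zero_mul]
  · simp

theorem IsBasicInvariants.der_ext {y : Fin n → invariantRing W}
    (hy : IsBasicInvariants W fun j => (y j : PolyRing n))
    {δ δ' : Derivation ℂ (invariantRing W) (PolyRing n)} (h : ∀ j, δ (y j) = δ' (y j)) :
    δ = δ' := by
  have hadj : Algebra.adjoin ℂ (Set.range y) = ⊤ := by
    rw [Algebra.adjoin_range_eq_range_aeval, AlgHom.range_eq_top]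
    exact hy.polyEquiv.surjective
  ext1 p
  exact Derivation.eqOn_adjoin (s := Set.range y) (by rintro _ ⟨j, rfl⟩; exact h j)
    (hadj ▸ Algebra.mem_top)

/-- A derivation is homogeneous if it is so on basic invariants. -/
theorem IsBasicInvariants.mem_derInvPart {y : Fin n → invariantRing W}
    (hy : IsBasicInvariants W fun j => (y j : PolyRing n)) {e : Fin n → ℤ}
    (he : ∀ j, (y j : PolyRing n) ∈ polyPart n (e j)) {k : ℤ}
    {δ : Derivation ℂ (invariantRing W) (PolyRing n)} (h : ∀ j, δ (y j) ∈ polyPart n (e j + k)) :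
    δ ∈ derInvPart W k := by
  classical
  intro m p hp
  have hδ : δ = hy.mkDer fun j => δ (y j) := hy.der_ext fun j =>
    (hy.mkDer_apply_self (fun j => δ (y j)) j).symm
  obtain ⟨F, rfl⟩ := hy.polyEquiv.surjective p
  rw [hy.coe_polyEquiv] at hp
  have hwt := hy.weight_eq hp
  have hetot : ∀ j, ((y j : PolyRing n).totalDegree : ℤ) = e j := fun j =>
    degree_unique (hy.ne_zero j) (hy.mem_polyPart j) (he j)
  simp only [hetot] at hwt
  rw [hδ, hy.mkDer_apply]
  refine Submodule.sum_mem _ fun j _ => ?_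
  have h1 : MvPolynomial.aeval (fun j => (y j : PolyRing n)) (MvPolynomial.pderiv j F) ∈
      polyPart n (m - e j) := by
    refine aeval_mem_polyPart _ e he _ _ fun a ha => ?_
    rw [MvPolynomial.coeff_pderiv] at ha
    have := hwt _ (left_ne_zero_of_mul ha)
    simp only [Finsupp.add_apply, Finsupp.single_apply, Nat.cast_add, add_mul,
      Finset.sum_add_distrib, Nat.cast_ite, Nat.cast_one, Nat.cast_zero, ite_mul, one_mul, zero_mul,
      Finset.sum_ite_eq, Finset.mem_univ, if_true] at this
    omega
  have h2 := mul_mem_polyPart h1 (h j)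
  rwa [show m - e j + (e j + k) = m + k by ring] at h2

end Derivations

namespace DualityBases

variable (B : DualityBases W)

theorem toInvariant_mem (j : Fin n) :
    (toInvariant W (B.σ j) : PolyRing n) ∈ polyPart n (B.deg j) := by
  rw [toInvariant_coe]
  refine Submodule.sum_mem _ fun k _ => ?_
  have := mul_mem_polyPart (B.σ_mem j (Pi.single k 1)) (X_mem_polyPart k)
  rwa [sub_add_cancel] at this

theorem restrictDer_apply (δ : Derivation ℂ (invariantRing W) (PolyRing n)) (σ : HomV W) :
    restrictDer W δ σ = δ (toInvariant W σ) := rfl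

theorem restrictDer_bijective (B : DualityBases W) [Fintype W] (hf : IsBasicInvariants W f) :
    Function.Bijective (restrictDer W) := by
  have hy := B.isBasicInvariants hf
  constructor
  · intro δ δ' h
    exact hy.der_ext fun j => LinearMap.congr_fun h (B.σ j)
  · intro l
    refine ⟨hy.mkDer fun j => l (B.σ j), B.σ.ext fun j => ?_⟩
    rw [restrictDer_apply]
    exact hy.mkDer_apply_self _ j

end DualityBases

end

/-! ### Directional derivatives and separating linear forms -/

section

variable {n : ℕ} {W : Subgroup (Matrix.GeneralLinearGroup (Fin n) ℂ)} {f : Fin n → PolyRing n}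

section DirectionalDerivative

theorem differential_mul (p q : PolyRing n) (u : Fin n → ℂ) :
    differential (p * q) u = p * differential q u + q * differential p u := by
  simp only [differential, LinearMap.coe_mk, AddHom.coe_mk, Derivation.leibniz, smul_eq_mul,
    Finset.mul_sum, mul_add, Finset.sum_add_distrib, mul_left_comm]

theorem differential_polyAct (g : Matrix.GeneralLinearGroup (Fin n) ℂ) (p : PolyRing n)
    (u : Fin n → ℂ) :
    differential (polyAct g p) u = polyAct g (differential p ((g⁻¹).val.mulVec u)) := by
  simp only [differential, LinearMap.coe_mk, AddHom.coe_mk, map_sum, map_mul]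
  rw [polyAct_eq_subst]
  simp_rw [pderiv_subst, subst_C, Finset.mul_sum, Matrix.mulVec, dotProduct, map_sum,
    Finset.sum_mul]
  rw [Finset.sum_comm]
  refine Finset.sum_congr rfl fun i _ => Finset.sum_congr rfl fun k _ => ?_
  rw [map_mul]; ring

theorem eval_linForm (l : Module.Dual ℂ (Fin n → ℂ)) (x : Fin n → ℂ) :
    MvPolynomial.eval x (linForm n l) = l x := by
  conv_rhs => rw [pi_eq_sum_univ' x]
  simp [linForm, mul_comm]

theorem differential_linForm (l : Module.Dual ℂ (Fin n → ℂ)) (u : Fin n → ℂ) :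
    differential (linForm n l) u = MvPolynomial.C (l u) := by
  classical
  conv_rhs => rw [pi_eq_sum_univ' u]
  simp [linForm, differential, mul_comm, MvPolynomial.pderiv_X, Pi.single_apply]

theorem linForm_mem (l : Module.Dual ℂ (Fin n → ℂ)) : linForm n l ∈ polyPart n 1 :=
  Submodule.sum_mem _ fun _ _ => C_mul_mem_polyPart _ (X_mem_polyPart _)

theorem dual_inv_apply (g : W) (l : Module.Dual ℂ (Fin n → ℂ)) (x : Fin n → ℂ) :
    (stdRep W).dual g⁻¹ l x = l (g.1.val.mulVec x) := by
  simp [Representation.dual_apply, Module.Dual.transpose_apply, stdRep]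

theorem eval_smul_of_mem_polyPart {k : ℕ} {p : PolyRing n} (hp : p ∈ polyPart n k) (c : ℂ)
    (x : Fin n → ℂ) : MvPolynomial.eval (c • x) p = c ^ k * MvPolynomial.eval x p := by
  rw [MvPolynomial.eval_eq', MvPolynomial.eval_eq', Finset.mul_sum]
  refine Finset.sum_congr rfl fun m hm => ?_
  have h := mem_polyPart.1 hp m (MvPolynomial.mem_support_iff.1 hm)
  rw [Finsupp.degree_eq_sum, Nat.cast_inj] at h
  simp_rw [Pi.smul_apply, smul_eq_mul, mul_pow]
  rw [Finset.prod_mul_distrib, Finset.prod_pow_eq_pow_sum, h]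
  ring

end DirectionalDerivative

section Point

variable {t : Fin n} {v : Fin n → ℂ}

/-- The ideal of the fibre of `V → V / W` through a point at which `f t` takes the value `1` and
the other basic invariants vanish. -/
noncomputable def fibreIdeal (f : Fin n → PolyRing n) (t : Fin n) : Ideal (PolyRing n) :=
  Ideal.span (Set.range fun i => f i - MvPolynomial.C (if i = t then 1 else 0))

/-- The degree of a homogeneous invariant not vanishing at `v` is a multiple of that of `f t`. -/
theorem IsBasicInvariants.exists_eq_mul_of_eval_ne_zero (hf : IsBasicInvariants W f)
    (hv : ∀ i, MvPolynomial.eval v (f i) = if i = t then 1 else 0) {s : PolyRing n}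
    (hs : s ∈ invariantRing W) {k : ℤ} (hk : s ∈ polyPart n k) (h0 : MvPolynomial.eval v s ≠ 0) :
    ∃ a : ℕ, k = a * (f t).totalDegree := by
  obtain ⟨F, rfl⟩ := hf.exists_aeval hs
  have h1 : MvPolynomial.eval v (MvPolynomial.aeval f F) =
      ∑ m ∈ F.support, F.coeff m * ∏ i, (if i = t then (1 : ℂ) else 0) ^ m i := by
    rw [MvPolynomial.aeval_def, MvPolynomial.eval₂_eq', map_sum]
    refine Finset.sum_congr rfl fun m _ => ?_
    simp [hv]
  rw [h1] at h0
  obtain ⟨m, hm, hm0⟩ := Finset.exists_ne_zero_of_sum_ne_zero h0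
  refine ⟨m t, ?_⟩
  rw [← hf.weight_eq hk m (MvPolynomial.mem_support_iff.1 hm), Finset.sum_eq_single t]
  · intro i _ hi
    have h2 := Finset.prod_ne_zero_iff.1 (right_ne_zero_of_mul hm0) i (Finset.mem_univ i)
    rw [if_neg hi] at h2
    have : m i = 0 := by
      by_contra h
      exact h2 (zero_pow h)
    simp [this]
  · simp

theorem IsBasicInvariants.sub_eval_mem_fibreIdeal (hf : IsBasicInvariants W f)
    (hv : ∀ i, MvPolynomial.eval v (f i) = if i = t then 1 else 0) {s : PolyRing n}
    (hs : s ∈ invariantRing W) :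
    s - MvPolynomial.C (MvPolynomial.eval v s) ∈ fibreIdeal f t := by
  obtain ⟨F, rfl⟩ := hf.exists_aeval hs
  clear hs
  induction F using MvPolynomial.induction_on with
  | C a => simp [MvPolynomial.algebraMap_eq]
  | add p q hp hq =>
    convert add_mem hp hq using 1
    simp only [map_add]; ring
  | mul_X p i hp =>
    have h1 : f i - MvPolynomial.C (if i = t then 1 else 0) ∈ fibreIdeal f t :=
      Ideal.subset_span ⟨i, rfl⟩
    convert add_mem (Ideal.mul_mem_left _ (MvPolynomial.aeval f p) h1)
      (Ideal.mul_mem_left _ (MvPolynomial.C (if i = t then 1 else 0)) hp) using 1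
    rw [map_mul, map_mul, MvPolynomial.aeval_X, hv, map_mul]
    ring

theorem eval_eq_zero_of_mem_fibreIdeal
    (hv : ∀ i, MvPolynomial.eval v (f i) = if i = t then 1 else 0) {p : PolyRing n}
    (hp : p ∈ fibreIdeal f t) : MvPolynomial.eval v p = 0 := by
  have : fibreIdeal f t ≤ RingHom.ker (MvPolynomial.eval v) := Ideal.span_le.2 (by
    rintro _ ⟨i, rfl⟩
    simp [RingHom.mem_ker, hv])
  exact this hp

/-- Derivatives at `v` of elements of the ideal of the fibre are invariant under the stabiliser of
`v`, because those of the basic invariants are. -/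
theorem eval_differential_of_mem_fibreIdeal (hf : IsBasicInvariants W f)
    (hv : ∀ i, MvPolynomial.eval v (f i) = if i = t then 1 else 0) {p : PolyRing n}
    (hp : p ∈ fibreIdeal f t) (h : W) (hh : h.1.val.mulVec v = v) (u : Fin n → ℂ) :
    MvPolynomial.eval v (differential p (h.1.val.mulVec u)) =
      MvPolynomial.eval v (differential p u) := by
  have hadd : ∀ a b : PolyRing n, ∀ u,
      differential (a + b) u = differential a u + differential b u := by
    intro a b u
    simp [differential, mul_add, Finset.sum_add_distrib]
  have hsub : ∀ a : PolyRing n, ∀ c : ℂ, ∀ u,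
      differential (a - MvPolynomial.C c) u = differential a u := by
    intro a c u
    simp [differential]
  have hinv : ((h.1)⁻¹).val.mulVec v = v := by
    conv_lhs => rw [← hh]
    rw [Matrix.mulVec_mulVec, ← Units.val_mul, inv_mul_cancel, Units.val_one, Matrix.one_mulVec]
  induction hp using Submodule.span_induction with
  | mem x hx =>
    obtain ⟨i, rfl⟩ := hx
    have := differential_equivariant (hf.mem_invariantRing i) h u
    simp only [hsub]
    rw [show h.1.val.mulVec u = stdRep W h u from rfl, this, eval_polyAct, hinv]
  | zero => simp [differential]
  | add x y _ _ hx hy => rw [hadd, hadd, map_add, map_add, hx, hy]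
  | smul a x hx ih =>
    rw [smul_eq_mul, differential_mul, differential_mul]
    simp only [map_add, map_mul, ih, eval_eq_zero_of_mem_fibreIdeal hv hx, zero_mul]

/-- An equivariant vector field whose degree is `1` modulo `d` is a multiple of the Euler field on
the fibre: the codegrees lie between `0` and `d - 2`, so only the codegree `0` contributes. -/
theorem DualityBases.exists_sub_smul_X_mem (B : DualityBases W) [Fintype W]
    (hW : IsIrreducibleReflectionGroup W) (hf : IsBasicInvariants W f)
    (ht : ∀ i, (f i).totalDegree ≤ (f t).totalDegree)
    (hv : ∀ i, MvPolynomial.eval v (f i) = if i = t then 1 else 0)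
    {Φ : Module.Dual ℂ (Fin n → ℂ) →ₗ[ℂ] PolyRing n}
    (hΦ : ∀ (g : W) l, Φ ((stdRep W).dual g l) = polyAct g.1 (Φ l)) (a : ℤ)
    (hdeg : ∀ l, Φ l ∈ polyPart n (a * (f t).totalDegree + 1)) :
    ∃ c : ℂ, ∀ k, Φ (LinearMap.proj k) - MvPolynomial.C c * MvPolynomial.X k ∈ fibreIdeal f t := by
  obtain ⟨s, hs, hsdeg, hexp⟩ := exists_eq_sum_mul_basis_of_mem_polyPart W (stdRep W).dual B.φ
    B.φ_mem hΦ hdeg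
  have key : ∀ j, ∃ c : ℂ, ∀ k, s j * (B.φ j).1 (LinearMap.proj k) -
      MvPolynomial.C c * MvPolynomial.X k ∈ fibreIdeal f t := by
    intro j
    have hsm := hf.sub_eval_mem_fibreIdeal hv (hs j)
    by_cases h0 : MvPolynomial.eval v (s j) = 0
    · refine ⟨0, fun k => ?_⟩
      rw [h0, map_zero, sub_zero] at hsm
      rw [map_zero, zero_mul, sub_zero]
      exact Ideal.mul_mem_right _ _ hsm
    · obtain ⟨b, hb⟩ := hf.exists_eq_mul_of_eval_ne_zero hv (hs j) (hsdeg j) h0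
      have hc0 : B.codeg j = 0 := by
        have h1 := B.codeg_nonneg j
        have h2 := B.two_le_deg hW j
        have h3 := B.add_eq j
        have h4 := B.totalDegree_eq hf ht
        have h5 : B.codeg j = (a - b) * (f t).totalDegree := by linear_combination -hb
        refine Int.eq_zero_of_abs_lt_dvd (m := (f t).totalDegree) ⟨a - b, by rw [h5]; ring⟩ ?_
        rw [abs_of_nonneg h1]
        omega
      obtain ⟨c, hc⟩ := hW.schur (B.φ j).2.2 (fun l => by simpa [hc0] using B.φ_mem j l)
      refine ⟨MvPolynomial.eval v (s j) * c, fun k => ?_⟩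
      rw [hc]
      convert Ideal.mul_mem_right (MvPolynomial.C c * MvPolynomial.X k) _ hsm using 1
      rw [map_mul]; ring
  choose c hc using key
  refine ⟨∑ j, c j, fun k => ?_⟩
  rw [hexp, map_sum, Finset.sum_mul, ← Finset.sum_sub_distrib]
  exact Submodule.sum_mem _ fun j _ => hc j k

/-- A form `ψ` with `ψ(v) = 1` vanishing at the translates of `v` that are not proportional to `v`.
Its degree is a multiple of `d`, so that it takes the value `1` at the proportional ones. -/
theorem exists_separating_form [Fintype W] (hf : IsBasicInvariants W f)
    (hv : ∀ i, MvPolynomial.eval v (f i) = if i = t then 1 else 0) :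
    ∃ ψ : PolyRing n, ∃ a : ℕ, ψ ∈ polyPart n ((a * (f t).totalDegree : ℕ) : ℤ) ∧
      MvPolynomial.eval v ψ = 1 ∧ ∀ w : W, MvPolynomial.eval (w.1.val.mulVec v) ψ = 0 ∨
        ∃ c : ℂ, c ^ (f t).totalDegree = 1 ∧ w.1.val.mulVec v = c • v := by
  have h1 : ∀ w : W, ∃ q ∈ polyPart n (f t).totalDegree, MvPolynomial.eval v q = 1 ∧
      (MvPolynomial.eval (w.1.val.mulVec v) q = 0 ∨
        ∃ c : ℂ, c ^ (f t).totalDegree = 1 ∧ w.1.val.mulVec v = c • v) := by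
    intro w
    by_cases hm : w.1.val.mulVec v ∈ Submodule.span ℂ {v}
    · obtain ⟨c, hc⟩ := Submodule.mem_span_singleton.1 hm
      refine ⟨f t, hf.mem_polyPart t, by simp [hv], Or.inr ⟨c, ?_, hc.symm⟩⟩
      have h2 := eval_smul_of_mem_polyPart (hf.mem_polyPart t) c v
      have h3 := congrArg (MvPolynomial.eval v) (hf.mem_invariantRing t _ (inv_mem w.2))
      rw [eval_polyAct, inv_inv, ← hc, h2, hv, if_pos rfl, mul_one] at h3
      exact h3
    · have hm' : v ∉ Submodule.span ℂ {w.1.val.mulVec v} := by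
        intro h
        obtain ⟨c, hc⟩ := Submodule.mem_span_singleton.1 h
        have hc0 : c ≠ 0 := by
          rintro rfl
          rw [zero_smul] at hc
          apply hm
          rw [← hc, Matrix.mulVec_zero]
          exact zero_mem _
        apply hm
        rw [Submodule.mem_span_singleton]
        exact ⟨c⁻¹, by conv_lhs => rw [← hc]
                       rw [smul_smul, inv_mul_cancel₀ hc0, one_smul]⟩
      obtain ⟨l, hl, hl'⟩ := Submodule.exists_le_ker_of_notMem hm'
      have hlw : l (w.1.val.mulVec v) = 0 := hl' (Submodule.mem_span_singleton_self _)
      refine ⟨linForm n ((l v)⁻¹ • l) ^ (f t).totalDegree, ?_, ?_, Or.inl ?_⟩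
      · simpa using pow_mem_polyPart (linForm_mem ((l v)⁻¹ • l)) (f t).totalDegree
      · simp [eval_linForm, hl]
      · rw [map_pow, eval_linForm, LinearMap.smul_apply, hlw, smul_zero,
          zero_pow (hf.totalDegree_pos t).ne']
  choose q hq1 hq2 hq3 using h1
  refine ⟨∏ w, q w, Fintype.card W, ?_, ?_, fun w => (hq3 w).imp (fun h => ?_) id⟩
  · have := prod_mem_polyPart Finset.univ q _ fun w _ => hq1 w
    simpa using this
  · rw [map_prod]
    exact Finset.prod_eq_one fun w _ => hq2 w
  · rw [map_prod]
    exact Finset.prod_eq_zero (Finset.mem_univ w) h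

end Point

end

/-! ### Freeness of the orbit of a regular vector -/

section

variable {n : ℕ} {W : Subgroup (Matrix.GeneralLinearGroup (Fin n) ℂ)} {f : Fin n → PolyRing n}

section Freeness

variable {t : Fin n} {v : Fin n → ℂ}

theorem ne_zero_of_eval (hf : IsBasicInvariants W f)
    (hv : ∀ i, MvPolynomial.eval v (f i) = if i = t then 1 else 0) : v ≠ 0 := by
  rintro rfl
  have h1 := hv t
  have h2 := hf.constantCoeff_eq_zero t
  rw [if_pos rfl] at h1
  rw [MvPolynomial.constantCoeff_eq] at h2
  rw [MvPolynomial.eval_zero, MvPolynomial.constantCoeff_eq, h2] at h1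
  exact zero_ne_one h1

/-- A matrix `A` killing `v` yields an equivariant vector field, the average of `ψ² A x`, which
vanishes at `v` and whose derivative at `v` is a nonzero multiple of `A`. The square makes the
summands with `ψ(w⁻¹ v) = 0` vanish to second order at `v`. -/
theorem reynoldsHom_first_order [Fintype W] (ψ : PolyRing n) (A : Matrix (Fin n) (Fin n) ℂ)
    (hA : A.mulVec v = 0) {d : ℕ} {a : ℕ} (hψ : ψ ∈ polyPart n ((a * d : ℕ) : ℤ))
    (hψv : MvPolynomial.eval v ψ = 1)
    (hsep : ∀ w : W, MvPolynomial.eval (w.1.val.mulVec v) ψ = 0 ∨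
        (∃ c : ℂ, c ^ d = 1 ∧ w.1.val.mulVec v = c • v))
    (hcomm : ∀ w : W, (∃ c : ℂ, c ≠ 0 ∧ w.1.val.mulVec v = c • v) → w.1.val * A = A * w.1.val)
    (hd : 0 < d) (l : Module.Dual ℂ (Fin n → ℂ)) :
    MvPolynomial.eval v (reynoldsHom W (stdRep W).dual
        (mulHom (ψ ^ 2) (linForm n ∘ₗ (Matrix.toLin' A).dualMap)) l) = 0 ∧
      ∃ z : ℂ, z ≠ 0 ∧ ∀ u, MvPolynomial.eval v (differential (reynoldsHom W (stdRep W).dual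
        (mulHom (ψ ^ 2) (linForm n ∘ₗ (Matrix.toLin' A).dualMap)) l) u) = z * l (A.mulVec u) := by
  classical
  -- the summand of `w` in the average; the good `w` are those with `w⁻¹ v` proportional to `v`
  let q : W → PolyRing n := fun w => polyAct w.1 (ψ ^ 2 * linForm n
    ((Matrix.toLin' A).dualMap ((stdRep W).dual w⁻¹ l)))
  let good : W → Prop := fun w => ∃ c : ℂ, c ^ d = 1 ∧ (w⁻¹).1.val.mulVec v = c • v
  have hform : ∀ (w : W) x, MvPolynomial.eval x (linForm n
      ((Matrix.toLin' A).dualMap ((stdRep W).dual w⁻¹ l))) =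
      l (w.1.val.mulVec (A.mulVec x)) := by
    intro w x
    rw [eval_linForm, LinearMap.dualMap_apply, dual_inv_apply, Matrix.toLin'_apply]
  have hgoodψ : ∀ w, good w → MvPolynomial.eval ((w⁻¹).1.val.mulVec v) ψ = 1 := by
    rintro w ⟨c, hc, hcv⟩
    rw [hcv, eval_smul_of_mem_polyPart hψ, hψv, mul_one, mul_comm a, pow_mul, hc, one_pow]
  have hbadψ : ∀ w, ¬ good w → MvPolynomial.eval ((w⁻¹).1.val.mulVec v) ψ = 0 := fun w hw =>
    (hsep w⁻¹).resolve_right hw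
  have hgoodA : ∀ w, good w → w.1.val * A = A * w.1.val := by
    rintro w ⟨c, hc, hcv⟩
    have hc0 : c ≠ 0 := by
      rintro rfl
      rw [zero_pow hd.ne'] at hc
      exact zero_ne_one hc
    refine hcomm w ⟨c⁻¹, inv_ne_zero hc0, ?_⟩
    have h1 := congrArg (w.1.val.mulVec) hcv
    rw [Matrix.mulVec_mulVec, Subgroup.coe_inv, ← Units.val_mul, mul_inv_cancel, Units.val_one,
      Matrix.one_mulVec, Matrix.mulVec_smul] at h1
    rw [h1, smul_smul, inv_mul_cancel₀ hc0, one_smul, ← h1]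
  have hq0 : ∀ w, MvPolynomial.eval v (q w) = 0 := by
    intro w
    simp only [q]
    rw [eval_polyAct, map_mul, map_pow, hform]
    by_cases hw : good w
    · obtain ⟨c, hc, hcv⟩ := hw
      have : ((w.1)⁻¹).val.mulVec v = c • v := hcv
      rw [this, Matrix.mulVec_smul, hA, smul_zero, Matrix.mulVec_zero, map_zero, mul_zero]
    · rw [show MvPolynomial.eval (((w.1)⁻¹).val.mulVec v) ψ = 0 from hbadψ w hw]
      ring
  have hqd : ∀ w u, MvPolynomial.eval v (differential (q w) u) =
      if good w then l (A.mulVec u) else 0 := by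
    intro w u
    simp only [q]
    rw [differential_polyAct, eval_polyAct, differential_mul, differential_linForm, pow_two,
      differential_mul]
    simp only [map_add, map_mul, hform, MvPolynomial.eval_C, LinearMap.dualMap_apply,
      dual_inv_apply, Matrix.toLin'_apply]
    split_ifs with hw
    · have h1 : MvPolynomial.eval (((w.1)⁻¹).val.mulVec v) ψ = 1 := hgoodψ w hw
      have h2 := hgoodA w hw
      obtain ⟨c, hc, hcv⟩ := hw
      have hcv' : ((w.1)⁻¹).val.mulVec v = c • v := hcv
      have h3 : A.mulVec (((w.1)⁻¹).val.mulVec v) = 0 := by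
        rw [hcv', Matrix.mulVec_smul, hA, smul_zero]
      rw [h3, h1, Matrix.mulVec_zero, map_zero, Matrix.mulVec_mulVec, h2, Matrix.mulVec_mulVec,
        Matrix.mul_assoc, ← Units.val_mul, mul_inv_cancel, Units.val_one, Matrix.mul_one]
      ring
    · rw [show MvPolynomial.eval (((w.1)⁻¹).val.mulVec v) ψ = 0 from hbadψ w hw]
      ring
  have hΦ : reynoldsHom W (stdRep W).dual
        (mulHom (ψ ^ 2) (linForm n ∘ₗ (Matrix.toLin' A).dualMap)) l =
      (Fintype.card W : ℂ)⁻¹ • ∑ w, q w := reynoldsHom_apply _ _ _ _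
  rw [hΦ]
  constructor
  · rw [MvPolynomial.smul_eval, map_sum, Finset.sum_eq_zero fun w _ => hq0 w, mul_zero]
  · have hgood1 : good 1 := ⟨1, one_pow _, by simp⟩
    refine ⟨(Fintype.card W : ℂ)⁻¹ * (Finset.univ.filter good).card, mul_ne_zero
      (inv_ne_zero (card_ne_zero_complex W)) ?_, fun u => ?_⟩
    · exact_mod_cast (Finset.card_pos.2 ⟨1, Finset.mem_filter.2 ⟨Finset.mem_univ _, hgood1⟩⟩).ne'
    · have h1 : ∀ (c : ℂ) (r : W → PolyRing n),
          MvPolynomial.eval v (differential (c • ∑ w, r w) u) =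
          c * ∑ w, MvPolynomial.eval v (differential (r w) u) := by
        intro c r
        simp only [differential, LinearMap.coe_mk, AddHom.coe_mk, map_sum, map_mul,
          Derivation.map_smul, MvPolynomial.smul_eval, MvPolynomial.eval_C, Finset.mul_sum]
        rw [Finset.sum_comm]
        refine Finset.sum_congr rfl fun _ _ => Finset.sum_congr rfl fun _ _ => by ring
      rw [h1, Finset.sum_congr rfl fun w _ => hqd w u, ← Finset.sum_filter, Finset.sum_const,
        nsmul_eq_mul, mul_assoc]

/-- The group acts freely on the orbit of `v`. With `A = ∑ (1 - h)` over the stabiliser of `v`,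
`reynoldsHom_first_order` gives a vector field which on the fibre through `v` is a multiple of the
Euler field; as it vanishes at `v`, its components lie in `fibreIdeal f t`. Hence the rows of `A`
are combinations of the differentials of the `f i` at `v`, which the stabiliser fixes, so `A h = A`,
whereas `A h - A` is a nonzero multiple of `h - 1`. -/
theorem DualityBases.eq_one_of_mulVec_eq (B : DualityBases W) [Fintype W]
    (hW : IsIrreducibleReflectionGroup W) (hf : IsBasicInvariants W f)
    (ht : ∀ i, (f i).totalDegree ≤ (f t).totalDegree)
    (hv : ∀ i, MvPolynomial.eval v (f i) = if i = t then 1 else 0)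
    (h : W) (hh : h.1.val.mulVec v = v) : h = 1 := by
  classical
  let St : Finset W := Finset.univ.filter fun h => h.1.val.mulVec v = v
  have hSt : ∀ {x : W}, x ∈ St ↔ x.1.val.mulVec v = v := by intro x; simp [St]
  let A : Matrix (Fin n) (Fin n) ℂ := ∑ x ∈ St, (1 - x.1.val)
  have hA : A.mulVec v = 0 := by
    simp only [A, Matrix.sum_mulVec]
    refine Finset.sum_eq_zero fun x hx => ?_
    rw [Matrix.sub_mulVec, Matrix.one_mulVec, hSt.1 hx, sub_self]
  have hcomm : ∀ w : W, (∃ c : ℂ, c ≠ 0 ∧ w.1.val.mulVec v = c • v) →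
      w.1.val * A = A * w.1.val := by
    rintro w ⟨c, hc, hwv⟩
    have hwv' : ((w⁻¹).1.val).mulVec v = c⁻¹ • v := by
      have h1 := congrArg ((w⁻¹).1.val.mulVec) hwv
      rw [Matrix.mulVec_mulVec, Subgroup.coe_inv, ← Units.val_mul, inv_mul_cancel, Units.val_one,
        Matrix.one_mulVec, Matrix.mulVec_smul] at h1
      rw [Subgroup.coe_inv]
      conv_rhs => rw [h1]
      rw [smul_smul, inv_mul_cancel₀ hc, one_smul]
    simp only [A, Finset.mul_sum, Finset.sum_mul]
    refine Finset.sum_bij' (fun x _ => w * x * w⁻¹) (fun x _ => w⁻¹ * x * w) ?_ ?_ ?_ ?_ ?_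
    · intro x hx
      rw [hSt] at hx ⊢
      rw [Subgroup.coe_mul, Subgroup.coe_mul, Units.val_mul, Units.val_mul, ← Matrix.mulVec_mulVec,
        ← Matrix.mulVec_mulVec, hwv', Matrix.mulVec_smul, hx, Matrix.mulVec_smul, hwv, smul_smul,
        inv_mul_cancel₀ hc, one_smul]
    · intro x hx
      rw [hSt] at hx ⊢
      rw [Subgroup.coe_mul, Subgroup.coe_mul, Units.val_mul, Units.val_mul, ← Matrix.mulVec_mulVec,
        ← Matrix.mulVec_mulVec, hwv, Matrix.mulVec_smul, hx, Matrix.mulVec_smul, hwv', smul_smul,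
        mul_inv_cancel₀ hc, one_smul]
    · intro x _; group
    · intro x _; group
    · intro x _
      rw [mul_sub, sub_mul, mul_one, one_mul, ← Units.val_mul, ← Units.val_mul]
      simp
  obtain ⟨ψ, a, hψ, hψv, hsep⟩ := exists_separating_form hf hv
  have hfo := reynoldsHom_first_order ψ A hA hψ hψv hsep hcomm (hf.totalDegree_pos t)
  set Φ := reynoldsHom W (stdRep W).dual
    (mulHom (ψ ^ 2) (linForm n ∘ₗ (Matrix.toLin' A).dualMap)) with hΦ
  have hΦeq : ∀ (g : W) l, Φ ((stdRep W).dual g l) = polyAct g.1 (Φ l) :=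
    reynoldsHom_equivariant W _ _
  have hΦdeg : ∀ l, Φ l ∈ polyPart n ((2 * a : ℤ) * (f t).totalDegree + 1) := by
    intro l
    rw [hΦ, reynoldsHom_apply]
    refine Submodule.smul_mem _ _ (Submodule.sum_mem _ fun g _ => polyAct_mem_polyPart _ ?_)
    have h1 := mul_mem_polyPart (pow_mem_polyPart hψ 2)
      (linForm_mem ((Matrix.toLin' A).dualMap ((stdRep W).dual g⁻¹ l)))
    have h2 : (((2 : ℕ) : ℤ) * ((a * (f t).totalDegree : ℕ) : ℤ) + 1) =
        (2 * a : ℤ) * (f t).totalDegree + 1 := by push_cast; ring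
    rw [h2] at h1
    exact h1
  obtain ⟨c, hc⟩ := B.exists_sub_smul_X_mem hW hf ht hv hΦeq _ hΦdeg
  have hc0 : c = 0 := by
    obtain ⟨k, hk⟩ : ∃ k, v k ≠ 0 := by
      by_contra! h0
      exact ne_zero_of_eval hf hv (funext h0)
    have h1 := eval_eq_zero_of_mem_fibreIdeal hv (hc k)
    rw [map_sub, (hfo _).1, map_mul, MvPolynomial.eval_C, MvPolynomial.eval_X, zero_sub,
      neg_eq_zero] at h1
    exact (mul_eq_zero.1 h1).resolve_right hk
  have hAh : ∀ u, A.mulVec (h.1.val.mulVec u) = A.mulVec u := by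
    intro u
    funext k
    have h1 := hc k
    rw [hc0, map_zero, zero_mul, sub_zero] at h1
    have h2 := eval_differential_of_mem_fibreIdeal hf hv h1 h hh u
    obtain ⟨z, hz, h3⟩ := (hfo (LinearMap.proj k)).2
    rw [h3, h3] at h2
    exact mul_left_cancel₀ hz h2
  have hN : A * h.1.val - A = (St.card : ℂ) • (h.1.val - 1) := by
    have h1 : ∑ x ∈ St, (x * h).1.val = ∑ x ∈ St, x.1.val := by
      refine Finset.sum_bij' (fun x _ => x * h) (fun x _ => x * h⁻¹) ?_ ?_ ?_ ?_ ?_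
      · intro x hx
        rw [hSt] at hx ⊢
        rw [Subgroup.coe_mul, Units.val_mul, ← Matrix.mulVec_mulVec, hh, hx]
      · intro x hx
        rw [hSt] at hx ⊢
        have : ((h⁻¹).1.val).mulVec v = v := by
          conv_lhs => rw [← hh]
          rw [Matrix.mulVec_mulVec, Subgroup.coe_inv, ← Units.val_mul, inv_mul_cancel,
            Units.val_one, Matrix.one_mulVec]
        rw [Subgroup.coe_mul, Units.val_mul, ← Matrix.mulVec_mulVec, this, hx]
      · intro x _; simp
      · intro x _; simp
      · intro x _; rfl
    have h2 : A = (St.card : ℂ) • (1 : Matrix (Fin n) (Fin n) ℂ) - ∑ x ∈ St, x.1.val := by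
      simp only [A, Finset.sum_sub_distrib, Finset.sum_const, Nat.cast_smul_eq_nsmul]
    rw [h2, sub_mul, Finset.sum_mul, ← h1]
    simp only [Subgroup.coe_mul, Units.val_mul, smul_mul_assoc, one_mul, smul_sub]
    rw [← Finset.sum_congr rfl fun (x : W) _ => Units.val_mul x.1 h.1]
    have h3 : ∑ x ∈ St, (x.1 * h.1).val = ∑ x ∈ St, x.1.val := h1
    rw [h3]
    abel
  have h0 : A * h.1.val - A = 0 := by
    rw [sub_eq_zero]
    refine Matrix.toLin'.injective (LinearMap.ext fun u => ?_)
    rw [Matrix.toLin'_apply, Matrix.toLin'_apply, ← Matrix.mulVec_mulVec, hAh]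
  rw [h0] at hN
  have hcard : (St.card : ℂ) ≠ 0 := by
    exact_mod_cast (Finset.card_pos.2 ⟨h, hSt.2 hh⟩).ne'
  have h1 := (smul_eq_zero.1 hN.symm).resolve_left hcard
  exact Subtype.ext (Units.ext (sub_eq_zero.1 h1))

end Freeness

section Evaluation

variable {v : Fin n → ℂ}

/-- At a point with trivial stabiliser every linear functional on a finite dimensional
representation is the value of an equivariant harmonic map. -/
theorem exists_eval_eq_of_free [Fintype W] (hfree : ∀ h : W, h.1.val.mulVec v = v → h = 1)
    {M : Type*} [AddCommGroup M] [Module ℂ M] [FiniteDimensional ℂ M] (ρ : Representation ℂ W M)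
    {ι : Type*} [Fintype ι] (b : Module.Basis ι ℂ (homHarmonic W ρ)) (l : M →ₗ[ℂ] ℂ) :
    ∃ c : ι → ℂ, ∀ m, l m = ∑ i, c i * MvPolynomial.eval v ((b i).1 m) := by
  classical
  -- `r` takes the value `1` at `v` and vanishes at its other translates; average `l ⊗ r`
  have h1 : ∀ w : W, ∃ q : PolyRing n, MvPolynomial.eval v q = 1 ∧
      (w ≠ 1 → MvPolynomial.eval (w.1.val.mulVec v) q = 0) := by
    intro w
    by_cases hw : w = 1
    · exact ⟨1, by simp, fun h => absurd hw h⟩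
    · have hne : w.1.val.mulVec v ≠ v := fun h => hw (hfree w h)
      obtain ⟨k, hk⟩ := Function.ne_iff.1 hne
      have hk' : v k - w.1.val.mulVec v k ≠ 0 := sub_ne_zero.2 hk.symm
      refine ⟨MvPolynomial.C (v k - w.1.val.mulVec v k)⁻¹ *
        (MvPolynomial.X k - MvPolynomial.C (w.1.val.mulVec v k)), ?_, fun _ => ?_⟩
      · simp [hk']
      · simp
  choose q hq1 hq2 using h1
  let r : PolyRing n := ∏ w, q w
  have hr1 : MvPolynomial.eval v r = 1 := by
    simp only [r, map_prod]
    exact Finset.prod_eq_one fun w _ => hq1 w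
  have hr0 : ∀ w : W, w ≠ 1 → MvPolynomial.eval (w.1.val.mulVec v) r = 0 := by
    intro w hw
    simp only [r, map_prod]
    exact Finset.prod_eq_zero (Finset.mem_univ w) (hq2 w hw)
  obtain ⟨s, -, hs⟩ := exists_eq_sum_mul_basis W ρ b
    (reynoldsHom_equivariant W ρ (LinearMap.smulRight l r))
  refine ⟨fun i => Fintype.card W * MvPolynomial.eval v (s i), fun m => ?_⟩
  have h2 := congrArg (MvPolynomial.eval v) (hs m)
  rw [reynoldsHom_apply, MvPolynomial.smul_eval, map_sum, Finset.sum_eq_single 1, map_sum] at h2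
  · simp only [LinearMap.smulRight_apply, inv_one, map_one, Module.End.one_apply,
      OneMemClass.coe_one, polyAct_one, MvPolynomial.smul_eval, hr1, mul_one] at h2
    rw [inv_mul_eq_iff_eq_mul₀ (card_ne_zero_complex W)] at h2
    rw [h2, Finset.mul_sum]
    exact Finset.sum_congr rfl fun i _ => by rw [map_mul, mul_assoc]
  · intro w _ hw
    have h3 := hr0 w⁻¹ (by simpa using hw)
    rw [Subgroup.coe_inv] at h3
    rw [LinearMap.smulRight_apply, map_smul, MvPolynomial.smul_eval, eval_polyAct, h3, mul_zero]
  · simp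

end Evaluation

end

/-! ### Perfectness of the duality pairing -/

section

variable {n : ℕ} {W : Subgroup (Matrix.GeneralLinearGroup (Fin n) ℂ)} {f : Fin n → PolyRing n}

section Pairing

variable {t : Fin n} {v : Fin n → ℂ}

theorem IsBasicInvariants.exists_aeval_basicCoeff (hf : IsBasicInvariants W f) (t : Fin n)
    (s : invariantRing W) :
    ∃ F : MvPolynomial (Fin n) ℂ, MvPolynomial.aeval f F = (s : PolyRing n) ∧
      basicCoeff hf t s = F.coeff (Finsupp.single t 1) :=
  ⟨hf.algebraicIndependent.repr (Subalgebra.inclusion hf.adjoin_eq.ge s),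
    hf.algebraicIndependent.aeval_repr _, rfl⟩

theorem IsBasicInvariants.eq_totalDegree_of_basicCoeff_ne_zero (hf : IsBasicInvariants W f)
    {s : invariantRing W} {k : ℤ} (hs : (s : PolyRing n) ∈ polyPart n k)
    (h0 : basicCoeff hf t s ≠ 0) : k = (f t).totalDegree := by
  classical
  obtain ⟨F, hF, hFt⟩ := hf.exists_aeval_basicCoeff t s
  rw [← hF] at hs
  rw [hFt] at h0
  rw [← hf.weight_eq hs _ h0, Finset.sum_eq_single t]
  · simp
  · intro i _ hi
    simp [hi.symm]
  · simp

/-- A homogeneous invariant of positive degree less than `2d` is a multiple of `f t` modulo the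
other basic invariants. -/
theorem IsBasicInvariants.sub_basicCoeff_mem (hf : IsBasicInvariants W f)
    {s : invariantRing W} {k : ℤ} (hs : (s : PolyRing n) ∈ polyPart n k) (hk : 0 < k)
    (hk' : k < 2 * (f t).totalDegree) :
    (s : PolyRing n) - MvPolynomial.C (basicCoeff hf t s) * f t ∈ otherInvariantsIdeal f t := by
  classical
  obtain ⟨F, hF, hFt⟩ := hf.exists_aeval_basicCoeff t s
  rw [hFt]
  rw [← hF] at hs ⊢
  have hG : F - MvPolynomial.C (F.coeff (Finsupp.single t 1)) * MvPolynomial.X t ∈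
      Ideal.span ((MvPolynomial.X : Fin n → MvPolynomial (Fin n) ℂ) '' {i | i ≠ t}) := by
    rw [MvPolynomial.mem_ideal_span_X_image]
    intro m hm
    rw [MvPolynomial.mem_support_iff, MvPolynomial.coeff_sub, MvPolynomial.coeff_C_mul,
      MvPolynomial.coeff_X] at hm
    by_contra! hall
    have hmt : m = Finsupp.single t (m t) := by
      ext i
      by_cases hi : i = t
      · rw [hi, Finsupp.single_eq_same]
      · rw [hall i hi, Finsupp.single_apply, if_neg (Ne.symm hi)]
    by_cases h1 : m t = 1
    · rw [h1] at hmt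
      rw [← hmt, if_pos rfl, mul_one, sub_self] at hm
      exact hm rfl
    · have hne : ¬ (Finsupp.single t 1 = m) := fun h => h1 (by rw [← h, Finsupp.single_eq_same])
      rw [if_neg hne, mul_zero, sub_zero] at hm
      have h2 := hf.weight_eq hs m hm
      rw [Finset.sum_eq_single t (fun i _ hi => by rw [hall i hi]; simp) (by simp)] at h2
      rcases Nat.lt_or_gt_of_ne h1 with h3 | h3
      · have : m t = 0 := by omega
        rw [this] at h2
        simp at h2
        omega
      · have : (2 : ℤ) * (f t).totalDegree ≤ m t * (f t).totalDegree :=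
          mul_le_mul_of_nonneg_right (by exact_mod_cast h3) (by positivity)
        omega
  have h7 := Ideal.mem_map_of_mem
    (MvPolynomial.aeval f : MvPolynomial (Fin n) ℂ →ₐ[ℂ] PolyRing n) hG
  rw [Ideal.map_span, ← Set.image_comp] at h7
  have hcomp : (MvPolynomial.aeval f : MvPolynomial (Fin n) ℂ →ₐ[ℂ] PolyRing n) ∘
      MvPolynomial.X = f := funext fun i => MvPolynomial.aeval_X f i
  rw [hcomp, map_sub, map_mul, MvPolynomial.aeval_X, MvPolynomial.aeval_C] at h7
  exact h7

namespace DualityBases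

variable (B : DualityBases W)

theorem contract_mem_polyPart (i j : Fin n) :
    contract (B.σ i).1 (B.φ j).1 ∈ polyPart n (B.deg i + B.codeg j) := by
  refine Submodule.sum_mem _ fun k _ => ?_
  have := mul_mem_polyPart (B.σ_mem i (Pi.single k 1)) (B.φ_mem j (LinearMap.proj k))
  rwa [show B.deg i - 1 + (B.codeg j + 1) = B.deg i + B.codeg j by ring] at this

/-- Modulo the other basic invariants, contraction is the duality pairing times `f t`: the
contractions of basis elements have degrees strictly between `0` and `2d`. -/
theorem contract_sub_mem (B : DualityBases W) [Fintype W] (hW : IsIrreducibleReflectionGroup W)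
    (hf : IsBasicInvariants W f) (ht : ∀ i, (f i).totalDegree ≤ (f t).totalDegree)
    (φ : HomVDual W) (σ : HomV W) :
    contract σ.1 φ.1 - MvPolynomial.C (dualityPairing hf t φ σ) * f t ∈
      otherInvariantsIdeal f t := by
  let J := otherInvariantsIdeal f t
  let L : invariantRing W →ₗ[ℂ] PolyRing n ⧸ J :=
    (Ideal.Quotient.mkₐ ℂ J).toLinearMap ∘ₗ (invariantRing W).val.toLinearMap
  let L' : ℂ →ₗ[ℂ] PolyRing n ⧸ J :=
    (Ideal.Quotient.mkₐ ℂ J).toLinearMap ∘ₗ LinearMap.mulRight ℂ (f t) ∘ₗ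
      Algebra.linearMap ℂ (PolyRing n)
  have h : (invariantPairing W).compr₂ L = (dualityPairing hf t).compr₂ L' := by
    refine LinearMap.ext_basis B.φ B.σ fun j i => ?_
    refine (Ideal.Quotient.eq (I := J)).2 ?_
    refine hf.sub_basicCoeff_mem (s := invariantPairing W (B.φ j) (B.σ i))
      (B.contract_mem_polyPart i j) ?_ ?_
    · have := B.one_le_deg i
      have := B.codeg_nonneg j
      omega
    · have := B.totalDegree_eq hf ht
      have := B.deg_le i
      have := B.two_le_deg hW j
      have := B.add_eq j
      omega
  exact (Ideal.Quotient.eq (I := J)).1 (LinearMap.congr_fun₂ h φ σ)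

theorem eval_eq_zero_of_mem_otherInvariantsIdeal
    (hv : ∀ i, MvPolynomial.eval v (f i) = if i = t then 1 else 0) {p : PolyRing n}
    (hp : p ∈ otherInvariantsIdeal f t) : MvPolynomial.eval v p = 0 := by
  have : otherInvariantsIdeal f t ≤ RingHom.ker (MvPolynomial.eval v) := Ideal.span_le.2 (by
    rintro _ ⟨i, hi, rfl⟩
    exact (hv i).trans (if_neg hi))
  exact this hp

/-- The duality pairing is perfect: its matrix is a product of two evaluation matrices at the
point `v`, which has trivial stabiliser. -/
theorem isUnit_pairing [Fintype W] (hW : IsIrreducibleReflectionGroup W)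
    (hf : IsBasicInvariants W f) (ht : ∀ i, (f i).totalDegree ≤ (f t).totalDegree) :
    IsUnit (Matrix.of fun i j => dualityPairing hf t (B.φ j) (B.σ i)) := by
  classical
  obtain ⟨v, hv⟩ := hf.exists_point t
  have hfree := B.eq_one_of_mulVec_eq hW hf ht hv
  let Sv : Matrix (Fin n) (Fin n) ℂ :=
    Matrix.of fun i k => MvPolynomial.eval v ((B.σ i).1 (Pi.single k 1))
  let Pv : Matrix (Fin n) (Fin n) ℂ :=
    Matrix.of fun j k => MvPolynomial.eval v ((B.φ j).1 (LinearMap.proj k))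
  have hS : IsUnit Sv := by
    choose c hc using fun k => exists_eval_eq_of_free hfree (stdRep W) B.σ (LinearMap.proj k)
    rw [Matrix.isUnit_iff_isUnit_det]
    refine Matrix.isUnit_det_of_left_inverse (B := Matrix.of c) ?_
    ext k k'
    rw [Matrix.mul_apply, Matrix.one_apply]
    refine (hc k (Pi.single k' 1)).symm.trans ?_
    simp [Pi.single_apply]
  have hP : IsUnit Pv := by
    choose c hc using fun k => exists_eval_eq_of_free hfree (stdRep W).dual B.φ
      (Module.Dual.eval ℂ (Fin n → ℂ) (Pi.single k 1))
    rw [Matrix.isUnit_iff_isUnit_det]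
    refine Matrix.isUnit_det_of_left_inverse (B := Matrix.of c) ?_
    ext k k'
    rw [Matrix.mul_apply, Matrix.one_apply]
    refine (hc k (LinearMap.proj k')).symm.trans ?_
    simp [Pi.single_apply, eq_comm]
  have h : (Matrix.of fun i j => dualityPairing hf t (B.φ j) (B.σ i)) = Sv * Pv.transpose := by
    ext i j
    have h1 := eval_eq_zero_of_mem_otherInvariantsIdeal hv
      (B.contract_sub_mem hW hf ht (B.φ j) (B.σ i))
    rw [map_sub, map_mul, MvPolynomial.eval_C, hv, if_pos rfl, mul_one, sub_eq_zero] at h1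
    rw [Matrix.of_apply, ← h1, Matrix.mul_apply, contract, map_sum]
    simp [Sv, Pv]
  rw [h]
  exact hS.mul ((Matrix.isUnit_transpose Pv).2 hP)

/-- The homogeneous bases can be chosen to be dual to each other. -/
theorem exists_dual [Fintype W] (B : DualityBases W) (hW : IsIrreducibleReflectionGroup W)
    (hf : IsBasicInvariants W f) (ht : ∀ i, (f i).totalDegree ≤ (f t).totalDegree) :
    ∃ B' : DualityBases W,
      ∀ i j, dualityPairing hf t (B'.φ j) (B'.σ i) = if i = j then 1 else 0 := by
  classical
  set P : Matrix (Fin n) (Fin n) ℂ :=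
    Matrix.of fun i j => dualityPairing hf t (B.φ j) (B.σ i) with hP
  have hu : IsUnit P := B.isUnit_pairing hW hf ht
  have hPne : ∀ i j, P i j ≠ 0 → B.codeg j = B.codeg i := by
    intro i j h
    have h1 := hf.eq_totalDegree_of_basicCoeff_ne_zero
      (s := invariantPairing W (B.φ j) (B.σ i)) (B.contract_mem_polyPart i j) h
    rw [B.totalDegree_eq hf ht] at h1
    have := B.add_eq i
    omega
  -- the homogeneous part of the inverse of the pairing matrix
  let Q : Matrix (Fin n) (Fin n) ℂ :=
    Matrix.of fun j l => if B.codeg j = B.codeg l then P⁻¹ j l else 0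
  have hPQ : P * Q = 1 := by
    ext i l
    rw [← Matrix.mul_nonsing_inv P (P.isUnit_iff_isUnit_det.1 hu)]
    have h1 : ∀ j, P i j * Q j l = if B.codeg i = B.codeg l then P i j * P⁻¹ j l else 0 := by
      intro j
      by_cases h : P i j = 0
      · simp [h]
      · simp only [Q, Matrix.of_apply, hPne i j h, mul_ite, mul_zero]
    rw [Matrix.mul_apply, Finset.sum_congr rfl fun j _ => h1 j]
    by_cases h : B.codeg i = B.codeg l
    · simp only [if_pos h, Matrix.mul_apply]
    · simp only [if_neg h, Finset.sum_const_zero]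
      rw [Matrix.mul_nonsing_inv P (P.isUnit_iff_isUnit_det.1 hu), Matrix.one_apply_ne]
      rintro rfl
      exact h rfl
  let φ' : Fin n → HomVDual W := fun l => ∑ j, Q j l • B.φ j
  have hdual : ∀ i l, dualityPairing hf t (φ' l) (B.σ i) = if i = l then 1 else 0 := by
    intro i l
    rw [← Matrix.one_apply, ← hPQ, Matrix.mul_apply]
    simp only [φ', map_sum, map_smul, LinearMap.sum_apply, LinearMap.smul_apply, smul_eq_mul]
    exact Finset.sum_congr rfl fun j _ => mul_comm _ _
  have hli : LinearIndependent ℂ φ' := by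
    rw [Fintype.linearIndependent_iff]
    intro c hc i
    have h1 := congrArg (fun φ => dualityPairing hf t φ (B.σ i)) hc
    simpa [hdual] using h1
  have hfin : Module.Finite ℂ (HomVDual W) := Module.Finite.of_basis B.φ
  let b := basisOfLinearIndependentOfCardEqFinrank' φ' hli (Module.finrank_eq_card_basis B.φ).symm
  have hb : ∀ i, b i = φ' i := fun i => by
    simp [b]
  refine ⟨{ B with φ := b, φ_mem := fun l m => ?_ }, fun i j => ?_⟩
  · rw [hb]
    simp only [φ', Submodule.coe_sum, Submodule.coe_smul, LinearMap.sum_apply, LinearMap.smul_apply]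
    refine Submodule.sum_mem _ fun j _ => ?_
    by_cases h : B.codeg j = B.codeg l
    · rw [← h]
      exact Submodule.smul_mem _ _ (B.φ_mem j m)
    · simp [Q, h]
  · change dualityPairing hf t (b j) (B.σ i) = _
    rw [hb, hdual]

/-- The functionals on `Hom_W(V, H)` obtained from the basis of `Hom_W(V*, H)` dual to that of
`Hom_W(V, H)`. -/
theorem pairingMap_sum (hf : IsBasicInvariants W f)
    (hB : ∀ i j, dualityPairing hf t (B.φ j) (B.σ i) = if i = j then 1 else 0)
    (s : Fin n → PolyRing n) (i : Fin n) :
    pairingMap hf t (∑ j, s j ⊗ₜ[ℂ] B.φ j) (B.σ i) = s i := by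
  have h1 : ∀ (a : PolyRing n) (φ : HomVDual W) (σ : HomV W), pairingMap hf t (a ⊗ₜ[ℂ] φ) σ =
      a * MvPolynomial.C (dualityPairing hf t φ σ) := by
    intro a φ σ
    rw [pairingMap, LinearMap.liftBaseChange_tmul]
    rfl
  rw [map_sum, LinearMap.sum_apply, Finset.sum_congr rfl fun j _ => h1 _ _ _]
  simp [hB]

theorem pairingMap_bijective (B : DualityBases W) (hf : IsBasicInvariants W f)
    (hB : ∀ i j, dualityPairing hf t (B.φ j) (B.σ i) = if i = j then 1 else 0) :
    Function.Bijective (pairingMap hf t) := by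
  have hx : ∀ x : PolyRing n ⊗[ℂ] HomVDual W,
      ∃ s : Fin n → PolyRing n, x = ∑ j, s j ⊗ₜ[ℂ] B.φ j := by
    intro x
    refine ⟨fun j => (Module.Basis.baseChange (PolyRing n) B.φ).repr x j, ?_⟩
    conv_lhs => rw [← (Module.Basis.baseChange (PolyRing n) B.φ).sum_repr x]
    refine Finset.sum_congr rfl fun j _ => ?_
    rw [Module.Basis.baseChange_apply, TensorProduct.smul_tmul', smul_eq_mul, mul_one]
  constructor
  · rw [injective_iff_map_eq_zero]
    intro x h
    obtain ⟨s, rfl⟩ := hx x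
    have hs : ∀ i, s i = 0 := fun i => by
      rw [← B.pairingMap_sum hf hB s i, h, LinearMap.zero_apply]
    simp [hs]
  · intro l
    exact ⟨∑ j, l (B.σ j) ⊗ₜ[ℂ] B.φ j, B.σ.ext fun i =>
      B.pairingMap_sum hf hB (fun j => l (B.σ j)) i⟩

theorem pairingK_apply (hf : IsBasicInvariants W f)
    (hB : ∀ i j, dualityPairing hf t (B.φ j) (B.σ i) = if i = j then 1 else 0)
    (hp : Function.Bijective (pairingMap hf t))
    (δ : Derivation ℂ (invariantRing W) (PolyRing n)) (k : Fin n) :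
    pairingK hf t hp δ (MvPolynomial.X k) =
      ∑ j, δ (toInvariant W (B.σ j)) * (B.φ j).1 (LinearMap.proj k) := by
  have h1 : (LinearEquiv.ofBijective (pairingMap hf t) hp).symm (restrictDer W δ) =
      ∑ j, δ (toInvariant W (B.σ j)) ⊗ₜ[ℂ] B.φ j := by
    rw [LinearEquiv.symm_apply_eq]
    refine B.σ.ext fun i => ?_
    exact (B.pairingMap_sum hf hB (fun j => δ (toInvariant W (B.σ j))) i).symm
  have h2 : ∀ (δ' : Derivation ℂ (PolyRing n) (PolyRing n)) (s : Fin n → PolyRing n),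
      δ' = ∑ j, s j • MvPolynomial.mkDerivation ℂ (fun i => (B.φ j).1 (LinearMap.proj i)) →
      δ' (MvPolynomial.X k) = ∑ j, s j * (B.φ j).1 (LinearMap.proj k) := by
    rintro _ s rfl
    rw [← Derivation.coeFnAddMonoidHom_apply, map_sum, Finset.sum_apply]
    simp [MvPolynomial.mkDerivation_X]
  refine h2 _ _ ?_
  change multMap W ((LinearEquiv.ofBijective (pairingMap hf t) hp).symm (restrictDer W δ)) = _
  rw [h1, map_sum]
  refine Finset.sum_congr rfl fun j _ => ?_
  rw [multMap, LinearMap.liftBaseChange_tmul]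
  rfl

theorem reducedJacobian_apply (hr : Function.Bijective (restrictDer W))
    (θ : Derivation ℂ (PolyRing n) (PolyRing n)) (σ : HomV W) :
    reducedJacobian hr θ (toInvariant W σ) = ∑ k, σ.1 (Pi.single k 1) * θ (MvPolynomial.X k) := by
  have h1 : restrictDer W (reducedJacobian hr θ) = reducedJacobianAux W θ :=
    LinearEquiv.apply_symm_apply (LinearEquiv.ofBijective (restrictDer W) hr) _
  exact LinearMap.congr_fun h1 σ

end DualityBases

end Pairing

end

/-! ### Matrix factorisations and exactness -/

section

section Eisenbud

variable {S : Type*} [CommRing S] {ι : Type*} [Fintype ι] [DecidableEq ι]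

/-- One of the two identities of a matrix factorisation of a nonzerodivisor implies the other. -/
theorem mul_eq_smul_one_comm {M N : Matrix ι ι S} {a : S} (ha : ∀ x, a * x = 0 → x = 0)
    (h : M * N = a • (1 : Matrix ι ι S)) : N * M = a • (1 : Matrix ι ι S) := by
  have hdet : M.det * N.det = a ^ Fintype.card ι := by
    rw [← Matrix.det_mul, h, Matrix.det_smul, Matrix.det_one, mul_one]
  have hpow : ∀ k : ℕ, ∀ x, a ^ k * x = 0 → x = 0 := by
    intro k
    induction k with
    | zero => intro x hx; simpa using hx
    | succ k ih =>
      intro x hx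
      rw [pow_succ, mul_assoc] at hx
      exact ha x (ih _ hx)
  have h1 : M * (N * M - a • 1) = 0 := by
    rw [mul_sub, ← mul_assoc, h, smul_mul_assoc, one_mul, mul_smul_comm, mul_one, sub_self]
  have h2 : M.det • (N * M - a • (1 : Matrix ι ι S)) = 0 := by
    have := congrArg (M.adjugate * ·) h1
    simpa only [← mul_assoc, Matrix.adjugate_mul, smul_mul_assoc, one_mul, mul_zero] using this
  rw [← sub_eq_zero]
  ext i j
  refine hpow (Fintype.card ι) _ ?_
  have h3 : M.det * (N * M - a • (1 : Matrix ι ι S)) i j = 0 := congrFun (congrFun h2 i) j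
  rw [← hdet, mul_comm M.det, mul_assoc, h3, mul_zero]

/-- Eisenbud's theorem: a matrix factorisation of a nonzerodivisor `a` of `S / J` becomes exact
over `S / I`, where `I = J + (a)`. -/
theorem mulVec_eq_zero_iff_of_factorisation {M N : Matrix ι ι S} {I J : Ideal S} {a : S}
    (ha : ∀ x, a * x ∈ J → x ∈ J) (hI : I = J ⊔ Ideal.span {a})
    (hMN : M.map (Ideal.Quotient.mk J) * N.map (Ideal.Quotient.mk J) =
      Ideal.Quotient.mk J a • 1)
    (hNM : N.map (Ideal.Quotient.mk J) * M.map (Ideal.Quotient.mk J) =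
      Ideal.Quotient.mk J a • 1) (x : ι → S ⧸ I) :
    (M.map (Ideal.Quotient.mk I)).mulVec x = 0 ↔
      ∃ y, (N.map (Ideal.Quotient.mk I)).mulVec y = x := by
  have hJI : J ≤ I := hI ▸ le_sup_left
  have haI : a ∈ I := hI ▸ (le_sup_right : _ ≤ J ⊔ Ideal.span {a}) (Ideal.mem_span_singleton_self a)
  have hvec : ∀ (K : Ideal S) (L : Matrix ι ι S) (z : ι → S),
      (L.map (Ideal.Quotient.mk K)).mulVec (Ideal.Quotient.mk K ∘ z) =
        Ideal.Quotient.mk K ∘ L.mulVec z := by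
    intro K L z
    funext i
    exact (RingHom.map_mulVec (Ideal.Quotient.mk K) L z i).symm
  have hmem : ∀ {L L' : Matrix ι ι S}, L.map (Ideal.Quotient.mk J) * L'.map (Ideal.Quotient.mk J) =
      Ideal.Quotient.mk J a • 1 →
        ∀ (z : ι → S) (i : ι), L.mulVec (L'.mulVec z) i - a * z i ∈ J := by
    intro L L' h z i
    rw [← Ideal.Quotient.eq]
    have h1 := congrArg (fun T => Matrix.mulVec T (Ideal.Quotient.mk J ∘ z)) h
    simp only [← Matrix.mulVec_mulVec, hvec, Matrix.smul_mulVec, Matrix.one_mulVec] at h1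
    rw [map_mul]
    exact congrFun h1 i
  constructor
  · intro hx
    obtain ⟨x, rfl⟩ : ∃ z : ι → S, Ideal.Quotient.mk I ∘ z = x :=
      ⟨fun i => (Ideal.Quotient.mk_surjective (x i)).choose, funext fun i =>
        (Ideal.Quotient.mk_surjective (x i)).choose_spec⟩
    rw [hvec] at hx
    have h1 : ∀ i, ∃ y, M.mulVec x i - a * y ∈ J := by
      intro i
      have h2 : M.mulVec x i ∈ J ⊔ Ideal.span {a} :=
        hI ▸ Ideal.Quotient.eq_zero_iff_mem.1 (congrFun hx i)
      obtain ⟨j, hj, b, hb, hjb⟩ := Submodule.mem_sup.1 h2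
      obtain ⟨y, rfl⟩ := Ideal.mem_span_singleton'.1 hb
      refine ⟨y, ?_⟩
      rw [← hjb, mul_comm a y, add_sub_cancel_right]
      exact hj
    choose y hy using h1
    refine ⟨Ideal.Quotient.mk I ∘ y, ?_⟩
    rw [hvec]
    funext i
    refine (Ideal.Quotient.eq.2 (hJI ?_))
    -- `M (N y - x)` vanishes modulo `J`, hence so does `a (N y - x) = N M (N y - x)`
    have h3 : ∀ i, M.mulVec (N.mulVec y - x) i ∈ J := by
      intro i
      rw [Matrix.mulVec_sub, Pi.sub_apply]
      convert sub_mem (hmem hMN y i) (hy i) using 1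
      ring
    have h4 : N.mulVec (M.mulVec (N.mulVec y - x)) i ∈ J :=
      Submodule.sum_mem _ fun j _ => Ideal.mul_mem_left _ _ (h3 j)
    refine ha _ ?_
    have h5 := hmem hNM (N.mulVec y - x) i
    have := sub_mem h4 h5
    rwa [sub_sub_cancel] at this
  · rintro ⟨y, rfl⟩
    obtain ⟨y, rfl⟩ : ∃ z : ι → S, Ideal.Quotient.mk I ∘ z = y :=
      ⟨fun i => (Ideal.Quotient.mk_surjective (y i)).choose, funext fun i =>
        (Ideal.Quotient.mk_surjective (y i)).choose_spec⟩
    rw [hvec, hvec]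
    funext i
    refine Ideal.Quotient.eq_zero_iff_mem.2 ?_
    have h1 := add_mem (hJI (hmem hMN y i)) (Ideal.mul_mem_right (y i) I haI)
    rwa [sub_add_cancel] at h1

end Eisenbud

section Bases

variable {A : Type*} [CommRing A] {ι : Type*} [Fintype ι] [DecidableEq ι]
variable {P Q : Type*} [AddCommGroup P] [Module A P] [AddCommGroup Q] [Module A Q]

theorem exact_of_toMatrix (b : Module.Basis ι A P) (c : Module.Basis ι A Q) (α : P →ₗ[A] Q)
    (β : Q →ₗ[A] P) (h : ∀ x, (LinearMap.toMatrix b c α).mulVec x = 0 ↔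
      ∃ y, (LinearMap.toMatrix c b β).mulVec y = x) : Function.Exact β α := by
  intro x
  have h1 : α x = 0 ↔ (LinearMap.toMatrix b c α).mulVec (b.repr x) = 0 := by
    rw [LinearMap.toMatrix_mulVec_repr]
    constructor
    · intro hx; rw [hx]; simp
    · intro hx
      refine c.repr.injective (Finsupp.ext fun i => ?_)
      rw [map_zero]
      exact congrFun hx i
  rw [h1, h]
  constructor
  · rintro ⟨y, hy⟩
    refine ⟨c.equivFun.symm y, b.repr.injective (Finsupp.ext fun i => ?_)⟩
    have := LinearMap.toMatrix_mulVec_repr c b β (c.equivFun.symm y)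
    rw [← congrFun this i]
    have h2 : (c.repr (c.equivFun.symm y) : ι → A) = y := c.equivFun.apply_symm_apply y
    rw [h2, hy]
  · rintro ⟨y, rfl⟩
    exact ⟨c.repr y, LinearMap.toMatrix_mulVec_repr c b β y⟩

theorem range_le_of_toMatrix (b : Module.Basis ι A P) (c : Module.Basis ι A Q) (α : P →ₗ[A] Q)
    (m : Ideal A) (h : ∀ i j, LinearMap.toMatrix b c α i j ∈ m) :
    LinearMap.range α ≤ m • (⊤ : Submodule A Q) := by
  rintro _ ⟨x, rfl⟩
  rw [← c.sum_repr (α x)]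
  refine Submodule.sum_mem _ fun i _ => Submodule.smul_mem_smul ?_ Submodule.mem_top
  rw [← congrFun (LinearMap.toMatrix_mulVec_repr b c α x) i]
  exact Submodule.sum_mem _ fun j _ => Ideal.mul_mem_right _ _ (h i j)

theorem comp_eq_smul_id_of_toMatrix (b : Module.Basis ι A P) (c : Module.Basis ι A Q)
    (α : P →ₗ[A] Q) (β : Q →ₗ[A] P) (a : A)
    (h : LinearMap.toMatrix c b β * LinearMap.toMatrix b c α = a • 1) :
    β ∘ₗ α = a • LinearMap.id := by
  refine (LinearMap.toMatrix b b).injective ?_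
  rw [LinearMap.toMatrix_comp b c b, h, map_smul, LinearMap.toMatrix_id]

theorem toMatrix_dualMap (b : Module.Basis ι A P) (c : Module.Basis ι A Q) (α : P →ₗ[A] Q) :
    LinearMap.toMatrix c.dualBasis b.dualBasis α.dualMap =
      (LinearMap.toMatrix b c α).transpose := by
  ext i j
  rw [LinearMap.toMatrix_apply, b.dualBasis_repr, Matrix.transpose_apply, LinearMap.toMatrix_apply,
    LinearMap.dualMap_apply, c.dualBasis_apply]

end Bases

end

/-! ### Bases of derivations and matrices of the maps -/

section

variable {n : ℕ} {W : Subgroup (Matrix.GeneralLinearGroup (Fin n) ℂ)} {f : Fin n → PolyRing n}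

section DerivationBases

theorem derivation_apply_eq_sum {M : Type*} [AddCommGroup M] [Module (PolyRing n) M] [Module ℂ M]
    [IsScalarTower ℂ (PolyRing n) M] (θ : Derivation ℂ (PolyRing n) M) (p : PolyRing n) :
    θ p = ∑ i, MvPolynomial.pderiv i p • θ (MvPolynomial.X i) := by
  classical
  induction p using MvPolynomial.induction_on with
  | C a =>
    rw [← MvPolynomial.algebraMap_eq, Derivation.map_algebraMap]
    simp
  | add p q hp hq => simp only [map_add, add_smul, Finset.sum_add_distrib, hp, hq]
  | mul_X p i hp =>
    rw [Derivation.leibniz, hp]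
    simp only [Derivation.leibniz, MvPolynomial.pderiv_X, add_smul, Finset.sum_add_distrib,
      smul_eq_mul, mul_smul, Finset.smul_sum]
    simp [Pi.single_apply, ite_smul]

/-- The basis of the derivations of `S` given by the partial derivatives. -/
noncomputable def derBasis (n : ℕ) :
    Module.Basis (Fin n) (PolyRing n) (Derivation ℂ (PolyRing n) (PolyRing n)) :=
  Module.Basis.ofEquivFun
    { toFun := fun θ i => θ (MvPolynomial.X i)
      map_add' := fun _ _ => rfl
      map_smul' := fun _ _ => rfl
      invFun := fun l => MvPolynomial.mkDerivation ℂ l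
      left_inv := fun _ => MvPolynomial.derivation_ext fun _ => MvPolynomial.mkDerivation_X _ _ _
      right_inv := fun _ => funext fun _ => MvPolynomial.mkDerivation_X _ _ _ }

theorem derBasis_repr (θ : Derivation ℂ (PolyRing n) (PolyRing n)) (i : Fin n) :
    (derBasis n).repr θ i = θ (MvPolynomial.X i) := rfl

theorem derBasis_apply_X (k i : Fin n) :
    derBasis n k (MvPolynomial.X i) = if k = i then 1 else 0 := by
  classical
  rw [← derBasis_repr, (derBasis n).repr_self, Finsupp.single_apply]

/-- The basis of `Der(S^W, S)` dual to the generators `σ̃` of `S^W`. -/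
noncomputable def DualityBases.derInvBasis (B : DualityBases W) [Fintype W]
    (hf : IsBasicInvariants W f) :
    Module.Basis (Fin n) (PolyRing n) (Derivation ℂ (invariantRing W) (PolyRing n)) :=
  Module.Basis.ofEquivFun
    { toFun := fun δ j => δ (toInvariant W (B.σ j))
      map_add' := fun _ _ => rfl
      map_smul' := fun _ _ => rfl
      invFun := fun l => (B.isBasicInvariants hf).mkDer l
      left_inv := fun δ => (B.isBasicInvariants hf).der_ext fun j =>
        (B.isBasicInvariants hf).mkDer_apply_self (fun j => δ (toInvariant W (B.σ j))) j
      right_inv := fun l => funext fun j => (B.isBasicInvariants hf).mkDer_apply_self l j }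

theorem DualityBases.derInvBasis_repr (B : DualityBases W) [Fintype W]
    (hf : IsBasicInvariants W f) (δ : Derivation ℂ (invariantRing W) (PolyRing n)) (j : Fin n) :
    (B.derInvBasis hf).repr δ j = δ (toInvariant W (B.σ j)) := rfl

theorem DualityBases.derInvBasis_apply (B : DualityBases W) [Fintype W]
    (hf : IsBasicInvariants W f) (i j : Fin n) :
    B.derInvBasis hf i (toInvariant W (B.σ j)) = if i = j then 1 else 0 := by
  classical
  rw [← B.derInvBasis_repr hf, (B.derInvBasis hf).repr_self, Finsupp.single_apply]

theorem mem_derPart {k : ℤ} {θ : Derivation ℂ (PolyRing n) (PolyRing n)}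
    (h : ∀ i, θ (MvPolynomial.X i) ∈ polyPart n (1 + k)) : θ ∈ derPart n k := by
  intro j p hp
  rw [derivation_apply_eq_sum]
  refine Submodule.sum_mem _ fun i _ => ?_
  have := mul_mem_polyPart (pderiv_mem_polyPart hp i) (h i)
  rwa [show j - 1 + (1 + k) = j + k by ring] at this

end DerivationBases

namespace DualityBases

variable (B : DualityBases W)

/-- The matrix of the reduced Jacobian: its rows are the `σ_j`. -/
noncomputable def jacMatrix : Matrix (Fin n) (Fin n) (PolyRing n) :=
  Matrix.of fun j k => (B.σ j).1 (Pi.single k 1)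

/-- The matrix of the map `K`, for dual bases: its columns are the `φ_j`. -/
noncomputable def fieldMatrix : Matrix (Fin n) (Fin n) (PolyRing n) :=
  Matrix.of fun k j => (B.φ j).1 (LinearMap.proj k)

variable {t : Fin n}

theorem toMatrix_reducedJacobian [Fintype W] (hf : IsBasicInvariants W f)
    (hr : Function.Bijective (restrictDer W)) :
    LinearMap.toMatrix (derBasis n) (B.derInvBasis hf) (reducedJacobian hr) = B.jacMatrix := by
  ext1 j k
  rw [LinearMap.toMatrix_apply, B.derInvBasis_repr, reducedJacobian_apply]
  simp [derBasis_apply_X, jacMatrix]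

theorem toMatrix_pairingK [Fintype W] (hf : IsBasicInvariants W f)
    (hB : ∀ i j, dualityPairing hf t (B.φ j) (B.σ i) = if i = j then 1 else 0)
    (hp : Function.Bijective (pairingMap hf t)) :
    LinearMap.toMatrix (B.derInvBasis hf) (derBasis n) (pairingK hf t hp) = B.fieldMatrix := by
  ext1 k j
  rw [LinearMap.toMatrix_apply, derBasis_repr, B.pairingK_apply hf hB]
  simp [B.derInvBasis_apply, fieldMatrix]

theorem jacMatrix_mul_fieldMatrix [Fintype W] (hW : IsIrreducibleReflectionGroup W)
    (hf : IsBasicInvariants W f) (ht : ∀ i, (f i).totalDegree ≤ (f t).totalDegree)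
    (hB : ∀ i j, dualityPairing hf t (B.φ j) (B.σ i) = if i = j then 1 else 0) :
    B.jacMatrix.map (Ideal.Quotient.mk (otherInvariantsIdeal f t)) *
      B.fieldMatrix.map (Ideal.Quotient.mk (otherInvariantsIdeal f t)) =
      Ideal.Quotient.mk (otherInvariantsIdeal f t) (f t) • 1 := by
  rw [← Matrix.map_mul]
  ext1 i j
  have h := Ideal.Quotient.eq.2 (B.contract_sub_mem hW hf ht (B.φ j) (B.σ i))
  have h1 : (B.jacMatrix * B.fieldMatrix) i j = contract (B.σ i).1 (B.φ j).1 := rfl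
  rw [Matrix.map_apply, h1, h, hB, Matrix.smul_apply, Matrix.one_apply]
  split_ifs <;> simp

theorem mk_mul_eq_zero [Fintype W] (hW : IsIrreducibleReflectionGroup W)
    (hf : IsBasicInvariants W f) (x : PolyRing n ⧸ otherInvariantsIdeal f t)
    (hx : Ideal.Quotient.mk (otherInvariantsIdeal f t) (f t) * x = 0) : x = 0 := by
  obtain ⟨p, rfl⟩ := Ideal.Quotient.mk_surjective x
  rw [← map_mul, Ideal.Quotient.eq_zero_iff_mem] at hx
  exact Ideal.Quotient.eq_zero_iff_mem.2 (hf.mem_of_mul_mem hW.generated t p hx)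

theorem fieldMatrix_mul_jacMatrix [Fintype W] (hW : IsIrreducibleReflectionGroup W)
    (hf : IsBasicInvariants W f) (ht : ∀ i, (f i).totalDegree ≤ (f t).totalDegree)
    (hB : ∀ i j, dualityPairing hf t (B.φ j) (B.σ i) = if i = j then 1 else 0) :
    B.fieldMatrix.map (Ideal.Quotient.mk (otherInvariantsIdeal f t)) *
      B.jacMatrix.map (Ideal.Quotient.mk (otherInvariantsIdeal f t)) =
      Ideal.Quotient.mk (otherInvariantsIdeal f t) (f t) • 1 :=
  mul_eq_smul_one_comm (mk_mul_eq_zero hW hf) (B.jacMatrix_mul_fieldMatrix hW hf ht hB)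

theorem isMatrixFactorisation [Fintype W] (hW : IsIrreducibleReflectionGroup W)
    (hf : IsBasicInvariants W f) (ht : ∀ i, (f i).totalDegree ≤ (f t).totalDegree)
    (hB : ∀ i j, dualityPairing hf t (B.φ j) (B.σ i) = if i = j then 1 else 0)
    (hr : Function.Bijective (restrictDer W)) (hp : Function.Bijective (pairingMap hf t)) :
    IsMatrixFactorisation (Ideal.Quotient.mk (otherInvariantsIdeal f t) (f t))
      ((reducedJacobian hr).baseChange (PolyRing n ⧸ otherInvariantsIdeal f t))
      ((pairingK hf t hp).baseChange (PolyRing n ⧸ otherInvariantsIdeal f t)) := by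
  let b := Algebra.TensorProduct.basis (PolyRing n ⧸ otherInvariantsIdeal f t) (derBasis n)
  let c := Algebra.TensorProduct.basis (PolyRing n ⧸ otherInvariantsIdeal f t) (B.derInvBasis hf)
  refine ⟨Module.Projective.of_basis b, Module.Projective.of_basis c, ?_, ?_⟩
  · refine comp_eq_smul_id_of_toMatrix b c _ _ _ ?_
    rw [LinearMap.toMatrix_baseChange, LinearMap.toMatrix_baseChange,
      B.toMatrix_reducedJacobian hf hr, B.toMatrix_pairingK hf hB hp]
    exact B.fieldMatrix_mul_jacMatrix hW hf ht hB
  · refine comp_eq_smul_id_of_toMatrix c b _ _ _ ?_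
    rw [LinearMap.toMatrix_baseChange, LinearMap.toMatrix_baseChange,
      B.toMatrix_reducedJacobian hf hr, B.toMatrix_pairingK hf hB hp]
    exact B.jacMatrix_mul_fieldMatrix hW hf ht hB

theorem reducedJacobian_homogeneous (B : DualityBases W) [Fintype W] (hf : IsBasicInvariants W f)
    (hr : Function.Bijective (restrictDer W)) :
    IsHomogeneousMap (derPart n) (derInvPart W) (reducedJacobian hr) 0 := by
  intro k θ hθ
  refine (B.isBasicInvariants hf).mem_derInvPart B.toInvariant_mem fun j => ?_
  rw [reducedJacobian_apply]
  refine Submodule.sum_mem _ fun i _ => ?_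
  have := mul_mem_polyPart (B.σ_mem j (Pi.single i 1)) (hθ 1 _ (X_mem_polyPart i))
  rwa [show B.deg j - 1 + (1 + k) = B.deg j + (k + 0) by ring] at this

theorem pairingK_homogeneous [Fintype W] (hf : IsBasicInvariants W f)
    (ht : ∀ i, (f i).totalDegree ≤ (f t).totalDegree)
    (hB : ∀ i j, dualityPairing hf t (B.φ j) (B.σ i) = if i = j then 1 else 0)
    (hp : Function.Bijective (pairingMap hf t)) :
    IsHomogeneousMap (derInvPart W) (derPart n) (pairingK hf t hp) (f t).totalDegree := by
  intro k δ hδ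
  refine mem_derPart fun i => ?_
  rw [B.pairingK_apply hf hB]
  refine Submodule.sum_mem _ fun j _ => ?_
  have := mul_mem_polyPart (hδ _ _ (B.toInvariant_mem j)) (B.φ_mem j (LinearMap.proj i))
  have h1 := B.add_eq j
  have h2 := B.totalDegree_eq hf ht
  rwa [show B.deg j + k + (B.codeg j + 1) = 1 + (k + (f t).totalDegree) by omega] at this

end DualityBases

section Homogeneous

theorem IsHomogeneousMap.baseChange (I : Ideal (PolyRing n)) {M N : Type*} [AddCommGroup M]
    [Module (PolyRing n) M] [AddCommGroup N] [Module (PolyRing n) N] {G : ℤ → Set M}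
    {G' : ℤ → Set N} {α : M →ₗ[PolyRing n] N} {d : ℤ} (h : IsHomogeneousMap G G' α d) :
    IsHomogeneousMap (tensorPart I G) (tensorPart I G') (α.baseChange (PolyRing n ⧸ I)) d := by
  rintro k _ ⟨m, hm, rfl⟩
  exact ⟨α m, h k m hm, (LinearMap.baseChange_tmul _ _ _).symm⟩

end Homogeneous

section Coinvariants

variable {t : Fin n}

theorem IsBasicInvariants.hilbertIdeal_eq_sup (hf : IsBasicInvariants W f) (t : Fin n) :
    hilbertIdeal W = otherInvariantsIdeal f t ⊔ Ideal.span {f t} := by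
  rw [hf.hilbertIdeal_eq, otherInvariantsIdeal, ← Ideal.span_union]
  congr 1
  ext p
  constructor
  · rintro ⟨i, rfl⟩
    by_cases h : i = t
    · right; rw [h]; rfl
    · exact Or.inl ⟨i, h, rfl⟩
  · rintro (⟨i, -, rfl⟩ | h)
    · exact ⟨i, rfl⟩
    · exact ⟨t, h.symm⟩

theorem mk_mem_irrelevant {k : ℤ} (hk : k ≠ 0) {p : PolyRing n} (hp : p ∈ polyPart n k) :
    Ideal.Quotient.mk (hilbertIdeal W) p ∈ irrelevant W := by
  refine Ideal.mem_map_of_mem _ ?_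
  rw [← Set.image_univ, MvPolynomial.mem_ideal_span_X_image]
  intro m hm
  by_contra! h
  have h0 : m = 0 := by ext i; exact h i (Set.mem_univ i)
  have := mem_polyPart.1 hp m (MvPolynomial.mem_support_iff.1 hm)
  rw [h0] at this
  simp at this
  exact hk this.symm

namespace DualityBases

variable (B : DualityBases W)

theorem jacMatrix_mem [Fintype W] (hW : IsIrreducibleReflectionGroup W) (j k : Fin n) :
    B.jacMatrix.map (Ideal.Quotient.mk (hilbertIdeal W)) j k ∈ irrelevant W :=
  mk_mem_irrelevant (by have := B.two_le_deg hW j; omega) (B.σ_mem j (Pi.single k 1))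

theorem fieldMatrix_mem (k j : Fin n) :
    B.fieldMatrix.map (Ideal.Quotient.mk (hilbertIdeal W)) k j ∈ irrelevant W :=
  mk_mem_irrelevant (by have := B.codeg_nonneg j; omega) (B.φ_mem j (LinearMap.proj k))

theorem jacMatrix_mulVec_eq_zero_iff [Fintype W] (hW : IsIrreducibleReflectionGroup W)
    (hf : IsBasicInvariants W f) (ht : ∀ i, (f i).totalDegree ≤ (f t).totalDegree)
    (hB : ∀ i j, dualityPairing hf t (B.φ j) (B.σ i) = if i = j then 1 else 0)
    (x : Fin n → Coinvariants W) :
    (B.jacMatrix.map (Ideal.Quotient.mk (hilbertIdeal W))).mulVec x = 0 ↔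
      ∃ y, (B.fieldMatrix.map (Ideal.Quotient.mk (hilbertIdeal W))).mulVec y = x :=
  mulVec_eq_zero_iff_of_factorisation (fun p hp => hf.mem_of_mul_mem hW.generated t p hp)
    (hf.hilbertIdeal_eq_sup t) (B.jacMatrix_mul_fieldMatrix hW hf ht hB)
    (B.fieldMatrix_mul_jacMatrix hW hf ht hB) x

theorem fieldMatrix_mulVec_eq_zero_iff [Fintype W] (hW : IsIrreducibleReflectionGroup W)
    (hf : IsBasicInvariants W f) (ht : ∀ i, (f i).totalDegree ≤ (f t).totalDegree)
    (hB : ∀ i j, dualityPairing hf t (B.φ j) (B.σ i) = if i = j then 1 else 0)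
    (x : Fin n → Coinvariants W) :
    (B.fieldMatrix.map (Ideal.Quotient.mk (hilbertIdeal W))).mulVec x = 0 ↔
      ∃ y, (B.jacMatrix.map (Ideal.Quotient.mk (hilbertIdeal W))).mulVec y = x :=
  mulVec_eq_zero_iff_of_factorisation (fun p hp => hf.mem_of_mul_mem hW.generated t p hp)
    (hf.hilbertIdeal_eq_sup t) (B.fieldMatrix_mul_jacMatrix hW hf ht hB)
    (B.jacMatrix_mul_fieldMatrix hW hf ht hB) x

theorem transpose_mul_transpose {R : Type*} [CommRing R] (g : PolyRing n →+* R)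
    {M N : Matrix (Fin n) (Fin n) (PolyRing n)} {a : R} (h : M.map g * N.map g = a • 1) :
    N.transpose.map g * M.transpose.map g = a • 1 := by
  have := congrArg Matrix.transpose h
  rwa [Matrix.transpose_mul, Matrix.transpose_smul, Matrix.transpose_one] at this

theorem jacMatrix_transpose_mulVec_eq_zero_iff [Fintype W] (hW : IsIrreducibleReflectionGroup W)
    (hf : IsBasicInvariants W f) (ht : ∀ i, (f i).totalDegree ≤ (f t).totalDegree)
    (hB : ∀ i j, dualityPairing hf t (B.φ j) (B.σ i) = if i = j then 1 else 0)
    (x : Fin n → Coinvariants W) :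
    (B.jacMatrix.transpose.map (Ideal.Quotient.mk (hilbertIdeal W))).mulVec x = 0 ↔
      ∃ y, (B.fieldMatrix.transpose.map (Ideal.Quotient.mk (hilbertIdeal W))).mulVec y = x :=
  mulVec_eq_zero_iff_of_factorisation (fun p hp => hf.mem_of_mul_mem hW.generated t p hp)
    (hf.hilbertIdeal_eq_sup t) (transpose_mul_transpose _ (B.fieldMatrix_mul_jacMatrix hW hf ht hB))
    (transpose_mul_transpose _ (B.jacMatrix_mul_fieldMatrix hW hf ht hB)) x

theorem fieldMatrix_transpose_mulVec_eq_zero_iff [Fintype W] (hW : IsIrreducibleReflectionGroup W)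
    (hf : IsBasicInvariants W f) (ht : ∀ i, (f i).totalDegree ≤ (f t).totalDegree)
    (hB : ∀ i j, dualityPairing hf t (B.φ j) (B.σ i) = if i = j then 1 else 0)
    (x : Fin n → Coinvariants W) :
    (B.fieldMatrix.transpose.map (Ideal.Quotient.mk (hilbertIdeal W))).mulVec x = 0 ↔
      ∃ y, (B.jacMatrix.transpose.map (Ideal.Quotient.mk (hilbertIdeal W))).mulVec y = x :=
  mulVec_eq_zero_iff_of_factorisation (fun p hp => hf.mem_of_mul_mem hW.generated t p hp)
    (hf.hilbertIdeal_eq_sup t) (transpose_mul_transpose _ (B.jacMatrix_mul_fieldMatrix hW hf ht hB))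
    (transpose_mul_transpose _ (B.fieldMatrix_mul_jacMatrix hW hf ht hB)) x

end DualityBases

end Coinvariants

end

/-! ### The resolution of the derivations of the coinvariant algebra -/

section

variable {n : ℕ} {W : Subgroup (Matrix.GeneralLinearGroup (Fin n) ℂ)} {f : Fin n → PolyRing n}

section Quotient

theorem quotient_smul (I : Ideal (PolyRing n)) (p : PolyRing n) (a : PolyRing n ⧸ I) :
    p • a = Ideal.Quotient.mk I p * a := by
  obtain ⟨q, rfl⟩ := Ideal.Quotient.mk_surjective a
  rfl

theorem exists_eq_one_tmul (I : Ideal (PolyRing n)) {M : Type*} [AddCommMonoid M]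
    [Module (PolyRing n) M] (x : (PolyRing n ⧸ I) ⊗[PolyRing n] M) :
    ∃ m : M, x = (1 : PolyRing n ⧸ I) ⊗ₜ[PolyRing n] m := by
  induction x using TensorProduct.induction_on with
  | zero => exact ⟨0, by rw [TensorProduct.tmul_zero]⟩
  | tmul a m =>
    obtain ⟨p, rfl⟩ := Ideal.Quotient.mk_surjective a
    refine ⟨p • m, ?_⟩
    rw [TensorProduct.tmul_smul, TensorProduct.smul_tmul', quotient_smul, mul_one]
  | add x y hx hy =>
    obtain ⟨m, rfl⟩ := hx
    obtain ⟨m', rfl⟩ := hy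
    exact ⟨m + m', by rw [TensorProduct.tmul_add]⟩

theorem one_tmul_eq_zero_iff (I : Ideal (PolyRing n)) {M : Type*} [AddCommMonoid M]
    [Module (PolyRing n) M] {ι : Type*} (b : Module.Basis ι (PolyRing n) M) (m : M) :
    (1 : PolyRing n ⧸ I) ⊗ₜ[PolyRing n] m = 0 ↔ ∀ i, b.repr m i ∈ I := by
  rw [← (Algebra.TensorProduct.basis (PolyRing n ⧸ I) b).repr.map_eq_zero_iff, Finsupp.ext_iff]
  refine forall_congr' fun i => ?_
  rw [Algebra.TensorProduct.basis_repr_tmul, one_smul, Finsupp.mapRange_apply, Finsupp.zero_apply]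
  exact Ideal.Quotient.eq_zero_iff_mem

theorem mkₐ_eq_zero_of_stable {I : Ideal (PolyRing n)}
    {θ : Derivation ℂ (PolyRing n) (PolyRing n)} (h : ∀ p ∈ I, θ p ∈ I) (p : PolyRing n)
    (hp : Ideal.Quotient.mkₐ ℂ I p = 0) : Ideal.Quotient.mkₐ ℂ I (θ p) = 0 := by
  rw [Ideal.Quotient.mkₐ_eq_mk, Ideal.Quotient.eq_zero_iff_mem] at *
  exact h p hp

/-- The derivation of `S / I` induced by a derivation of `S` preserving `I`. -/
noncomputable def quotientDerivation (I : Ideal (PolyRing n))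
    (θ : Derivation ℂ (PolyRing n) (PolyRing n)) (h : ∀ p ∈ I, θ p ∈ I) :
    Derivation ℂ (PolyRing n ⧸ I) (PolyRing n ⧸ I) :=
  Derivation.liftOfSurjective (f := Ideal.Quotient.mkₐ ℂ I) (Ideal.Quotient.mkₐ_surjective ℂ I)
    (d := θ) (mkₐ_eq_zero_of_stable h)

theorem quotientDerivation_apply (I : Ideal (PolyRing n))
    (θ : Derivation ℂ (PolyRing n) (PolyRing n)) (h : ∀ p ∈ I, θ p ∈ I) (p : PolyRing n) :
    quotientDerivation I θ h (Ideal.Quotient.mk I p) = Ideal.Quotient.mk I (θ p) :=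
  Derivation.liftOfSurjective_apply (f := Ideal.Quotient.mkₐ ℂ I)
    (Ideal.Quotient.mkₐ_surjective ℂ I) (d := θ) (mkₐ_eq_zero_of_stable h) p

theorem derivation_map_hilbertIdeal (θ : Derivation ℂ (PolyRing n) (PolyRing n))
    (h : ∀ p ∈ invariantRing W, MvPolynomial.constantCoeff p = 0 → θ p ∈ hilbertIdeal W)
    {p : PolyRing n} (hp : p ∈ hilbertIdeal W) : θ p ∈ hilbertIdeal W := by
  induction hp using Submodule.span_induction with
  | mem x hx => exact h x hx.1 hx.2
  | zero => rw [map_zero]; exact zero_mem _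
  | add x y _ _ hx hy => rw [map_add]; exact add_mem hx hy
  | smul a x hx ih =>
    rw [smul_eq_mul, Derivation.leibniz]
    exact add_mem (Ideal.mul_mem_left _ _ ih) (Ideal.mul_mem_right _ _ hx)

/-- A derivation of the coinvariant algebra is determined by its values on the coordinates. -/
theorem coinvariants_derivation_ext {D D' : Derivation ℂ (Coinvariants W) (Coinvariants W)}
    (h : ∀ k, D (Ideal.Quotient.mk (hilbertIdeal W) (MvPolynomial.X k)) =
      D' (Ideal.Quotient.mk (hilbertIdeal W) (MvPolynomial.X k))) : D = D' := by
  have h1 : D.compAlgebraMap (PolyRing n) = D'.compAlgebraMap (PolyRing n) :=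
    MvPolynomial.derivation_ext h
  ext1 a
  obtain ⟨p, rfl⟩ := Ideal.Quotient.mk_surjective a
  exact DFunLike.congr_fun h1 p

end Quotient

namespace DualityBases

variable (B : DualityBases W) {t : Fin n}

/-- The derivations in the image of `K` preserve the Hilbert ideal: they map an invariant `p` into
the ideal generated by the contractions of `dp` with the `φ_j`, which are invariants without
constant term. -/
theorem pairingK_mem_hilbertIdeal (B : DualityBases W) (hf : IsBasicInvariants W f)
    (hB : ∀ i j, dualityPairing hf t (B.φ j) (B.σ i) = if i = j then 1 else 0)
    (hp : Function.Bijective (pairingMap hf t))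
    (δ : Derivation ℂ (invariantRing W) (PolyRing n)) {p : PolyRing n} (hpI : p ∈ hilbertIdeal W) :
    pairingK hf t hp δ p ∈ hilbertIdeal W := by
  refine derivation_map_hilbertIdeal _ (fun p hpW _ => ?_) hpI
  have h1 : pairingK hf t hp δ p =
      ∑ j, δ (toInvariant W (B.σ j)) * contract (differential p) (B.φ j).1 := by
    rw [derivation_apply_eq_sum]
    simp only [B.pairingK_apply hf hB, smul_eq_mul, Finset.mul_sum, contract, differential_single]
    rw [Finset.sum_comm]
    refine Finset.sum_congr rfl fun j _ => Finset.sum_congr rfl fun k _ => by ring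
  rw [h1]
  refine Submodule.sum_mem _ fun j _ => Ideal.mul_mem_left _ _ (Ideal.subset_span ⟨?_, ?_⟩)
  · exact contract_mem W _ _ (differential_equivariant hpW) (B.φ j).2.2
  · rw [contract, map_sum]
    refine Finset.sum_eq_zero fun k _ => ?_
    rw [map_mul, constantCoeff_of_mem_polyPart (B.φ_mem j (LinearMap.proj k))
      (by have := B.codeg_nonneg j; omega), mul_zero]

/-- The map `ε` induced by `K`, from `Der(S^W, S) ⊗ A` to the derivations of `A`. -/
noncomputable def augmentation (hf : IsBasicInvariants W f)
    (hp : Function.Bijective (pairingMap hf t))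
    (hK : ∀ δ : Derivation ℂ (invariantRing W) (PolyRing n), ∀ p ∈ hilbertIdeal W,
      pairingK hf t hp δ p ∈ hilbertIdeal W) :
    (Coinvariants W ⊗[PolyRing n] Derivation ℂ (invariantRing W) (PolyRing n)) →ₗ[Coinvariants W]
      Derivation ℂ (Coinvariants W) (Coinvariants W) :=
  LinearMap.liftBaseChange (Coinvariants W)
    { toFun := fun δ => quotientDerivation (hilbertIdeal W) (pairingK hf t hp δ) (hK δ)
      map_add' := fun δ δ' => by
        ext1 a
        obtain ⟨p, rfl⟩ := Ideal.Quotient.mk_surjective a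
        simp only [Derivation.add_apply, quotientDerivation_apply, map_add]
      map_smul' := fun c δ => by
        ext1 a
        obtain ⟨p, rfl⟩ := Ideal.Quotient.mk_surjective a
        simp only [RingHom.id_apply, Derivation.smul_apply, quotientDerivation_apply, map_smul,
          smul_eq_mul, map_mul, quotient_smul] }

theorem augmentation_apply (hf : IsBasicInvariants W f)
    (hp : Function.Bijective (pairingMap hf t))
    (hK : ∀ δ : Derivation ℂ (invariantRing W) (PolyRing n), ∀ p ∈ hilbertIdeal W,
      pairingK hf t hp δ p ∈ hilbertIdeal W)
    (δ : Derivation ℂ (invariantRing W) (PolyRing n)) (p : PolyRing n) :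
    augmentation hf hp hK (1 ⊗ₜ δ) (Ideal.Quotient.mk (hilbertIdeal W) p) =
      Ideal.Quotient.mk (hilbertIdeal W) (pairingK hf t hp δ p) := by
  rw [augmentation, LinearMap.liftBaseChange_tmul, one_smul]
  exact quotientDerivation_apply _ _ (hK δ) p

/-- The differentials of the basic invariants and the `σ_j` span the same space modulo the Hilbert
ideal. So if the `θ k` satisfy, modulo a submodule `N` containing the multiples by this ideal, the
relations given by the differentials, then they satisfy those given by the `σ_j`. -/
theorem jacMatrix_mem_of_differential_mem [Fintype W] (hf : IsBasicInvariants W f) {R : Type*}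
    [AddCommGroup R] [Module (PolyRing n) R] (N : Submodule (PolyRing n) R)
    (hN : ∀ p ∈ hilbertIdeal W, ∀ r : R, p • r ∈ N) (θ : Fin n → R)
    (h : ∀ i, ∑ k, MvPolynomial.pderiv k (f i) • θ k ∈ N) (j : Fin n) :
    ∑ k, B.jacMatrix j k • θ k ∈ N := by
  classical
  obtain ⟨s, hs, -, hexp⟩ := B.exists_expansion hf
  have hu := B.isUnit_constantCoeff hf hs hexp
  set c : Matrix (Fin n) (Fin n) ℂ :=
    Matrix.of fun i j => MvPolynomial.constantCoeff (s i j) with hc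
  have h1 : ∀ i, ∑ j, (MvPolynomial.C (c i j) : PolyRing n) • ∑ k, B.jacMatrix j k • θ k ∈ N := by
    intro i
    have h2 : ∑ k, MvPolynomial.pderiv k (f i) • θ k =
        ∑ j, s i j • ∑ k, B.jacMatrix j k • θ k := by
      simp_rw [← differential_single, hexp, Finset.sum_smul, Finset.smul_sum, smul_smul]
      rw [Finset.sum_comm]
      rfl
    have h3 : ∑ j, (s i j - (MvPolynomial.C (c i j) : PolyRing n)) •
        ∑ k, B.jacMatrix j k • θ k ∈ N := by
      refine Submodule.sum_mem _ fun j _ => hN _ (Ideal.subset_span ⟨?_, ?_⟩) _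
      · exact sub_mem (hs i j) (C_mem_invariantRing _)
      · simp [hc]
    have h4 := sub_mem (h2 ▸ h i) h3
    rw [← Finset.sum_sub_distrib] at h4
    simpa only [← sub_smul, sub_sub_cancel] using h4
  have h5 : ∑ k, B.jacMatrix j k • θ k = ∑ i, (MvPolynomial.C (c⁻¹ j i) : PolyRing n) •
      ∑ l, (MvPolynomial.C (c i l) : PolyRing n) • ∑ k, B.jacMatrix l k • θ k := by
    simp_rw [Finset.smul_sum
        (f := fun l => (MvPolynomial.C (c _ l) : PolyRing n) • ∑ k, B.jacMatrix l k • θ k),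
      smul_smul, ← map_mul]
    rw [Finset.sum_comm]
    simp_rw [← Finset.sum_smul, ← map_sum, ← Matrix.mul_apply,
      Matrix.nonsing_inv_mul c (c.isUnit_iff_isUnit_det.1 hu), Matrix.one_apply]
    simp
  rw [h5]
  exact Submodule.sum_mem _ fun i _ => Submodule.smul_mem _ _ (h1 i)

theorem exact_reducedJacobian_pairingK [Fintype W] (hW : IsIrreducibleReflectionGroup W)
    (hf : IsBasicInvariants W f) (ht : ∀ i, (f i).totalDegree ≤ (f t).totalDegree)
    (hB : ∀ i j, dualityPairing hf t (B.φ j) (B.σ i) = if i = j then 1 else 0)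
    (hr : Function.Bijective (restrictDer W)) (hp : Function.Bijective (pairingMap hf t)) :
    Function.Exact ((reducedJacobian hr).baseChange (Coinvariants W))
      ((pairingK hf t hp).baseChange (Coinvariants W)) := by
  refine exact_of_toMatrix (Algebra.TensorProduct.basis _ (B.derInvBasis hf))
    (Algebra.TensorProduct.basis _ (derBasis n)) _ _ ?_
  rw [LinearMap.toMatrix_baseChange, LinearMap.toMatrix_baseChange,
    B.toMatrix_reducedJacobian hf hr, B.toMatrix_pairingK hf hB hp]
  exact B.fieldMatrix_mulVec_eq_zero_iff hW hf ht hB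

theorem exact_pairingK_reducedJacobian [Fintype W] (hW : IsIrreducibleReflectionGroup W)
    (hf : IsBasicInvariants W f) (ht : ∀ i, (f i).totalDegree ≤ (f t).totalDegree)
    (hB : ∀ i j, dualityPairing hf t (B.φ j) (B.σ i) = if i = j then 1 else 0)
    (hr : Function.Bijective (restrictDer W)) (hp : Function.Bijective (pairingMap hf t)) :
    Function.Exact ((pairingK hf t hp).baseChange (Coinvariants W))
      ((reducedJacobian hr).baseChange (Coinvariants W)) := by
  refine exact_of_toMatrix (Algebra.TensorProduct.basis _ (derBasis n))
    (Algebra.TensorProduct.basis _ (B.derInvBasis hf)) _ _ ?_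
  rw [LinearMap.toMatrix_baseChange, LinearMap.toMatrix_baseChange,
    B.toMatrix_reducedJacobian hf hr, B.toMatrix_pairingK hf hB hp]
  exact B.jacMatrix_mulVec_eq_zero_iff hW hf ht hB

theorem augmentation_eq_zero_iff (hf : IsBasicInvariants W f)
    (hp : Function.Bijective (pairingMap hf t))
    (hK : ∀ δ : Derivation ℂ (invariantRing W) (PolyRing n), ∀ p ∈ hilbertIdeal W,
      pairingK hf t hp δ p ∈ hilbertIdeal W)
    (x : Coinvariants W ⊗[PolyRing n] Derivation ℂ (invariantRing W) (PolyRing n)) :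
    augmentation hf hp hK x = 0 ↔ (pairingK hf t hp).baseChange (Coinvariants W) x = 0 := by
  obtain ⟨δ, rfl⟩ := exists_eq_one_tmul _ x
  rw [LinearMap.baseChange_tmul, one_tmul_eq_zero_iff _ (derBasis n)]
  constructor
  · intro h k
    rw [derBasis_repr, ← Ideal.Quotient.eq_zero_iff_mem, ← augmentation_apply hf hp hK, h]
    rfl
  · intro h
    refine coinvariants_derivation_ext fun k => ?_
    rw [augmentation_apply, Derivation.zero_apply, Ideal.Quotient.eq_zero_iff_mem]
    exact h k

/-- A derivation of `A` lifts to a derivation of `S` preserving the Hilbert ideal. Modulo this ideal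
the lift is killed by the reduced Jacobian, so by exactness it is in the image of `K`. -/
theorem augmentation_surjective [Fintype W] (B : DualityBases W)
    (hW : IsIrreducibleReflectionGroup W)
    (hf : IsBasicInvariants W f) (ht : ∀ i, (f i).totalDegree ≤ (f t).totalDegree)
    (hB : ∀ i j, dualityPairing hf t (B.φ j) (B.σ i) = if i = j then 1 else 0)
    (hr : Function.Bijective (restrictDer W)) (hp : Function.Bijective (pairingMap hf t))
    (hK : ∀ δ : Derivation ℂ (invariantRing W) (PolyRing n), ∀ p ∈ hilbertIdeal W,
      pairingK hf t hp δ p ∈ hilbertIdeal W) :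
    Function.Surjective (augmentation hf hp hK) := by
  intro D
  choose l hl using fun k => Ideal.Quotient.mk_surjective
    (D (Ideal.Quotient.mk (hilbertIdeal W) (MvPolynomial.X k)))
  -- a lift of `D` to a derivation of `S`
  let θ : Derivation ℂ (PolyRing n) (PolyRing n) := MvPolynomial.mkDerivation ℂ l
  have hθX : ∀ k, θ (MvPolynomial.X k) = l k := fun k => MvPolynomial.mkDerivation_X _ _ _
  have hθ : ∀ p, Ideal.Quotient.mk (hilbertIdeal W) (θ p) =
      D (Ideal.Quotient.mk (hilbertIdeal W) p) := by
    intro p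
    have h1 := derivation_apply_eq_sum (D.compAlgebraMap (PolyRing n)) p
    have h2 : D.compAlgebraMap (PolyRing n) p = D (Ideal.Quotient.mk (hilbertIdeal W) p) := rfl
    rw [← h2, h1, derivation_apply_eq_sum, map_sum]
    refine Finset.sum_congr rfl fun k _ => ?_
    rw [hθX, smul_eq_mul, map_mul, hl, quotient_smul]
    rfl
  have h0 : (reducedJacobian hr).baseChange (Coinvariants W) (1 ⊗ₜ θ) = 0 := by
    rw [LinearMap.baseChange_tmul, one_tmul_eq_zero_iff _ (B.derInvBasis hf)]
    intro j
    rw [B.derInvBasis_repr, reducedJacobian_apply]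
    refine B.jacMatrix_mem_of_differential_mem hf (hilbertIdeal W)
      (fun p hp r => Ideal.mul_mem_right _ _ hp) (fun k => θ (MvPolynomial.X k)) (fun i => ?_) j
    have hfi : f i ∈ hilbertIdeal W :=
      Ideal.subset_span ⟨hf.mem_invariantRing i, hf.constantCoeff_eq_zero i⟩
    rw [← derivation_apply_eq_sum, ← Ideal.Quotient.eq_zero_iff_mem, hθ,
      Ideal.Quotient.eq_zero_iff_mem.2 hfi, map_zero]
  obtain ⟨y, hy⟩ := (B.exact_pairingK_reducedJacobian hW hf ht hB hr hp _).1 h0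
  obtain ⟨δ, rfl⟩ := exists_eq_one_tmul _ y
  refine ⟨1 ⊗ₜ δ, coinvariants_derivation_ext fun k => ?_⟩
  rw [augmentation_apply, ← hθ, Ideal.Quotient.eq]
  rw [LinearMap.baseChange_tmul, ← sub_eq_zero, ← TensorProduct.tmul_sub,
    one_tmul_eq_zero_iff _ (derBasis n)] at hy
  exact hy k

theorem isPeriodicMinimalFreeResolution [Fintype W] (B : DualityBases W)
    (hW : IsIrreducibleReflectionGroup W)
    (hf : IsBasicInvariants W f) (ht : ∀ i, (f i).totalDegree ≤ (f t).totalDegree)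
    (hB : ∀ i j, dualityPairing hf t (B.φ j) (B.σ i) = if i = j then 1 else 0)
    (hr : Function.Bijective (restrictDer W)) (hp : Function.Bijective (pairingMap hf t))
    (hK : ∀ δ : Derivation ℂ (invariantRing W) (PolyRing n), ∀ p ∈ hilbertIdeal W,
      pairingK hf t hp δ p ∈ hilbertIdeal W) :
    IsPeriodicMinimalFreeResolution (irrelevant W)
      ((reducedJacobian hr).baseChange (Coinvariants W))
      ((pairingK hf t hp).baseChange (Coinvariants W)) (augmentation hf hp hK) := by
  let b := Algebra.TensorProduct.basis (Coinvariants W) (derBasis n)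
  let c := Algebra.TensorProduct.basis (Coinvariants W) (B.derInvBasis hf)
  have hex := B.exact_reducedJacobian_pairingK hW hf ht hB hr hp
  refine ⟨Module.Free.of_basis c, Module.Free.of_basis b, Module.Finite.of_basis c,
    Module.Finite.of_basis b, B.augmentation_surjective hW hf ht hB hr hp hK,
    fun x => (augmentation_eq_zero_iff hf hp hK x).trans (hex x),
    B.exact_pairingK_reducedJacobian hW hf ht hB hr hp, hex, ?_, ?_⟩
  · refine range_le_of_toMatrix b c _ _ fun i j => ?_
    rw [LinearMap.toMatrix_baseChange, B.toMatrix_reducedJacobian hf hr]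
    exact B.jacMatrix_mem hW i j
  · refine range_le_of_toMatrix c b _ _ fun i j => ?_
    rw [LinearMap.toMatrix_baseChange, B.toMatrix_pairingK hf hB hp]
    exact B.fieldMatrix_mem i j

theorem augmentation_homogeneous [Fintype W] (B : DualityBases W) (hf : IsBasicInvariants W f)
    (ht : ∀ i, (f i).totalDegree ≤ (f t).totalDegree)
    (hB : ∀ i j, dualityPairing hf t (B.φ j) (B.σ i) = if i = j then 1 else 0)
    (hp : Function.Bijective (pairingMap hf t))
    (hK : ∀ δ : Derivation ℂ (invariantRing W) (PolyRing n), ∀ p ∈ hilbertIdeal W,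
      pairingK hf t hp δ p ∈ hilbertIdeal W) :
    IsHomogeneousMap (tensorPart (hilbertIdeal W) (derInvPart W))
      (derQuotPart (hilbertIdeal W)) (augmentation hf hp hK) (f t).totalDegree := by
  rintro k _ ⟨δ, hδ, rfl⟩ j _ ⟨p, hpj, rfl⟩
  exact ⟨_, B.pairingK_homogeneous hf ht hB hp k δ hδ j p hpj,
    (augmentation_apply hf hp hK δ p).symm⟩

end DualityBases

end

/-! ### The resolution of the Kähler differentials -/

section

variable {n : ℕ} {W : Subgroup (Matrix.GeneralLinearGroup (Fin n) ℂ)} {f : Fin n → PolyRing n}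

section Kaehler

/-- The map from the dual of a module to a module `M` given by vectors `x k` and elements `ω k` of
`M`, sending `l` to `∑ l(x k) ω k`. -/
def sumEvalSmul {A T M ι : Type*} [CommRing A] [AddCommGroup T] [Module A T] [AddCommGroup M]
    [Module A M] [Fintype ι] (x : ι → T) (ω : ι → M) : Module.Dual A T →ₗ[A] M where
  toFun l := ∑ k, l (x k) • ω k
  map_add' l l' := by simp only [LinearMap.add_apply, add_smul, Finset.sum_add_distrib]
  map_smul' c l := by
    simp only [LinearMap.smul_apply, smul_eq_mul, mul_smul, Finset.smul_sum, RingHom.id_apply]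

theorem sum_sum_mul_smul_eq_zero {A M ι κ : Type*} [CommRing A] [AddCommGroup M] [Module A M]
    [Fintype ι] [Fintype κ] (a : ι → κ → A) (u : κ → A) (ω : ι → M)
    (h : ∀ j, ∑ k, a k j • ω k = 0) : ∑ k, (∑ j, a k j * u j) • ω k = 0 := by
  simp_rw [Finset.sum_smul]
  rw [Finset.sum_comm]
  refine Finset.sum_eq_zero fun j _ => ?_
  simp_rw [mul_comm _ (u j), mul_smul]
  rw [← Finset.smul_sum, h, smul_zero]

theorem kaehler_D_eq_sum (I : Ideal (PolyRing n)) (p : PolyRing n) :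
    KaehlerDifferential.D ℂ (PolyRing n ⧸ I) (Ideal.Quotient.mk I p) =
      ∑ k, Ideal.Quotient.mk I (MvPolynomial.pderiv k p) •
        KaehlerDifferential.D ℂ (PolyRing n ⧸ I) (Ideal.Quotient.mk I (MvPolynomial.X k)) := by
  refine (derivation_apply_eq_sum
    ((KaehlerDifferential.D ℂ (PolyRing n ⧸ I)).compAlgebraMap (PolyRing n)) p).trans ?_
  refine Finset.sum_congr rfl fun k _ => ?_
  exact (algebraMap_smul (PolyRing n ⧸ I) (MvPolynomial.pderiv k p)
    (KaehlerDifferential.D ℂ (PolyRing n ⧸ I) (Ideal.Quotient.mk I (MvPolynomial.X k)))).symm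

/-- The relations between the differentials of the coordinates on `S / I` are the differentials of
the elements of `I`. -/
theorem exists_mem_of_sum_smul_D_eq_zero (I : Ideal (PolyRing n)) (l : Fin n → PolyRing n)
    (h : ∑ k, Ideal.Quotient.mk I (l k) •
      KaehlerDifferential.D ℂ (PolyRing n ⧸ I) (Ideal.Quotient.mk I (MvPolynomial.X k)) = 0) :
    ∃ p ∈ I, ∀ k, l k - MvPolynomial.pderiv k p ∈ I := by
  let ω : Ω[PolyRing n⁄ℂ] := ∑ k, l k • KaehlerDifferential.D ℂ (PolyRing n) (MvPolynomial.X k)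
  have h1 : KaehlerDifferential.mapBaseChange ℂ (PolyRing n) (PolyRing n ⧸ I) (1 ⊗ₜ ω) = 0 := by
    rw [KaehlerDifferential.mapBaseChange_tmul]
    refine (one_smul (PolyRing n ⧸ I)
      (KaehlerDifferential.map ℂ ℂ (PolyRing n) (PolyRing n ⧸ I) ω)).trans ?_
    rw [← h, map_sum]
    refine Finset.sum_congr rfl fun k _ => ?_
    rw [map_smul, KaehlerDifferential.map_D]
    exact (algebraMap_smul (PolyRing n ⧸ I) (l k)
      (KaehlerDifferential.D ℂ (PolyRing n ⧸ I) (Ideal.Quotient.mk I (MvPolynomial.X k)))).symm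
  obtain ⟨z, hz⟩ := (KaehlerDifferential.exact_kerCotangentToTensor_mapBaseChange ℂ (PolyRing n)
    (PolyRing n ⧸ I) Ideal.Quotient.mk_surjective _).1 h1
  obtain ⟨x, rfl⟩ := Ideal.toCotangent_surjective _ z
  refine ⟨x.1, Ideal.Quotient.eq_zero_iff_mem.1 x.2, fun k => ?_⟩
  rw [KaehlerDifferential.kerCotangentToTensor_toCotangent, eq_comm, ← sub_eq_zero,
    ← TensorProduct.tmul_sub,
    one_tmul_eq_zero_iff I (KaehlerDifferential.mvPolynomialBasis ℂ (Fin n))] at hz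
  have h2 := hz k
  rw [map_sub, Finsupp.sub_apply, KaehlerDifferential.mvPolynomialBasis_repr_apply, map_sum,
    Finsupp.finsetSum_apply] at h2
  simpa [Finsupp.single_apply] using h2

theorem evalDual_tmul (I : Ideal (PolyRing n)) (p : PolyRing n)
    (θ : Derivation ℂ (PolyRing n) (PolyRing n)) :
    evalDual I p (1 ⊗ₜ θ) = Ideal.Quotient.mk I (θ p) := by
  rw [evalDual, LinearMap.liftBaseChange_tmul, one_smul]
  rfl

theorem derBasis_apply (k : Fin n) (p : PolyRing n) :
    derBasis n k p = MvPolynomial.pderiv k p := by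
  rw [derivation_apply_eq_sum]
  simp [derBasis_apply_X]

/-- The map `ε'` from the dual of `A ⊗ Der(S, S)` to the differentials of `A`. -/
noncomputable def kaehlerAugmentation (I : Ideal (PolyRing n)) :
    Module.Dual (PolyRing n ⧸ I)
      ((PolyRing n ⧸ I) ⊗[PolyRing n] Derivation ℂ (PolyRing n) (PolyRing n)) →ₗ[PolyRing n ⧸ I]
        Ω[(PolyRing n ⧸ I)⁄ℂ] :=
  sumEvalSmul (fun k => 1 ⊗ₜ derBasis n k)
    fun k => KaehlerDifferential.D ℂ (PolyRing n ⧸ I) (Ideal.Quotient.mk I (MvPolynomial.X k))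

theorem kaehlerAugmentation_apply (I : Ideal (PolyRing n)) (l : Module.Dual (PolyRing n ⧸ I)
      ((PolyRing n ⧸ I) ⊗[PolyRing n] Derivation ℂ (PolyRing n) (PolyRing n))) :
    kaehlerAugmentation I l = ∑ k, l (1 ⊗ₜ derBasis n k) •
      KaehlerDifferential.D ℂ (PolyRing n ⧸ I) (Ideal.Quotient.mk I (MvPolynomial.X k)) := rfl

theorem kaehlerAugmentation_evalDual (I : Ideal (PolyRing n)) (p : PolyRing n) :
    kaehlerAugmentation I (evalDual I p) =
      KaehlerDifferential.D ℂ (PolyRing n ⧸ I) (Ideal.Quotient.mk I p) := by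
  rw [kaehlerAugmentation_apply, kaehler_D_eq_sum]
  simp only [evalDual_tmul, derBasis_apply]

theorem kaehlerAugmentation_surjective (I : Ideal (PolyRing n)) :
    Function.Surjective (kaehlerAugmentation I) := by
  rw [← LinearMap.range_eq_top, eq_top_iff, ← KaehlerDifferential.span_range_derivation,
    Submodule.span_le]
  rintro _ ⟨a, rfl⟩
  obtain ⟨p, rfl⟩ := Ideal.Quotient.mk_surjective a
  exact ⟨evalDual I p, kaehlerAugmentation_evalDual I p⟩

theorem kaehlerAugmentation_homogeneous (I : Ideal (PolyRing n)) :
    IsHomogeneousMap (dualPart I (tensorPart I (derPart n))) (kaehlerPart I)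
      (kaehlerAugmentation I) 0 := by
  intro k l hl
  rw [kaehlerAugmentation_apply, add_zero]
  refine Submodule.sum_mem _ fun i _ => Submodule.subset_span ⟨-1 + k, 1, by ring, _,
    hl (-1) _ ⟨derBasis n i, ?_, rfl⟩, _, ⟨_, X_mem_polyPart i, rfl⟩, rfl⟩
  refine mem_derPart fun j => ?_
  rw [derBasis_apply_X]
  split_ifs
  · simpa using one_mem_polyPart
  · exact zero_mem _

theorem dualMap_reducedJacobian_homogeneous (hr : Function.Bijective (restrictDer W))
    (h : IsHomogeneousMap (derPart n) (derInvPart W) (reducedJacobian hr) 0) :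
    IsHomogeneousMap
      (dualPart (hilbertIdeal W) (tensorPart (hilbertIdeal W) (derInvPart W)))
      (dualPart (hilbertIdeal W) (tensorPart (hilbertIdeal W) (derPart n)))
      ((reducedJacobian hr).baseChange (Coinvariants W)).dualMap 0 := by
  rintro k l hl j _ ⟨x, hx, rfl⟩
  have := hl _ (1 ⊗ₜ reducedJacobian hr x) ⟨_, h j x hx, rfl⟩
  rw [LinearMap.dualMap_apply, LinearMap.baseChange_tmul]
  rwa [show j + 0 + k = j + (k + 0) by ring] at this

theorem dualMap_pairingK_homogeneous {t : Fin n} (hf : IsBasicInvariants W f)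
    (hp : Function.Bijective (pairingMap hf t)) {d : ℤ}
    (h : IsHomogeneousMap (derInvPart W) (derPart n) (pairingK hf t hp) d) :
    IsHomogeneousMap
      (dualPart (hilbertIdeal W) (tensorPart (hilbertIdeal W) (derPart n)))
      (dualPart (hilbertIdeal W) (tensorPart (hilbertIdeal W) (derInvPart W)))
      ((pairingK hf t hp).baseChange (Coinvariants W)).dualMap d := by
  rintro k l hl j _ ⟨x, hx, rfl⟩
  have := hl _ (1 ⊗ₜ pairingK hf t hp x) ⟨_, h j x hx, rfl⟩
  rw [LinearMap.dualMap_apply, LinearMap.baseChange_tmul]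
  rwa [show j + d + k = j + (k + d) by ring] at this

end Kaehler

namespace DualityBases

variable (B : DualityBases W) {t : Fin n}

theorem toMatrix_dualMap_reducedJacobian [Fintype W] (hf : IsBasicInvariants W f)
    (hr : Function.Bijective (restrictDer W)) :
    LinearMap.toMatrix (Algebra.TensorProduct.basis (Coinvariants W) (B.derInvBasis hf)).dualBasis
      (Algebra.TensorProduct.basis (Coinvariants W) (derBasis n)).dualBasis
      ((reducedJacobian hr).baseChange (Coinvariants W)).dualMap =
      B.jacMatrix.transpose.map (Ideal.Quotient.mk (hilbertIdeal W)) := by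
  rw [toMatrix_dualMap, LinearMap.toMatrix_baseChange, B.toMatrix_reducedJacobian hf hr]
  rfl

theorem toMatrix_dualMap_pairingK [Fintype W] (hf : IsBasicInvariants W f)
    (hB : ∀ i j, dualityPairing hf t (B.φ j) (B.σ i) = if i = j then 1 else 0)
    (hp : Function.Bijective (pairingMap hf t)) :
    LinearMap.toMatrix (Algebra.TensorProduct.basis (Coinvariants W) (derBasis n)).dualBasis
      (Algebra.TensorProduct.basis (Coinvariants W) (B.derInvBasis hf)).dualBasis
      ((pairingK hf t hp).baseChange (Coinvariants W)).dualMap =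
      B.fieldMatrix.transpose.map (Ideal.Quotient.mk (hilbertIdeal W)) := by
  rw [toMatrix_dualMap, LinearMap.toMatrix_baseChange, B.toMatrix_pairingK hf hB hp]
  rfl

/-- The kernel of `ε'` consists of the differentials of elements of the Hilbert ideal, which modulo
this ideal are spanned by the `σ_j`. -/
theorem exact_kaehlerAugmentation [Fintype W] (B : DualityBases W)
    (hf : IsBasicInvariants W f) (hr : Function.Bijective (restrictDer W)) :
    Function.Exact ((reducedJacobian hr).baseChange (Coinvariants W)).dualMap
      (kaehlerAugmentation (hilbertIdeal W)) := by
  let b := Algebra.TensorProduct.basis (Coinvariants W) (derBasis n)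
  let c := Algebra.TensorProduct.basis (Coinvariants W) (B.derInvBasis hf)
  let mk := Ideal.Quotient.mk (hilbertIdeal W)
  let dX : Fin n → Ω[(Coinvariants W)⁄ℂ] := fun k =>
    KaehlerDifferential.D ℂ (Coinvariants W) (mk (MvPolynomial.X k))
  have hb : ∀ k, b k = (1 : Coinvariants W) ⊗ₜ[PolyRing n] derBasis n k := fun k =>
    Algebra.TensorProduct.basis_apply (derBasis n) k
  have hcoord : ∀ l' : Module.Dual (Coinvariants W) (Coinvariants W ⊗[PolyRing n]
      Derivation ℂ (invariantRing W) (PolyRing n)), ∀ k,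
      ((reducedJacobian hr).baseChange (Coinvariants W)).dualMap l' (1 ⊗ₜ derBasis n k) =
        ∑ j, mk (B.jacMatrix j k) * l' (c j) := by
    intro l' k
    have h1 := congrFun (LinearMap.toMatrix_mulVec_repr c.dualBasis b.dualBasis
      ((reducedJacobian hr).baseChange (Coinvariants W)).dualMap l') k
    rw [B.toMatrix_dualMap_reducedJacobian hf hr, b.dualBasis_repr] at h1
    rw [← hb, ← h1]
    simp only [Matrix.mulVec, dotProduct, c.dualBasis_repr]
    rfl
  intro l
  constructor
  · intro hl
    choose p hp using fun k => Ideal.Quotient.mk_surjective (I := hilbertIdeal W)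
      (l (1 ⊗ₜ derBasis n k))
    rw [kaehlerAugmentation_apply] at hl
    simp only [← hp] at hl
    obtain ⟨q, hq, hpq⟩ := exists_mem_of_sum_smul_D_eq_zero _ p hl
    obtain ⟨a, ha⟩ := (mem_hilbertIdeal_iff hf).1 hq
    obtain ⟨s, -, -, hexp⟩ := B.exists_expansion hf
    refine ⟨c.dualBasis.equivFun.symm fun j => mk (∑ i, a i * s i j), b.ext fun k => ?_⟩
    rw [hb, hcoord, ← hp, Ideal.Quotient.eq.2 (hpq k)]
    have h2 : ∀ j, (c.dualBasis.equivFun.symm fun j => mk (∑ i, a i * s i j)) (c j) =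
        mk (∑ i, a i * s i j) := by
      intro j
      rw [← c.dualBasis_repr, ← Module.Basis.equivFun_apply, LinearEquiv.apply_symm_apply]
    simp only [h2, ← map_mul, ← map_sum]
    refine Ideal.Quotient.eq.2 ?_
    have h3 : MvPolynomial.pderiv k q = ∑ j, B.jacMatrix j k * ∑ i, a i * s i j +
        ∑ i, f i * MvPolynomial.pderiv k (a i) := by
      rw [ha, map_sum]
      simp only [Derivation.leibniz, smul_eq_mul, Finset.sum_add_distrib]
      rw [add_comm]
      congr 1
      simp only [← differential_single, hexp, Finset.mul_sum]
      rw [Finset.sum_comm]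
      refine Finset.sum_congr rfl fun j _ => Finset.sum_congr rfl fun i _ => ?_
      rw [jacMatrix, Matrix.of_apply]
      ring
    rw [h3, sub_add_cancel_left]
    refine neg_mem (Submodule.sum_mem _ fun i _ => Ideal.mul_mem_right _ _ ?_)
    exact Ideal.subset_span ⟨hf.mem_invariantRing i, hf.constantCoeff_eq_zero i⟩
  · rintro ⟨l', rfl⟩
    have h0 : ∀ j, ∑ k, B.jacMatrix j k • dX k = 0 := by
      intro j
      have := B.jacMatrix_mem_of_differential_mem hf
        (⊥ : Submodule (PolyRing n) Ω[(Coinvariants W)⁄ℂ])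
        (fun p hp r => by
          rw [Submodule.mem_bot, ← algebraMap_smul (Coinvariants W) p r]
          exact (congrArg (· • r) (Ideal.Quotient.eq_zero_iff_mem.2 hp)).trans 
            (zero_smul (Coinvariants W) r)) dX
        (fun i => by
          have hfi : mk (f i) = 0 := Ideal.Quotient.eq_zero_iff_mem.2
            (Ideal.subset_span ⟨hf.mem_invariantRing i, hf.constantCoeff_eq_zero i⟩)
          have h1 := kaehler_D_eq_sum (hilbertIdeal W) (f i)
          rw [show Ideal.Quotient.mk (hilbertIdeal W) (f i) = 0 from hfi, map_zero] at h1
          rw [Submodule.mem_bot, h1]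
          refine Finset.sum_congr rfl fun k _ => ?_
          exact (algebraMap_smul (Coinvariants W) (MvPolynomial.pderiv k (f i)) (dX k)).symm) j
      exact (Submodule.mem_bot _).1 this
    rw [kaehlerAugmentation_apply]
    simp only [hcoord]
    refine sum_sum_mul_smul_eq_zero (fun k j => mk (B.jacMatrix j k)) (fun j => l' (c j)) dX
      fun j => ?_
    rw [← h0 j]
    exact Finset.sum_congr rfl fun k _ =>
      algebraMap_smul (Coinvariants W) (B.jacMatrix j k) (dX k)

theorem dual_isPeriodicMinimalFreeResolution [Fintype W] (B : DualityBases W)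
    (hW : IsIrreducibleReflectionGroup W)
    (hf : IsBasicInvariants W f) (ht : ∀ i, (f i).totalDegree ≤ (f t).totalDegree)
    (hB : ∀ i j, dualityPairing hf t (B.φ j) (B.σ i) = if i = j then 1 else 0)
    (hr : Function.Bijective (restrictDer W)) (hp : Function.Bijective (pairingMap hf t)) :
    IsPeriodicMinimalFreeResolution (irrelevant W)
      ((reducedJacobian hr).baseChange (Coinvariants W)).dualMap
      ((pairingK hf t hp).baseChange (Coinvariants W)).dualMap
      (kaehlerAugmentation (hilbertIdeal W)) := by
  let b := (Algebra.TensorProduct.basis (Coinvariants W) (derBasis n)).dualBasis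
  let c := (Algebra.TensorProduct.basis (Coinvariants W) (B.derInvBasis hf)).dualBasis
  have hJ := B.toMatrix_dualMap_reducedJacobian hf hr
  have hK := B.toMatrix_dualMap_pairingK hf hB hp
  refine ⟨Module.Free.of_basis b, Module.Free.of_basis c, Module.Finite.of_basis b,
    Module.Finite.of_basis c, kaehlerAugmentation_surjective _, B.exact_kaehlerAugmentation hf hr,
    ?_, ?_, ?_, ?_⟩
  · refine exact_of_toMatrix c b _ _ ?_
    rw [hJ, hK]
    exact B.jacMatrix_transpose_mulVec_eq_zero_iff hW hf ht hB
  · refine exact_of_toMatrix b c _ _ ?_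
    rw [hJ, hK]
    exact B.fieldMatrix_transpose_mulVec_eq_zero_iff hW hf ht hB
  · refine range_le_of_toMatrix c b _ _ fun i j => ?_
    rw [hJ]
    exact B.jacMatrix_mem hW j i
  · refine range_le_of_toMatrix b c _ _ fun i j => ?_
    rw [hK]
    exact B.fieldMatrix_mem j i

end DualityBases

end

end WellGenerated

open WellGenerated in
theorem theorem2 {n : ℕ} (W : Subgroup (Matrix.GeneralLinearGroup (Fin n) ℂ))
    (hW : IsIrreducibleReflectionGroup W) (hdual : IsDualityGroup W)
    (f : Fin n → PolyRing n) (hf : IsBasicInvariants W f)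
    (t : Fin n) (ht : ∀ i, (f i).totalDegree ≤ (f t).totalDegree) :
    ∃ (hr : Function.Bijective (restrictDer W)) (hp : Function.Bijective (pairingMap hf t)),
      -- the matrix factorisation of `f_t` over `S / (f_i : i ≠ t)`
      (IsMatrixFactorisation (Ideal.Quotient.mk (otherInvariantsIdeal f t) (f t))
          ((reducedJacobian hr).baseChange (PolyRing n ⧸ otherInvariantsIdeal f t))
          ((pairingK hf t hp).baseChange (PolyRing n ⧸ otherInvariantsIdeal f t)) ∧
        IsHomogeneousMap (tensorPart (otherInvariantsIdeal f t) (derPart n))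
          (tensorPart (otherInvariantsIdeal f t) (derInvPart W))
          ((reducedJacobian hr).baseChange (PolyRing n ⧸ otherInvariantsIdeal f t)) 0 ∧
        IsHomogeneousMap (tensorPart (otherInvariantsIdeal f t) (derInvPart W))
          (tensorPart (otherInvariantsIdeal f t) (derPart n))
          ((pairingK hf t hp).baseChange (PolyRing n ⧸ otherInvariantsIdeal f t))
          (f t).totalDegree) ∧
      -- the resolution of `Der(A, A)`
      (∃ ε : (Coinvariants W ⊗[PolyRing n] Derivation ℂ (invariantRing W) (PolyRing n)) →ₗ[Coinvariants W]
          Derivation ℂ (Coinvariants W) (Coinvariants W),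
        (∀ (δ : Derivation ℂ (invariantRing W) (PolyRing n)) (p : PolyRing n),
          ε (1 ⊗ₜ δ) (Ideal.Quotient.mk (hilbertIdeal W) p) =
            Ideal.Quotient.mk (hilbertIdeal W) (pairingK hf t hp δ p)) ∧
        IsPeriodicMinimalFreeResolution (irrelevant W)
          ((reducedJacobian hr).baseChange (Coinvariants W))
          ((pairingK hf t hp).baseChange (Coinvariants W)) ε ∧
        IsHomogeneousMap (tensorPart (hilbertIdeal W) (derPart n))
          (tensorPart (hilbertIdeal W) (derInvPart W))
          ((reducedJacobian hr).baseChange (Coinvariants W)) 0 ∧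
        IsHomogeneousMap (tensorPart (hilbertIdeal W) (derInvPart W))
          (tensorPart (hilbertIdeal W) (derPart n))
          ((pairingK hf t hp).baseChange (Coinvariants W)) (f t).totalDegree ∧
        IsHomogeneousMap (tensorPart (hilbertIdeal W) (derInvPart W))
          (derQuotPart (hilbertIdeal W)) ε (f t).totalDegree) ∧
      -- the dual resolution, of the Kähler differentials of `A`
      (∃ ε : Module.Dual (Coinvariants W)
            (Coinvariants W ⊗[PolyRing n] Derivation ℂ (PolyRing n) (PolyRing n)) →ₗ[Coinvariants W]
          Ω[(Coinvariants W)⁄ℂ],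
        (∀ p : PolyRing n, ε (evalDual (hilbertIdeal W) p) =
          KaehlerDifferential.D ℂ (Coinvariants W) (Ideal.Quotient.mk (hilbertIdeal W) p)) ∧
        IsPeriodicMinimalFreeResolution (irrelevant W)
          ((reducedJacobian hr).baseChange (Coinvariants W)).dualMap
          ((pairingK hf t hp).baseChange (Coinvariants W)).dualMap ε ∧
        IsHomogeneousMap
          (dualPart (hilbertIdeal W) (tensorPart (hilbertIdeal W) (derInvPart W)))
          (dualPart (hilbertIdeal W) (tensorPart (hilbertIdeal W) (derPart n)))
          ((reducedJacobian hr).baseChange (Coinvariants W)).dualMap 0 ∧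
        IsHomogeneousMap
          (dualPart (hilbertIdeal W) (tensorPart (hilbertIdeal W) (derPart n)))
          (dualPart (hilbertIdeal W) (tensorPart (hilbertIdeal W) (derInvPart W)))
          ((pairingK hf t hp).baseChange (Coinvariants W)).dualMap (f t).totalDegree ∧
        IsHomogeneousMap
          (dualPart (hilbertIdeal W) (tensorPart (hilbertIdeal W) (derPart n)))
          (kaehlerPart (hilbertIdeal W)) ε 0) := by
  have := hW.finite
  have := Fintype.ofFinite W
  obtain ⟨B₀⟩ := hdual.exists_bases
  obtain ⟨B, hB⟩ := B₀.exists_dual hW hf ht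
  have hr := B.restrictDer_bijective hf
  have hp := B.pairingMap_bijective hf hB
  have hK : ∀ δ : Derivation ℂ (invariantRing W) (PolyRing n), ∀ p ∈ hilbertIdeal W,
      pairingK hf t hp δ p ∈ hilbertIdeal W :=
    fun δ p h => B.pairingK_mem_hilbertIdeal hf hB hp δ h
  have hJ0 := B.reducedJacobian_homogeneous hf hr
  have hKd := B.pairingK_homogeneous hf ht hB hp
  refine ⟨hr, hp, ⟨?_, ?_, ?_⟩, ⟨DualityBases.augmentation hf hp hK, ?_, ?_, ?_, ?_, ?_⟩,
    ⟨kaehlerAugmentation (hilbertIdeal W), ?_, ?_, ?_, ?_, ?_⟩⟩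
  · exact B.isMatrixFactorisation hW hf ht hB hr hp
  · exact hJ0.baseChange _
  · exact hKd.baseChange _
  · exact DualityBases.augmentation_apply hf hp hK
  · exact B.isPeriodicMinimalFreeResolution hW hf ht hB hr hp hK
  · exact hJ0.baseChange _
  · exact hKd.baseChange _
  · exact B.augmentation_homogeneous hf ht hB hp hK
  · exact kaehlerAugmentation_evalDual _
  · exact B.dual_isPeriodicMinimalFreeResolution hW hf ht hB hr hp
  · exact dualMap_reducedJacobian_homogeneous hr hJ0
  · exact dualMap_pairingK_homogeneous hf hp hKd
  · exact kaehlerAugmentation_homogeneous _
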